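/- Let $\Sigma$ be the (reduced, crystallographic) root system of type $E_8$, with Weyl group $W$, bracket $(\alpha|\beta)=2(\alpha,\beta)/(\beta,\beta)$, and simple roots $\alpha_1,\dots,\alpha_8$ in Bourbaki's numbering. A *subsystem* of $\Sigma$ is a subset $\widetilde\Sigma$ that is a root system in its span and contains $\alpha+\beta$ whenever $\alpha,\beta\in\widetilde\Sigma$ and $\alpha+\beta\in\Sigma$. A *$\Pi$-system* is a basis (set of simple roots) of a subsystem. Two sets of roots are *isomorphic* if there is a bijection between them preserving $(\cdot|\cdot)$, and *conjugate* if some $w\in W$ maps one onto the other. A $\Pi$-system is *special* if it is isomorphic to some $\Pi$-system that is not conjugate to it. The *diagram* of a set of roots joins two distinct roots by an edge if they are not orthogonal; a set of roots is *irreducible* if its diagram is connected, and its *irreducible components* are its maximal irreducible subsets. An orthogonal subset $O$ of an irreducible set $X$ is a *perfect moset* of $X$ if no element of $X\setminus O$ is orthogonal to $O$, the set $X\setminus O$ is orthogonal, and $|O|\ge|X\setminus O|$. A perfect moset of an arbitrary $X$ is a union of perfect mosets, one for each irreducible component of $X$. The *charge* of a $\Pi$-system is the cardinality of its perfect mosets.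 Let $M$ be the set of eight mutually orthogonal roots, labelled by the vectors of $\mathbb F_2^3$ as follows: $\alpha_2\mapsto 100$, $\alpha_3\mapsto 010$, $\alpha_5\mapsto 001$, $\alpha_7\mapsto 101$, and the highest roots of the subsystems of types $D_4$, $D_6$, $E_7$, $E_8$ with bases $\{\alpha_2,\dots,\alpha_5\}$, $\{\alpha_2,\dots,\alpha_7\}$, $\{\alpha_1,\dots,\alpha_7\}$, $\{\alpha_1,\dots,\alpha_8\}$ are labelled $111$, $011$, $110$, $000$ respectively. The *parity* of a subset of $M$ is $0$ if its labels sum to $000$, and $1$ otherwise; the parity of a set $O$ of four mutually orthogonal roots is the parity of any subset of $M$ conjugate to $O$ (such a subset exists, and its parity does not depend on the choice). The *parity* of a $\Pi$-system of charge $4$ is the parity of its perfect mosets. **Theorem 4.6.** A $\Pi$-system in $E_8$ is special if and only if it is of one of the types $$A_7,\quad A_5+A_1,\quad 2A_3,\quad A_3+2A_1,\quad 4A_1.$$ Every special $\Pi$-system has charge $4$. For each of these five types, the $\Pi$-systems of that type form exactly two Weyl orbits: one consists of $\Pi$-systems of parity $0$ and the other of $\Pi$-systems of parity $1$. -/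

import Mathlib

namespace PiSystem

open Set

variable {ι M N : Type*} [AddCommGroup M] [Module ℝ M] [AddCommGroup N] [Module ℝ N]

/-! Sets of roots of a root system `P` are represented by sets of indices `Λ : Set ι`; the bracket
`(α|β) = 2(α,β)/(β,β)` of the roots `α = P.root i`, `β = P.root j` is `P.pairing i j`. -/

section General

variable (P : RootPairing ι ℝ M N)

/-- A subsystem: a set of roots which is a root system in its span (that is, stable under its own
reflections) and which is closed under those sums of two of its elements that are roots. -/
def IsSubsystem (Ψ : Set ι) : Prop :=
  (∀ i ∈ Ψ, ∀ j ∈ Ψ, P.reflectionPerm i j ∈ Ψ) ∧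
    ∀ i ∈ Ψ, ∀ j ∈ Ψ, ∀ k, P.root i + P.root j = P.root k → k ∈ Ψ

/-- `Λ` is a basis of the subsystem `Ψ`: it is a linearly independent subset of `Ψ`, and every
element of `Ψ` is a combination of elements of `Λ` with all coefficients non-negative integers
or all coefficients non-positive integers. -/
def IsBasisOf (Λ Ψ : Set ι) : Prop :=
  Λ ⊆ Ψ ∧ LinearIndepOn ℝ P.root Λ ∧
    ∀ i ∈ Ψ, P.root i ∈ AddSubmonoid.closure (P.root '' Λ) ∨
      -P.root i ∈ AddSubmonoid.closure (P.root '' Λ)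

/-- A `Π`-system: a basis of some subsystem. -/
def IsPiSystem (Λ : Set ι) : Prop :=
  ∃ Ψ : Set ι, IsSubsystem P Ψ ∧ IsBasisOf P Λ Ψ

/-- Isomorphic sets of roots: there is a bijection between them preserving the bracket. -/
def IsIsomorphic (Λ Λ' : Set ι) : Prop :=
  ∃ f : Λ ≃ Λ', ∀ x y : Λ, P.pairing (f x) (f y) = P.pairing x y

/-- Conjugate sets of roots: some element of the Weyl group maps one onto the other. -/
def IsConjugate (Λ Λ' : Set ι) : Prop :=
  ∃ w : P.weylGroup, P.weylGroupToPerm w '' Λ = Λ'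

/-- The Weyl orbit of a set of roots. -/
def weylOrbit (Λ : Set ι) : Set (Set ι) :=
  {Λ' | IsConjugate P Λ Λ'}

/-- A special `Π`-system: one that is isomorphic to some `Π`-system not conjugate to it. -/
def IsSpecial (Λ : Set ι) : Prop :=
  IsPiSystem P Λ ∧ ∃ Λ', IsPiSystem P Λ' ∧ IsIsomorphic P Λ Λ' ∧ ¬ IsConjugate P Λ Λ'

/-- `Λ` is of type `A_{n₁} + ⋯ + A_{n_k}`, where `τ = [n₁, …, n_k]`. -/
def HasTypeA [P.IsCrystallographic] (Λ : Set ι) (τ : List ℕ) : Prop :=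
  ∃ f : (Σ t : Fin τ.length, Fin (τ.get t)) ≃ Λ, ∀ x y,
    P.pairingIn ℤ (f x) (f y) =
      Matrix.blockDiagonal' (fun t : Fin τ.length => CartanMatrix.A (τ.get t)) x y

/-- The diagram on all roots: two distinct roots are neighbors if they are not orthogonal. -/
def diagram : SimpleGraph ι :=
  SimpleGraph.fromRel fun i j => P.pairing i j ≠ 0

/-- A set of roots is irreducible if its diagram is connected. -/
def IsIrreducible (X : Set ι) : Prop :=
  ((diagram P).induce X).Connected

/-- Irreducible components are the maximal irreducible subsets. -/
def IsComponent (C X : Set ι) : Prop :=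
  Maximal (fun Y => Y ⊆ X ∧ IsIrreducible P Y) C

/-- A set of pairwise orthogonal roots. -/
def IsOrthogonalSet (O : Set ι) : Prop :=
  ∀ i ∈ O, ∀ j ∈ O, i ≠ j → P.pairing i j = 0

/-- A moset in `X`: an orthogonal subset `O` of `X` such that no element of `X \ O` is orthogonal
to `O`. -/
def IsMoset (O X : Set ι) : Prop :=
  O ⊆ X ∧ IsOrthogonalSet P O ∧ ∀ i ∈ X \ O, ∃ j ∈ O, P.pairing i j ≠ 0

/-- A perfect moset `O` of an arbitrary set `X`: it meets every irreducible component `C` of `X` in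
a moset `O ∩ C` of `C` whose complement in `C` is orthogonal and not larger than `O ∩ C`. -/
def IsPerfectMoset (O X : Set ι) : Prop :=
  O ⊆ X ∧ ∀ C, IsComponent P C X →
    IsMoset P (O ∩ C) C ∧ IsOrthogonalSet P (C \ O) ∧ (C \ O).ncard ≤ (O ∩ C).ncard

/-- The charge of `Λ` is `c`: perfect mosets of `Λ` exist and all of them have `c` elements. -/
def HasCharge (Λ : Set ι) (c : ℕ) : Prop :=
  (∃ O, IsPerfectMoset P O Λ) ∧ ∀ O, IsPerfectMoset P O Λ → O.ncard = c

end General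

/-! ### Parity in the root system of type `E₈` -/

section E8

/-- A standard moset of `E₈`, in coordinates with respect to the simple roots (in Bourbaki's
numbering): the simple roots `α₂`, `α₃`, `α₅`, `α₇`, and the highest roots of the subsystems of types
`D₄`, `D₆`, `E₇`, `E₈` whose bases are `α₂,…,α₅`, `α₂,…,α₇`, `α₁,…,α₇` and `α₁,…,α₈`.
These are, up to sign, the elements of the distinguished moset in the enhanced basis of `E₈`. -/
def mosetCoeff : Fin 8 → Fin 8 → ℤ :=
  ![![0, 1, 0, 0, 0, 0, 0, 0],
    ![0, 0, 1, 0, 0, 0, 0, 0],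
    ![0, 0, 0, 0, 1, 0, 0, 0],
    ![0, 0, 0, 0, 0, 0, 1, 0],
    ![0, 1, 1, 2, 1, 0, 0, 0],
    ![0, 1, 1, 2, 2, 2, 1, 0],
    ![2, 2, 3, 4, 3, 2, 1, 0],
    ![2, 3, 4, 6, 5, 4, 3, 2]]

/-- The labels of the elements of the standard moset, running through all vectors of `𝔽₂³`. -/
def mosetLabel : Fin 8 → Fin 3 → ZMod 2 :=
  ![![1, 0, 0], ![0, 1, 0], ![0, 0, 1], ![1, 0, 1],
    ![1, 1, 1], ![0, 1, 1], ![1, 1, 0], ![0, 0, 0]]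

/-- The parity of a subset of the standard moset: `0` if its labels sum to zero, `1` otherwise. -/
def mosetParity (S : Finset (Fin 8)) : ZMod 2 :=
  if ∑ s ∈ S, mosetLabel s = 0 then 0 else 1

variable (P : RootPairing ι ℝ M N) {b : P.Base} (e : Fin 8 ≃ b.support)

/-- The elements of the standard moset as vectors; `e` numbers the simple roots. -/
noncomputable def mosetRoot (s : Fin 8) : M :=
  ∑ k, mosetCoeff s k • P.root (e k)

/-- The element `w` of the Weyl group maps the set of roots `O` onto the subset of the standard moset
given by `S`. -/
def MapsOntoMoset (w : P.weylGroup) (O : Set ι) (S : Finset (Fin 8)) : Prop :=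
  P.root '' (P.weylGroupToPerm w '' O) = mosetRoot P e '' S

/-- The orthogonal set `O` has (well-defined) parity `ε`: it is conjugate to a subset of the standard
moset, and every such subset has parity `ε`. -/
def HasOrthogonalParity (O : Set ι) (ε : ZMod 2) : Prop :=
  (∃ w S, MapsOntoMoset P e w O S) ∧ ∀ w S, MapsOntoMoset P e w O S → mosetParity S = ε

/-- `Λ` has parity `ε`: perfect mosets of `Λ` exist and all of them have parity `ε`. -/
def HasParity (Λ : Set ι) (ε : ZMod 2) : Prop :=
  (∃ O, IsPerfectMoset P O Λ) ∧ ∀ O, IsPerfectMoset P O Λ → HasOrthogonalParity P e O ε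

/-- The types `A₇`, `A₅ + A₁`, `2A₃`, `A₃ + 2A₁` and `4A₁`. -/
def specialTypes : List (List ℕ) :=
  [[7], [5, 1], [3, 3], [3, 1, 1], [1, 1, 1, 1]]

end E8

end PiSystem

/-!
Everything is done in the root lattice of `E₈`, identified with `Fin 8 → ℤ` by the simple roots: the
roots are the vectors with `quad a = 1`, and a `Π`-system is a linearly independent set of roots with
nonpositive products (`IsObtuseBasis`, `IsCoordinates.isPiSystem_iff`).

Whether two `Π`-systems are conjugate is decided modulo `2`. Reduction modulo `2` identifies the pairs
of opposite roots with the nonsingular vectors of a nondegenerate quadratic form over `𝔽₂`, and Witt's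
theorem holds for the Weyl group acting there (`exists_weyl_red_eq`, proved with Siegel
transformations, which are products of transvections). So two families of roots with the same
Cartan matrix and the same linear relations modulo `2` are conjugate up to signs. For bases, the
signs can be corrected: the members with the wrong sign are orthogonal to the others, and the
longest element of the Weyl group they generate takes their set to its opposite and fixes the others
(`exists_weyl_neg`, `exists_weyl_image_eq`).

It remains to compare the relations modulo `2`, which we call words, of two bases `a` and `b` with the
same Cartan matrix. Words form a doubly even code, because half of the sum of a word is a lattice
vector. Every vertex of the diagram has evenly many neighbors in a word; as the diagram is a
forest, there are no edges within a word or between two words. Totally isotropic subspaces have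
dimension at most `4`, so any five mutually orthogonal roots contain a word, which then has four
elements. If some five mutually orthogonal indices contain different words of `a` and `b`, these words
differ by exchanging two indices, and this exchange is a symmetry of the diagram which makes more
words common (`exists_perm_of_ne`). Iterating, `a` and `b` become conjugate, unless one of them has as
its only nonempty word a set `O` of four elements and the other has none (`exists_perm_or_exceptional`).
In the exceptional case, every vertex outside of `O` has exactly two neighbors in `O`, and can be regarded
as an edge on the vertex set `O`. Since affine diagrams do not occur, the graph so obtained is part of
a path, and so the diagram consists of the even vertices `0`, `2`, `4`, `6` of the chain `A₇`, which form
`O`, and of some of the odd vertices (`exists_isSubchain`). These are the five special types.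

Conversely, for these types the even vertices form the only perfect moset
(`IsCoordinates.isPerfectMoset_iff`), which has four elements, and the only possible nonempty word
(`IsSubchain.isWord_eq`). So there are at most two orbits, according to whether the moset is a word. This
is what the parity records, since the words with four elements in the standard moset are the sets of
labels with sum zero (`isWord_mosetCoeff`). Both cases occur: it suffices to find them for `A₇`, by
`chainCoeff`.
-/

namespace PiSystem

open Finset

/-! ### The root lattice of `E₈` and its reduction modulo two -/

section Lattice

variable {R : Type*} [CommRing R]

/-- The symmetric bilinear form of the root lattice of `E₈`, in coordinates with respect to the
simple roots, over any commutative ring. -/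
def form : LinearMap.BilinForm R (Fin 8 → R) :=
  LinearMap.mk₂ R (fun a b =>
    2 * (a 0 * b 0 + a 1 * b 1 + a 2 * b 2 + a 3 * b 3 + a 4 * b 4 + a 5 * b 5 + a 6 * b 6
      + a 7 * b 7)
    - (a 0 * b 2 + a 2 * b 0 + a 1 * b 3 + a 3 * b 1 + a 2 * b 3 + a 3 * b 2 + a 3 * b 4
      + a 4 * b 3 + a 4 * b 5 + a 5 * b 4 + a 5 * b 6 + a 6 * b 5 + a 6 * b 7 + a 7 * b 6))
    (by intros; simp only [Pi.add_apply]; ring)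
    (by intros; simp only [Pi.smul_apply, smul_eq_mul]; ring)
    (by intros; simp only [Pi.add_apply]; ring)
    (by intros; simp only [Pi.smul_apply, smul_eq_mul]; ring)

theorem form_apply (a b : Fin 8 → R) : form a b =
    2 * (a 0 * b 0 + a 1 * b 1 + a 2 * b 2 + a 3 * b 3 + a 4 * b 4 + a 5 * b 5 + a 6 * b 6
      + a 7 * b 7)
    - (a 0 * b 2 + a 2 * b 0 + a 1 * b 3 + a 3 * b 1 + a 2 * b 3 + a 3 * b 2 + a 3 * b 4
      + a 4 * b 3 + a 4 * b 5 + a 5 * b 4 + a 5 * b 6 + a 6 * b 5 + a 6 * b 7 + a 7 * b 6) := rfl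

/-- The quadratic form of the root lattice of `E₈`, normalized so that the roots are the vectors
with value `1`. -/
def quad (a : Fin 8 → R) : R :=
  a 0 ^ 2 + a 1 ^ 2 + a 2 ^ 2 + a 3 ^ 2 + a 4 ^ 2 + a 5 ^ 2 + a 6 ^ 2 + a 7 ^ 2
    - (a 0 * a 2 + a 1 * a 3 + a 2 * a 3 + a 3 * a 4 + a 4 * a 5 + a 5 * a 6 + a 6 * a 7)

theorem form_comm (a b : Fin 8 → R) : form a b = form b a := by
  simp only [form_apply]; ring

theorem form_self (a : Fin 8 → R) : form a a = 2 * quad a := by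
  simp only [form_apply, quad]; ring

theorem quad_add (a b : Fin 8 → R) : quad (a + b) = quad a + quad b + form a b := by
  simp only [form_apply, quad, Pi.add_apply]; ring

theorem quad_smul (c : R) (a : Fin 8 → R) : quad (c • a) = c ^ 2 * quad a := by
  simp only [quad, Pi.smul_apply, smul_eq_mul]; ring

theorem quad_neg (a : Fin 8 → R) : quad (-a) = quad a := by
  simp only [quad, Pi.neg_apply]; ring

theorem quad_zero : quad (0 : Fin 8 → R) = 0 := by simp [quad]

theorem quad_sub (a b : Fin 8 → R) : quad (a - b) = quad a + quad b - form a b := by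
  simp only [form_apply, quad, Pi.sub_apply]; ring

theorem form_single (k l : Fin 8) :
    form (Pi.single k 1) (Pi.single l (1 : ℤ)) = CartanMatrix.E₈ k l := by
  fin_cases k <;> fin_cases l <;> rfl

end Lattice

/-- The lattice is positive definite. -/
theorem eq_zero_of_quad_nonpos {a : Fin 8 → ℤ} (h : quad a ≤ 0) : a = 0 := by
  -- Completing squares along the branches of the diagram towards its branch node.
  have key : 120 * quad a = 30 * (2 * a 0 - a 2) ^ 2 + 10 * (3 * a 2 - 2 * a 3) ^ 2
      + 30 * (2 * a 1 - a 3) ^ 2 + 30 * (2 * a 7 - a 6) ^ 2 + 10 * (3 * a 6 - 2 * a 5) ^ 2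
      + 5 * (4 * a 5 - 3 * a 4) ^ 2 + 3 * (5 * a 4 - 4 * a 3) ^ 2 + 2 * a 3 ^ 2 := by
    simp only [quad]; ring
  have h1 := sq_nonneg (2 * a 0 - a 2)
  have h2 := sq_nonneg (3 * a 2 - 2 * a 3)
  have h3 := sq_nonneg (2 * a 1 - a 3)
  have h4 := sq_nonneg (2 * a 7 - a 6)
  have h5 := sq_nonneg (3 * a 6 - 2 * a 5)
  have h6 := sq_nonneg (4 * a 5 - 3 * a 4)
  have h7 := sq_nonneg (5 * a 4 - 4 * a 3)
  have h8 := sq_nonneg (a 3)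
  have e8 : a 3 = 0 := pow_eq_zero_iff two_ne_zero |>.1 (by linarith)
  have e7 := pow_eq_zero_iff two_ne_zero |>.1 (show (5 * a 4 - 4 * a 3) ^ 2 = 0 by linarith)
  have e6 := pow_eq_zero_iff two_ne_zero |>.1 (show (4 * a 5 - 3 * a 4) ^ 2 = 0 by linarith)
  have e5 := pow_eq_zero_iff two_ne_zero |>.1 (show (3 * a 6 - 2 * a 5) ^ 2 = 0 by linarith)
  have e4 := pow_eq_zero_iff two_ne_zero |>.1 (show (2 * a 7 - a 6) ^ 2 = 0 by linarith)
  have e3 := pow_eq_zero_iff two_ne_zero |>.1 (show (2 * a 1 - a 3) ^ 2 = 0 by linarith)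
  have e2 := pow_eq_zero_iff two_ne_zero |>.1 (show (3 * a 2 - 2 * a 3) ^ 2 = 0 by linarith)
  have e1 := pow_eq_zero_iff two_ne_zero |>.1 (show (2 * a 0 - a 2) ^ 2 = 0 by linarith)
  funext k
  fin_cases k <;> simp <;> omega

theorem quad_nonneg (a : Fin 8 → ℤ) : 0 ≤ quad a := by
  by_contra h
  have := eq_zero_of_quad_nonpos (a := a) (by omega)
  simp [this, quad_zero] at h

theorem quad_pos {a : Fin 8 → ℤ} (h : a ≠ 0) : 1 ≤ quad a := by
  by_contra h'
  exact h (eq_zero_of_quad_nonpos (by omega))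

/-- Reduction of the `E₈` lattice modulo `2`. -/
def red : (Fin 8 → ℤ) →+ (Fin 8 → ZMod 2) :=
  (Int.castAddHom (ZMod 2)).compLeft (Fin 8)

theorem red_apply (a : Fin 8 → ℤ) (k : Fin 8) : red a k = (a k : ZMod 2) := rfl

theorem form_red (a b : Fin 8 → ℤ) : form (red a) (red b) = ((form a b : ℤ) : ZMod 2) := by
  simp only [form_apply, red_apply]; push_cast; ring

theorem quad_red (a : Fin 8 → ℤ) : quad (red a) = ((quad a : ℤ) : ZMod 2) := by
  simp only [quad, red_apply]; push_cast; ring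

theorem red_eq_zero_iff {a : Fin 8 → ℤ} : red a = 0 ↔ ∃ b, a = (2 : ℤ) • b := by
  constructor
  · intro h
    have h' : ∀ k, ∃ c, a k = 2 * c := fun k =>
      (ZMod.intCast_zmod_eq_zero_iff_dvd (a k) 2).1 (congrFun h k)
    choose b hb using h'
    exact ⟨b, funext fun k => by simp [hb k]⟩
  · rintro ⟨b, rfl⟩
    funext k
    rw [red_apply]
    simp only [Pi.smul_apply, smul_eq_mul, Pi.zero_apply]
    push_cast
    rw [show (2 : ZMod 2) = 0 from rfl, zero_mul]

theorem red_neg (a : Fin 8 → ℤ) : red (-a) = red a := by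
  rw [map_neg]; funext k; exact ZMod.neg_eq_self_mod_two _

theorem add_self_eq_zero (x : Fin 8 → ZMod 2) : x + x = 0 := by
  funext k; exact CharTwo.add_self_eq_zero _

theorem form_self_mod_two (x : Fin 8 → ZMod 2) : form x x = 0 := by
  rw [form_self]; exact mul_eq_zero_of_left (by decide) _

/-- Congruent roots agree up to sign: half of their sum and half of their difference are lattice
vectors, and one of them has norm less than that of a root. -/
theorem eq_or_eq_neg_of_red_eq {a b : Fin 8 → ℤ} (ha : quad a = 1) (hb : quad b = 1)
    (h : red a = red b) : a = b ∨ a = -b := by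
  have h1 : red (a - b) = 0 := by rw [map_sub, h, sub_self]
  obtain ⟨c, hc⟩ := red_eq_zero_iff.1 h1
  have h2 := congrArg quad hc
  have hd : a + b = (2 : ℤ) • (c + b) := by rw [smul_add, ← hc, two_smul]; abel
  have h3 := congrArg quad hd
  rw [quad_sub, quad_smul, ha, hb] at h2
  rw [quad_add, quad_smul, ha, hb] at h3
  have h4 := quad_nonneg c
  have h5 := quad_nonneg (c + b)
  rcases (show quad c ≤ 0 ∨ quad (c + b) ≤ 0 by omega) with h6 | h6
  · left
    have := eq_zero_of_quad_nonpos h6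
    rw [this, smul_zero, sub_eq_zero] at hc
    exact hc
  · right
    have := eq_zero_of_quad_nonpos h6
    rw [this, smul_zero] at hd
    exact eq_neg_of_add_eq_zero_left hd

theorem form_le_two {a b : Fin 8 → ℤ} (ha : quad a = 1) (hb : quad b = 1) : form a b ≤ 2 := by
  have := quad_nonneg (a - b)
  rw [quad_sub, ha, hb] at this
  omega

theorem eq_of_form_eq_two {a b : Fin 8 → ℤ} (ha : quad a = 1) (hb : quad b = 1)
    (h : form a b = 2) : a = b := by
  have := eq_zero_of_quad_nonpos (a := a - b) (by rw [quad_sub, ha, hb, h]; norm_num)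
  exact sub_eq_zero.1 this

/-- The form is nondegenerate modulo `2`, since `E₈` is unimodular. -/
theorem eq_zero_of_form_eq_zero {x : Fin 8 → ZMod 2} (h : ∀ y, form x y = 0) : x = 0 := by
  have h0 := h (Pi.single 0 1)
  have h1 := h (Pi.single 1 1)
  have h2 := h (Pi.single 2 1)
  have h3 := h (Pi.single 3 1)
  have h4 := h (Pi.single 4 1)
  have h5 := h (Pi.single 5 1)
  have h6 := h (Pi.single 6 1)
  have h7 := h (Pi.single 7 1)
  have t : (2 : ZMod 2) = 0 := rfl
  simp only [form_apply, t, zero_mul, zero_sub, Pi.single_apply] at h0 h1 h2 h3 h4 h5 h6 h7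
  simp at h0 h1 h2 h3 h4 h5 h6 h7
  have e0 : x 0 = 0 := by simpa [h1] using h2
  have e4 : x 4 = 0 := by simpa [h7] using h5
  have e1 : x 1 = 0 := by simpa [h0, e4] using h3
  have e5 : x 5 = 0 := by simpa [h1] using h4
  have e7 : x 7 = 0 := by simpa [e5] using h6
  funext k
  fin_cases k <;> simp [*]

/-! ### Vectors modulo two generated from the simple roots -/

/-- The vector over `𝔽₂` whose coordinates are the binary digits of `n`. -/
def bitVec (n : ℕ) : Fin 8 → ZMod 2 := fun k => ((n.testBit k).toNat : ZMod 2)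

/-- The quadratic form modulo `2` evaluated on the binary digits of `n`, as a Boolean. -/
def bitQuad (n : ℕ) : Bool :=
  n.testBit 0 ^^ n.testBit 1 ^^ n.testBit 2 ^^ n.testBit 3 ^^ n.testBit 4 ^^ n.testBit 5
    ^^ n.testBit 6 ^^ n.testBit 7 ^^ (n.testBit 0 && n.testBit 2) ^^ (n.testBit 1 && n.testBit 3)
    ^^ (n.testBit 2 && n.testBit 3) ^^ (n.testBit 3 && n.testBit 4)
    ^^ (n.testBit 4 && n.testBit 5) ^^ (n.testBit 5 && n.testBit 6)
    ^^ (n.testBit 6 && n.testBit 7)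

theorem bitVec_xor (m n : ℕ) : bitVec (m ^^^ n) = bitVec m + bitVec n := by
  funext k
  simp only [bitVec, Nat.testBit_xor, Pi.add_apply]
  cases m.testBit k <;> cases n.testBit k <;> decide

theorem quad_bitVec (n : ℕ) : quad (bitVec n) = ((bitQuad n).toNat : ZMod 2) := by
  have hx : ∀ a b : Bool, ((a ^^ b).toNat : ZMod 2) = a.toNat + b.toNat := by decide
  have ha : ∀ a b : Bool, ((a && b).toNat : ZMod 2) = a.toNat * b.toNat := by decide
  have hs : ∀ a : Bool, (a.toNat : ZMod 2) ^ 2 = a.toNat := by decide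
  simp only [quad, bitQuad, bitVec, hx, ha, hs, CharTwo.sub_eq_add]
  simp only [Fin.isValue, Fin.coe_ofNat_eq_mod, Nat.reduceMod]
  ring

theorem exists_bitVec (x : Fin 8 → ZMod 2) : ∃ n < 256, bitVec n = x := by
  refine ⟨Nat.ofBits (fun k => decide (x k = 1)), Nat.ofBits_lt_two_pow _, funext fun k => ?_⟩
  simp only [bitVec, Nat.testBit_ofBits_lt _ _ k.2, Fin.eta]
  generalize x k = y
  revert y; decide

/-- A rank on codes of vectors. Its dominant part is the number of connected components of the
support in the `E₈` diagram; ties are broken lexicographically, for an ordering of the coordinates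
which makes every nonsingular vector other than a simple root a sum of two of smaller rank. -/
def bitRank (n : ℕ) : ℕ :=
  let d := fun k => (n.testBit k).toNat
  d 0 + 2 * d 1 + 4 * d 2 + 8 * d 3 + 32 * d 4 + 16 * d 5 + 128 * d 6 + 64 * d 7
    + 256 * (d 0 + d 1 + d 2 + d 3 + d 4 + d 5 + d 6 + d 7 - (d 0 * d 2 + d 1 * d 3 + d 2 * d 3
      + d 3 * d 4 + d 4 * d 5 + d 5 * d 6 + d 6 * d 7))

set_option maxRecDepth 100000 in
/-- Every nonsingular vector other than a simple root is a sum of two nonsingular vectors of smaller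
rank. It is stated in Booleans to be fast to evaluate. -/
theorem exists_xor_of_bitQuad : ((List.range 256).all fun n =>
    !bitQuad n || (List.range 8).any (fun k => n == 2 ^ k) ||
      (List.range 256).any fun m => bitQuad m && bitQuad (m ^^^ n) &&
        Nat.blt (bitRank m) (bitRank n) && Nat.blt (bitRank (m ^^^ n)) (bitRank n)) = true := by
  decide +kernel

/-- Every nonsingular vector modulo `2` is obtained from the simple roots by repeatedly adding two
nonsingular vectors with nonsingular sum. -/
theorem nonsingular_induction {p : (Fin 8 → ZMod 2) → Prop}
    (h₁ : ∀ k, p (Pi.single k 1))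
    (h₂ : ∀ x y, quad x = 1 → quad y = 1 → form x y = 1 → p x → p y → p (x + y))
    {x : Fin 8 → ZMod 2} (hx : quad x = 1) : p x := by
  obtain ⟨n, hn, rfl⟩ := exists_bitVec x
  generalize hr : bitRank n = r
  induction r using Nat.strong_induction_on generalizing n with
  | _ r ih =>
    have hq : ∀ m, quad (bitVec m) = 1 ↔ bitQuad m = true := fun m => by
      rw [quad_bitVec]; cases bitQuad m <;> simp
    have key := List.all_eq_true.1 exists_xor_of_bitQuad n (List.mem_range.2 hn)
    simp only [(hq n).1 hx, Bool.not_true, Bool.false_or, Bool.or_eq_true, List.any_eq_true,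
      List.mem_range, beq_iff_eq, Bool.and_eq_true, Nat.blt_eq] at key
    rcases key with ⟨k, hk, rfl⟩ | ⟨m, hm, ⟨⟨hm1, hm2⟩, hm3⟩, hm4⟩
    · have : bitVec (2 ^ k) = Pi.single ⟨k, hk⟩ 1 := by
        funext l
        simp only [bitVec, Nat.testBit_two_pow, Pi.single_apply, Fin.ext_iff, eq_comm (a := k)]
        split_ifs with h <;> simp [h]
      rw [this]; exact h₁ _
    · have hs : bitVec m + bitVec (m ^^^ n) = bitVec n := by
        rw [← bitVec_xor, ← Nat.xor_assoc, Nat.xor_self, Nat.zero_xor]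
      have h3 := hs ▸ hx
      have hm1' := (hq m).2 hm1
      have hm2' := (hq _).2 hm2
      have h4 : form (bitVec m) (bitVec (m ^^^ n)) = 1 := by
        rw [quad_add, hm1', hm2'] at h3
        rwa [show (1 : ZMod 2) + 1 = 0 from rfl, zero_add] at h3
      rw [← hs]
      exact h₂ _ _ hm1' hm2' h4 (ih _ (hr ▸ hm3) m hm hm1' rfl)
        (ih _ (hr ▸ hm4) _ (Nat.xor_lt_two_pow (n := 8) hm hn) hm2' rfl)

/-- Every nonsingular vector modulo `2` is the reduction of a root. -/
theorem exists_root_red {x : Fin 8 → ZMod 2} (hx : quad x = 1) :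
    ∃ a : Fin 8 → ℤ, quad a = 1 ∧ red a = x := by
  refine nonsingular_induction (p := fun x => ∃ a : Fin 8 → ℤ, quad a = 1 ∧ red a = x) ?_ ?_ hx
  · intro k
    refine ⟨Pi.single k 1, by fin_cases k <;> rfl, funext fun l => ?_⟩
    rw [red_apply, Pi.single_apply, Pi.single_apply]; split_ifs <;> simp
  · rintro _ _ - - hxy ⟨a, ha, rfl⟩ ⟨b, hb, rfl⟩
    rw [form_red] at hxy
    have h1 := form_le_two ha hb
    have h2 := form_le_two ha ((quad_neg b).trans hb)
    rw [map_neg] at h2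
    have h3 : ¬ (2 : ℤ) ∣ form a b := by
      intro h
      rw [(ZMod.intCast_zmod_eq_zero_iff_dvd _ 2).2 h] at hxy
      exact absurd hxy (by decide)
    rcases (show form a b = 1 ∨ form a b = -1 by omega) with h | h
    · exact ⟨a - b, by rw [quad_sub, ha, hb, h]; rfl, by
        rw [sub_eq_add_neg, map_add, red_neg]⟩
    · exact ⟨a + b, by rw [quad_add, ha, hb, h]; rfl, map_add _ _ _⟩

/-! ### The Weyl group modulo two and Witt's theorem -/

/-- The Weyl group of `E₈`, acting on the root lattice. -/
def weyl : Subgroup ((Fin 8 → ℤ) ≃ₗ[ℤ] (Fin 8 → ℤ)) :=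
  Subgroup.closure {s | ∃ r, quad r = 1 ∧ ∀ a, s a = a - form a r • r}

theorem exists_weyl_reflection {r : Fin 8 → ℤ} (hr : quad r = 1) :
    ∃ s ∈ weyl, ∀ a, s a = a - form a r • r := by
  have h : form r r = 2 := by rw [form_self, hr]; rfl
  refine ⟨Module.reflection h, Subgroup.subset_closure ⟨r, hr, ?_⟩, ?_⟩ <;>
    exact fun a => by rw [Module.reflection_apply, form_comm]

theorem form_weyl {g : (Fin 8 → ℤ) ≃ₗ[ℤ] (Fin 8 → ℤ)} (hg : g ∈ weyl) (a b : Fin 8 → ℤ) :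
    form (g a) (g b) = form a b := by
  induction hg using Subgroup.closure_induction generalizing a b with
  | mem s hs =>
    obtain ⟨r, hr, hs⟩ := hs
    simp only [hs, map_sub, LinearMap.sub_apply, map_smul, LinearMap.smul_apply, smul_eq_mul,
      form_self r, hr, form_comm r]
    ring
  | one => rfl
  | mul g h _ _ hg hh => rw [LinearEquiv.mul_apply, LinearEquiv.mul_apply, hg, hh]
  | inv g _ hg => rw [← hg, ← LinearEquiv.mul_apply, ← LinearEquiv.mul_apply, mul_inv_cancel]; rfl

theorem quad_weyl {g : (Fin 8 → ℤ) ≃ₗ[ℤ] (Fin 8 → ℤ)} (hg : g ∈ weyl) (a : Fin 8 → ℤ) :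
    quad (g a) = quad a := by
  have := form_weyl hg a a
  rw [form_self, form_self] at this
  omega

theorem red_map_eq_zero_iff (g : (Fin 8 → ℤ) ≃ₗ[ℤ] (Fin 8 → ℤ)) (a : Fin 8 → ℤ) :
    red (g a) = 0 ↔ red a = 0 := by
  rw [red_eq_zero_iff, red_eq_zero_iff]
  constructor
  · rintro ⟨b, hb⟩
    exact ⟨g.symm b, by rw [← map_smul, ← hb, LinearEquiv.symm_apply_apply]⟩
  · rintro ⟨b, rfl⟩
    exact ⟨g b, map_smul _ _ _⟩

theorem sum_red_map_eq_zero_iff {κ : Type*} (g : (Fin 8 → ℤ) ≃ₗ[ℤ] (Fin 8 → ℤ))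
    (a : κ → Fin 8 → ℤ) (s : Finset κ) :
    ∑ i ∈ s, red (g (a i)) = 0 ↔ ∑ i ∈ s, red (a i) = 0 := by
  rw [← map_sum, ← map_sum, ← map_sum, red_map_eq_zero_iff]

/-- An endomorphism of the reduction modulo `2` is a Weyl endomorphism if it is induced by an
element of the Weyl group. -/
def IsWeylMod (T : (Fin 8 → ZMod 2) → (Fin 8 → ZMod 2)) : Prop :=
  ∃ g ∈ weyl, ∀ a, red (g a) = T (red a)

theorem IsWeylMod.comp {S T : (Fin 8 → ZMod 2) → (Fin 8 → ZMod 2)} (hS : IsWeylMod S)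
    (hT : IsWeylMod T) : IsWeylMod (S ∘ T) := by
  obtain ⟨g, hg, hg'⟩ := hS
  obtain ⟨h, hh, hh'⟩ := hT
  exact ⟨g * h, mul_mem hg hh, fun a => by
    rw [LinearEquiv.mul_apply, hg', hh']; rfl⟩

theorem isWeylMod_id : IsWeylMod id := ⟨1, one_mem _, fun _ => rfl⟩

theorem isWeylMod_transvection {u : Fin 8 → ZMod 2} (hu : quad u = 1) :
    IsWeylMod (fun x => x + form x u • u) := by
  obtain ⟨r, hr, rfl⟩ := exists_root_red hu
  obtain ⟨s, hs, hs'⟩ := exists_weyl_reflection hr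
  refine ⟨s, hs, fun a => ?_⟩
  funext k
  simp only [hs', form_red, red_apply, Pi.add_apply, Pi.sub_apply, Pi.smul_apply, smul_eq_mul]
  push_cast
  exact CharTwo.sub_eq_add _ _

theorem exists_nonsingular_orthogonal (s v : Fin 8 → ZMod 2) :
    ∃ u : Fin 8 → ZMod 2, quad u = 1 ∧ form u s = 0 ∧ form u v = 0 := by
  -- Among the roots `α₁, α₃, α₄, α₅` and their consecutive sums one is orthogonal to both vectors:
  -- two of the five partial sums of the pairs of values at these roots coincide.
  have key : ∀ a b c d a' b' c' d' : ZMod 2, ∃ i j k l : ZMod 2,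
      i ^ 2 + j ^ 2 + k ^ 2 + l ^ 2 - (i * j + j * k + k * l) = 1 ∧
      i * a + j * b + k * c + l * d = 0 ∧ i * a' + j * b' + k * c' + l * d' = 0 := by
    decide +kernel
  obtain ⟨i, j, k, l, h1, h2, h3⟩ := key (form (Pi.single 0 1) s) (form (Pi.single 2 1) s)
    (form (Pi.single 3 1) s) (form (Pi.single 4 1) s) (form (Pi.single 0 1) v)
    (form (Pi.single 2 1) v) (form (Pi.single 3 1) v) (form (Pi.single 4 1) v)
  refine ⟨i • Pi.single 0 1 + j • Pi.single 2 1 + k • Pi.single 3 1 + l • Pi.single 4 1, ?_, ?_, ?_⟩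
  · refine Eq.trans ?_ h1
    simp [quad]
  · simpa only [map_add, LinearMap.add_apply, map_smul, LinearMap.smul_apply, smul_eq_mul] using h2
  · simpa only [map_add, LinearMap.add_apply, map_smul, LinearMap.smul_apply, smul_eq_mul] using h3

/-- Siegel transformations: if `s` is singular and `v` is orthogonal to `s`, then some element of
the Weyl group acts on the vectors orthogonal to `s` as `x ↦ x + (x, v) s`. If `v` is nonsingular,
it is a product of the transvections at `v + s` and `v`. -/
theorem exists_siegel {s v : Fin 8 → ZMod 2} (hs : quad s = 0) (hv : form v s = 0) :
    ∃ T, IsWeylMod T ∧ ∀ x, form x s = 0 → T x = x + form x v • s := by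
  have aux : ∀ v : Fin 8 → ZMod 2, quad v = 1 → form v s = 0 →
      ∃ T, IsWeylMod T ∧ ∀ x, form x s = 0 → T x = x + form x v • s := by
    intro v hq hv
    have hq' : quad (v + s) = 1 := by rw [quad_add, hq, hs, hv]; rfl
    refine ⟨_, (isWeylMod_transvection hq).comp (isWeylMod_transvection hq'), fun x hx => ?_⟩
    simp only [Function.comp_apply, map_add, LinearMap.add_apply, map_smul, LinearMap.smul_apply,
      hx, form_self_mod_two, form_comm s v, hv, smul_add, add_zero, smul_zero]
    rw [add_assoc, add_right_comm (form x v • v), add_self_eq_zero, zero_add]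
  by_cases hq : quad v = 1
  · exact aux v hq hv
  · replace hq : quad v = 0 := by
      generalize quad v = c at hq; revert hq; revert c; decide
    -- Write `v` as the sum of the nonsingular vectors `u` and `v + u`.
    obtain ⟨u, hu, hus, huv⟩ := exists_nonsingular_orthogonal s v
    obtain ⟨S, hS, hS'⟩ := aux u hu hus
    obtain ⟨T, hT, hT'⟩ := aux (v + u) (by rw [quad_add, hq, hu, form_comm, huv]; rfl)
      (by rw [map_add, LinearMap.add_apply, hv, hus, add_zero])
    refine ⟨_, hS.comp hT, fun x hx => ?_⟩
    rw [Function.comp_apply, hT' x hx, hS' _ (by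
      rw [map_add, LinearMap.add_apply, map_smul, LinearMap.smul_apply, form_self_mod_two, hx,
        smul_zero, add_zero])]
    simp only [map_add, LinearMap.add_apply, map_smul, LinearMap.smul_apply,
      form_comm s u, hus, smul_zero, add_zero, add_smul]
    rw [add_assoc, add_assoc, add_self_eq_zero, add_zero]

/-- A vector outside a subspace is detected by the form, by nondegeneracy. -/
theorem exists_form_eq_one {U : Submodule (ZMod 2) (Fin 8 → ZMod 2)} {x : Fin 8 → ZMod 2}
    (hx : x ∉ U) : ∃ v, form x v = 1 ∧ ∀ u ∈ U, form u v = 0 := by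
  obtain ⟨f, hf, hU⟩ := Submodule.exists_le_ker_of_notMem hx
  have hinj : Function.Injective (form : LinearMap.BilinForm (ZMod 2) (Fin 8 → ZMod 2)) := by
    rw [injective_iff_map_eq_zero]
    intro a ha
    exact eq_zero_of_form_eq_zero fun y => by rw [ha]; rfl
  obtain ⟨v, rfl⟩ := (LinearMap.injective_iff_surjective_of_finrank_eq_finrank
    (Subspace.dual_finrank_eq (K := ZMod 2) (V := Fin 8 → ZMod 2)).symm).1 hinj f
  refine ⟨v, ?_, fun u hu => ?_⟩
  · rw [form_comm]; generalize form v x = c at hf; revert hf; revert c; decide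
  · rw [form_comm]; exact hU hu

/-- The extension step of Witt's theorem: `x` is taken to `y` by the transvection
at `x + y` if this vector is nonsingular, and otherwise by a Siegel transformation. -/
theorem exists_isWeylMod_fix {U : Submodule (ZMod 2) (Fin 8 → ZMod 2)} {x y : Fin 8 → ZMod 2}
    (hx : quad x = 1) (hy : quad y = 1) (hU : ∀ u ∈ U, form u x = form u y)
    (hxU : x ∈ U → x = y) (hyU : y ∈ U → x = y) :
    ∃ T, IsWeylMod T ∧ T x = y ∧ ∀ u ∈ U, T u = u := by
  by_cases hxy : x = y
  · exact ⟨id, isWeylMod_id, hxy, fun _ _ => rfl⟩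
  have hUs : ∀ u ∈ U, form u (x + y) = 0 := fun u hu => by
    rw [map_add, hU u hu]; exact CharTwo.add_self_eq_zero _
  have hxxy : x + (x + y) = y := by rw [← add_assoc, add_self_eq_zero, zero_add]
  by_cases hB : form x y = 1
  · refine ⟨_, isWeylMod_transvection (u := x + y) (by rw [quad_add, hx, hy, hB]; rfl), ?_, ?_⟩
    · simp only [map_add, form_self_mod_two, hB, zero_add, one_smul]
      exact hxxy
    · intro u hu
      simp only [hUs u hu, zero_smul, add_zero]
  · replace hB : form x y = 0 := by
      generalize form x y = c at hB; revert hB; revert c; decide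
    have hxs : x ∉ U ⊔ Submodule.span (ZMod 2) {x + y} := by
      rw [Submodule.mem_sup]
      rintro ⟨u, hu, w, hw, huw⟩
      obtain ⟨c, rfl⟩ := Submodule.mem_span_singleton.1 hw
      have hc : c = 0 ∨ c = 1 := by clear huw hw; revert c; decide
      rcases hc with rfl | rfl
      · rw [zero_smul, add_zero] at huw
        exact hxy (hxU (huw ▸ hu))
      · refine hxy (hyU ?_)
        have : u = y := by
          rw [one_smul] at huw
          rw [← hxxy]
          nth_rw 1 [← huw]
          rw [add_assoc, add_self_eq_zero, add_zero]
        exact this ▸ hu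
    obtain ⟨v, hv, hv'⟩ := exists_form_eq_one hxs
    have hvs : form v (x + y) = 0 := by
      rw [form_comm]
      exact hv' _ (Submodule.mem_sup_right (Submodule.mem_span_singleton_self _))
    obtain ⟨T, hT, hT'⟩ := exists_siegel (s := x + y) (by rw [quad_add, hx, hy, hB]; rfl) hvs
    refine ⟨T, hT, ?_, fun u hu => ?_⟩
    · rw [hT' x (by rw [map_add, form_self_mod_two, hB, add_zero]), hv, one_smul, hxxy]
    · rw [hT' u (hUs u hu), hv' u (Submodule.mem_sup_left hu), zero_smul, add_zero]

theorem exists_sum_eq_of_mem_span {κ V : Type*} [AddCommGroup V] [Module (ZMod 2) V]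
    [DecidableEq κ] {s : Finset κ} {a : κ → V} {x : V}
    (hx : x ∈ Submodule.span (ZMod 2) (a '' s)) : ∃ t ⊆ s, ∑ i ∈ t, a i = x := by
  obtain ⟨c, rfl⟩ := (Submodule.mem_span_image_finset_iff_exists_fun (ZMod 2)).1 hx
  refine ⟨(univ.filter fun i => c i = 1).map (Function.Embedding.subtype _), ?_, ?_⟩
  · intro i hi
    obtain ⟨j, -, rfl⟩ := mem_map.1 hi
    exact j.2
  rw [sum_map, sum_filter]
  refine sum_congr rfl fun i _ => ?_
  have hc : c i = 0 ∨ c i = 1 := by generalize c i = c; revert c; decide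
  rcases hc with h | h <;> simp [h]

/-- Witt's theorem for roots modulo `2`: two families of roots with the same form and the same
linear relations modulo `2` are conjugate modulo `2`, that is, up to signs. -/
theorem exists_weyl_red_eq {κ : Type*} (s : Finset κ) (a b : κ → Fin 8 → ℤ)
    (ha : ∀ i ∈ s, quad (a i) = 1) (hb : ∀ i ∈ s, quad (b i) = 1)
    (hform : ∀ i ∈ s, ∀ j ∈ s, form (red (a i)) (red (a j)) = form (red (b i)) (red (b j)))
    (hrel : ∀ t ⊆ s, ∑ i ∈ t, red (a i) = 0 ↔ ∑ i ∈ t, red (b i) = 0) :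
    ∃ g ∈ weyl, ∀ i ∈ s, red (g (a i)) = red (b i) := by
  classical
  induction s using Finset.induction_on with
  | empty => exact ⟨1, one_mem _, by simp⟩
  | insert m s hm ih =>
    obtain ⟨g, hg, hgs⟩ := ih (fun i hi => ha i (mem_insert_of_mem hi))
      (fun i hi => hb i (mem_insert_of_mem hi))
      (fun i hi j hj => hform i (mem_insert_of_mem hi) j (mem_insert_of_mem hj))
      (fun t ht => hrel t (ht.trans (subset_insert _ _)))
    have hsum : ∀ t ⊆ s, ∑ i ∈ t, red (g (a i)) = ∑ i ∈ t, red (b i) := fun t ht =>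
      sum_congr rfl fun i hi => hgs i (ht hi)
    have hiff : ∀ t ⊆ s, ∑ i ∈ t, red (b i) = red (g (a m)) ↔
        ∑ i ∈ t, red (b i) = red (b m) := by
      intro t ht
      have hmt : m ∉ t := fun h => hm (ht h)
      have h1 := sum_red_map_eq_zero_iff g a (insert m t)
      rw [hrel _ (insert_subset_insert m ht), sum_insert hmt, sum_insert hmt, hsum t ht] at h1
      have h2 : ∀ x y : Fin 8 → ZMod 2, y = x ↔ x + y = 0 := fun x y =>
        ⟨fun h => h ▸ add_self_eq_zero y, fun h => by
          rw [← add_zero y, ← add_self_eq_zero x, ← add_assoc, add_comm y, h, zero_add]⟩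
      exact (h2 _ _).trans (h1.trans (h2 _ _).symm)
    obtain ⟨T, ⟨h, hh, hT⟩, hTx, hTU⟩ := exists_isWeylMod_fix
      (U := Submodule.span (ZMod 2) ((fun i => red (b i)) '' s)) (x := red (g (a m)))
      (y := red (b m))
      (by rw [quad_red, quad_weyl hg, ha m (mem_insert_self _ _)]; rfl)
      (by rw [quad_red, hb m (mem_insert_self _ _)]; rfl)
      (by
        intro u hu
        obtain ⟨t, ht, rfl⟩ := exists_sum_eq_of_mem_span hu
        rw [map_sum, LinearMap.sum_apply, LinearMap.sum_apply]
        refine sum_congr rfl fun i hi => ?_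
        have hi' := mem_insert_of_mem (a := i) (b := m) (ht hi)
        rw [← hform i hi' m (mem_insert_self _ _), ← hgs i (ht hi), form_red, form_red,
          form_weyl hg])
      (by
        intro hx
        obtain ⟨t, ht, h⟩ := exists_sum_eq_of_mem_span hx
        rw [← h, (hiff t ht).1 h])
      (by
        intro hx
        obtain ⟨t, ht, h⟩ := exists_sum_eq_of_mem_span hx
        rw [← h, (hiff t ht).2 h])
    refine ⟨h * g, mul_mem hh hg, fun i hi => ?_⟩
    rw [LinearEquiv.mul_apply, hT]
    rcases mem_insert.1 hi with rfl | hi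
    · exact hTx
    · rw [hgs i hi]
      exact hTU _ (Submodule.subset_span ⟨i, hi, rfl⟩)

/-! ### Sign changes and conjugacy of bases -/

section Bases

variable {κ : Type*} [Fintype κ]

theorem form_sum_sum (n m : κ → ℤ) (b : κ → Fin 8 → ℤ) :
    form (∑ i, n i • b i) (∑ j, m j • b j) = ∑ i, ∑ j, n i * m j * form (b i) (b j) := by
  simp only [map_sum, LinearMap.sum_apply, map_smul, LinearMap.smul_apply, smul_eq_mul, mul_sum]
  rw [sum_comm]
  exact sum_congr rfl fun i _ => sum_congr rfl fun j _ => by ring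

/-- A root in the integral span of an obtuse family is a non-negative or a non-positive
combination of it: its positive and negative parts have non-positive product, so they cannot both
be nonzero, the norms of nonzero vectors being at least that of a root. -/
theorem exists_nat_combination {b : κ → Fin 8 → ℤ}
    (hob : ∀ i j, i ≠ j → form (b i) (b j) ≤ 0) {v : Fin 8 → ℤ} (hv : quad v = 1)
    (hs : v ∈ Submodule.span ℤ (Set.range b)) :
    ∃ n : κ → ℕ, v = ∑ i, (n i : ℤ) • b i ∨ v = -∑ i, (n i : ℤ) • b i := by
  obtain ⟨c, rfl⟩ := (Submodule.mem_span_range_iff_exists_fun ℤ).1 hs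
  set p := ∑ i, ((c i).toNat : ℤ) • b i with hp
  set q := ∑ i, ((-c i).toNat : ℤ) • b i with hq
  have hpq : ∑ i, c i • b i = p - q := by
    rw [hp, hq, ← sum_sub_distrib]
    refine sum_congr rfl fun i _ => ?_
    rw [← sub_smul]
    congr 1
    omega
  have hf : form p q ≤ 0 := by
    rw [hp, hq, form_sum_sum]
    refine sum_nonpos fun i _ => sum_nonpos fun j _ => ?_
    by_cases hij : i = j
    · subst hij
      rcases le_total 0 (c i) with h | h
      · rw [show (-c i).toNat = 0 by omega]; simp
      · rw [show (c i).toNat = 0 by omega]; simp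
    · exact mul_nonpos_of_nonneg_of_nonpos (by positivity) (hob i j hij)
  rw [hpq, quad_sub] at hv
  have h1 := quad_nonneg p
  have h2 := quad_nonneg q
  rcases (show quad p ≤ 0 ∨ quad q ≤ 0 by omega) with h | h
  · exact ⟨_, Or.inr (by rw [hpq, eq_zero_of_quad_nonpos h, zero_sub])⟩
  · exact ⟨_, Or.inl (by rw [hpq, eq_zero_of_quad_nonpos h, sub_zero])⟩

theorem eq_zero_of_form_sum_nonpos {b : κ → Fin 8 → ℤ} (hb : LinearIndependent ℤ b)
    {n : κ → ℤ} (h : ∑ i, ∑ j, n i * n j * form (b i) (b j) ≤ 0) : n = 0 := by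
  rw [← form_sum_sum, form_self] at h
  exact funext (Fintype.linearIndependent_iff.1 hb n (eq_zero_of_quad_nonpos (by omega)))

/-- The Gram matrix of independent lattice vectors is nonsingular. -/
theorem det_form_ne_zero [DecidableEq κ] {a : κ → Fin 8 → ℤ} (ha : LinearIndependent ℤ a) :
    (Matrix.of fun i j => form (a i) (a j)).det ≠ 0 := by
  intro h
  obtain ⟨n, hn, h⟩ := Matrix.exists_mulVec_eq_zero_iff.2 h
  refine hn (eq_zero_of_form_sum_nonpos ha (le_of_eq ?_))
  refine sum_eq_zero fun i _ => ?_
  have hi := congrFun h i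
  simp only [Matrix.mulVec, dotProduct, Matrix.of_apply, Pi.zero_apply] at hi
  rw [sum_congr rfl fun j _ => (by ring :
    n i * n j * form (a i) (a j) = n i * (form (a i) (a j) * n j)), ← mul_sum, hi, mul_zero]

/-- A strictly dominant vector for a linearly independent family. -/
theorem exists_form_pos {b : κ → Fin 8 → ℤ} (hb : LinearIndependent ℤ b) :
    ∃ m, ∀ i, 0 < form m (b i) := by
  classical
  let G : Matrix κ κ ℤ := .of fun i j => form (b i) (b j)
  have hdet : G.det ≠ 0 := det_form_ne_zero hb
  -- Cramer's rule: in this way all products are equal to the square of the determinant.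
  let n : κ → ℤ := G.adjugate.mulVec (fun _ => G.det)
  refine ⟨∑ j, n j • b j, fun i => ?_⟩
  have h1 : G.mulVec n i = G.det * G.det := by
    rw [Matrix.mulVec_mulVec, Matrix.mul_adjugate, Matrix.smul_mulVec, Matrix.one_mulVec]
    rfl
  have h2 : form (∑ j, n j • b j) (b i) = G.mulVec n i := by
    simp only [map_sum, LinearMap.sum_apply, map_smul, LinearMap.smul_apply, smul_eq_mul,
      Matrix.mulVec, dotProduct, G, Matrix.of_apply]
    exact sum_congr rfl fun j _ => by rw [form_comm, mul_comm]
  rw [h2, h1]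
  exact mul_self_pos.2 hdet

/-- The opposite of a basis is conjugate to it under the Weyl group of the subsystem it spans (by
the longest element), so by an element which fixes all vectors orthogonal to the basis. -/
theorem exists_weyl_neg {b : κ → Fin 8 → ℤ} (hq : ∀ i, quad (b i) = 1)
    (hob : ∀ i j, i ≠ j → form (b i) (b j) ≤ 0) (hb : LinearIndependent ℤ b) :
    ∃ h ∈ weyl, (∀ v, (∀ i, form v (b i) = 0) → h v = v) ∧
      ∃ σ : Equiv.Perm κ, ∀ i, h (b i) = -b (σ i) := by
  classical
  obtain ⟨m, hm⟩ := exists_form_pos hb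
  let Good : ((Fin 8 → ℤ) ≃ₗ[ℤ] (Fin 8 → ℤ)) → Prop := fun h => h ∈ weyl ∧
    (∀ v, (∀ i, form v (b i) = 0) → h v = v) ∧
    ∀ a, h a - a ∈ Submodule.span ℤ (Set.range b)
  -- An element minimizing the product of `h m` with `m` takes the dominant vector `m` to an
  -- antidominant one.
  obtain ⟨h, ⟨hw, hfix, hspan⟩, hmin⟩ : ∃ h, Good h ∧ ∀ h', Good h' →
      form (h m) m ≤ form (h' m) m := by
    have hne : {k : ℕ | ∃ h, Good h ∧ (k : ℤ) = form (h m) m + 2 * quad m}.Nonempty := by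
      refine ⟨(form m m + 2 * quad m).toNat, 1, ⟨one_mem _, fun _ _ => rfl, fun a => ?_⟩, ?_⟩
      · simp
      · have := quad_nonneg m
        rw [Int.toNat_of_nonneg (by rw [form_self]; omega)]; rfl
    obtain ⟨h, hh, hk⟩ := Nat.sInf_mem hne
    refine ⟨h, hh, fun h' hh' => ?_⟩
    have h1 := quad_nonneg (h' m + m)
    rw [quad_add, quad_weyl hh'.1] at h1
    have h2 := Nat.sInf_le (s := {k : ℕ | ∃ h, Good h ∧ (k : ℤ) = form (h m) m + 2 * quad m})
      (m := (form (h' m) m + 2 * quad m).toNat) ⟨h', hh', Int.toNat_of_nonneg (by omega)⟩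
    omega
  have hanti : ∀ i, form (h m) (b i) ≤ 0 := by
    intro i
    by_contra hpos
    obtain ⟨s, hs, hs'⟩ := exists_weyl_reflection (hq i)
    have hgood : Good (s * h) := by
      refine ⟨mul_mem hs hw, fun v hv => ?_, fun a => ?_⟩
      · rw [LinearEquiv.mul_apply, hfix v hv, hs', hv i, zero_smul, sub_zero]
      · rw [LinearEquiv.mul_apply, hs', sub_right_comm]
        exact Submodule.sub_mem _ (hspan a)
          (Submodule.smul_mem _ _ (Submodule.subset_span ⟨i, rfl⟩))
    have := hmin _ hgood
    rw [LinearEquiv.mul_apply, hs', map_sub, LinearMap.sub_apply, map_smul,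
      LinearMap.smul_apply, smul_eq_mul, form_comm (b i)] at this
    have := mul_pos (not_le.1 hpos) (hm i)
    omega
  have hmsum : ∀ n : κ → ℕ, form m (∑ i, (n i : ℤ) • b i) = ∑ i, (n i : ℤ) * form m (b i) :=
    fun n => by simp only [map_sum, map_smul, smul_eq_mul]
  have hmem : ∀ i, b i ∈ Submodule.span ℤ (Set.range b) := fun i =>
    Submodule.subset_span ⟨i, rfl⟩
  have hinv : ∀ i, ∃ n : κ → ℕ, h.symm (b i) = -∑ j, (n j : ℤ) • b j := by
    intro i
    have hqi : quad (h.symm (b i)) = 1 := by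
      rw [← quad_weyl hw, LinearEquiv.apply_symm_apply, hq]
    have hmi : form m (h.symm (b i)) ≤ 0 := by
      rw [← form_weyl hw, LinearEquiv.apply_symm_apply]; exact hanti i
    obtain ⟨n, hn | hn⟩ := exists_nat_combination hob hqi (by
      have := Submodule.sub_mem _ (hmem i) (hspan (h.symm (b i)))
      rwa [LinearEquiv.apply_symm_apply, sub_sub_cancel] at this)
    · exfalso
      rw [hn, hmsum] at hmi
      have h0 : ∀ j, n j = 0 := by
        intro j
        by_contra hj
        have : 0 < ∑ i, (n i : ℤ) * form m (b i) :=
          sum_pos' (fun i _ => mul_nonneg (by positivity) (hm i).le)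
            ⟨j, mem_univ _, mul_pos (by positivity) (hm j)⟩
        omega
      rw [hn] at hqi
      simp [h0, quad_zero] at hqi
    · exact ⟨n, hn⟩
  choose N hN using hinv
  have hfwd : ∀ i, ∃ j, h (b i) = -b j := by
    intro i
    have hqi : quad (h (b i)) = 1 := by rw [quad_weyl hw, hq]
    obtain ⟨M, hM⟩ := exists_nat_combination hob hqi (by
      have := Submodule.add_mem _ (hspan (b i)) (hmem i)
      rwa [sub_add_cancel] at this)
    have hsymm : h.symm (∑ j, (M j : ℤ) • b j) =
        -∑ l, ((∑ j, M j * N j l : ℕ) : ℤ) • b l := by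
      simp only [map_sum, map_smul, hN, smul_neg, sum_neg_distrib, smul_sum, Nat.cast_sum,
        sum_smul, Nat.cast_mul, mul_smul]
      rw [sum_comm]
    rcases hM with hM | hM
    · exfalso
      have h1 := congrArg h.symm hM
      rw [LinearEquiv.symm_apply_apply, hsymm] at h1
      have h2 := hm i
      rw [h1, map_neg, hmsum] at h2
      have : 0 ≤ ∑ l, ((∑ j, M j * N j l : ℕ) : ℤ) * form m (b l) :=
        sum_nonneg fun l _ => mul_nonneg (by positivity) (hm l).le
      omega
    · have h1 := congrArg h.symm hM
      rw [LinearEquiv.symm_apply_apply, map_neg, hsymm, neg_neg] at h1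
      have h2 : ∀ l, ∑ j, M j * N j l = if l = i then 1 else 0 := by
        have h3 : ∑ l, (((∑ j, M j * N j l : ℕ) : ℤ) - if l = i then 1 else 0) • b l = 0 := by
          simp only [sub_smul, sum_sub_distrib, ← h1, ite_smul, one_smul, zero_smul,
            sum_ite_eq', mem_univ, if_true, sub_self]
        intro l
        have := Fintype.linearIndependent_iff.1 hb _ h3 l
        split_ifs at this ⊢ <;> omega
      -- The rows of `N` are nonzero, so the heights of both sides force `M` to be a unit vector.
      have h4 : ∑ j, M j * ∑ l, N j l = 1 := by
        simp only [mul_sum]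
        rw [sum_comm]
        simp [h2]
      have h5 : ∀ j, 1 ≤ ∑ l, N j l := by
        intro j
        by_contra hj
        have h0 : ∀ l, N j l = 0 := by
          have : ∑ l, N j l = 0 := by omega
          simpa using this
        have := hN j
        simp only [h0, Nat.cast_zero, zero_smul, sum_const_zero, neg_zero,
          LinearEquiv.map_eq_zero_iff] at this
        have h6 := hq j
        rw [this, quad_zero] at h6
        exact absurd h6 (by decide)
      have h6 : ∑ j, M j ≤ 1 := by
        rw [← h4]
        exact sum_le_sum fun j _ => Nat.le_mul_of_pos_right _ (h5 j)
      obtain ⟨j, hj⟩ : ∃ j, M j ≠ 0 := by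
        by_contra! h0
        simp [h0] at h4
      have h7 := add_sum_erase univ M (mem_univ j)
      have h8 : ∑ l ∈ univ.erase j, M l = 0 := by omega
      have h9 : ∀ l, l ≠ j → M l = 0 := fun l hl =>
        sum_eq_zero_iff.1 h8 l (mem_erase.2 ⟨hl, mem_univ _⟩)
      refine ⟨j, ?_⟩
      rw [hM, sum_eq_single j (fun l _ hl => by rw [h9 l hl]; simp) (by simp),
        show M j = 1 by omega, Nat.cast_one, one_smul]
  choose σ hσ using hfwd
  have hinj : Function.Injective σ := by
    intro i j hij
    apply hb.injective
    apply h.injective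
    rw [hσ, hσ, hij]
  exact ⟨h, hw, hfix, Equiv.ofBijective σ (Finite.injective_iff_bijective.1 hinj), hσ⟩

/-- Two bases with the same Cartan matrix and the same linear relations modulo `2` are conjugate
as sets. -/
theorem exists_weyl_image_eq {a b : κ → Fin 8 → ℤ} (ha : ∀ i, quad (a i) = 1)
    (hb : ∀ i, quad (b i) = 1) (hform : ∀ i j, form (a i) (a j) = form (b i) (b j))
    (hob : ∀ i j, i ≠ j → form (b i) (b j) ≤ 0) (hli : LinearIndependent ℤ b)
    (hrel : ∀ t : Finset κ, ∑ i ∈ t, red (a i) = 0 ↔ ∑ i ∈ t, red (b i) = 0) :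
    ∃ g ∈ weyl, g '' Set.range a = Set.range b := by
  classical
  obtain ⟨g, hg, hgr⟩ := exists_weyl_red_eq univ a b (fun i _ => ha i) (fun i _ => hb i)
    (fun i _ j _ => by rw [form_red, form_red, hform]) (fun t _ => hrel t)
  have hpm : ∀ i, g (a i) = b i ∨ g (a i) = -b i := fun i =>
    eq_or_eq_neg_of_red_eq (by rw [quad_weyl hg, ha]) (hb i) (hgr i (mem_univ i))
  obtain ⟨h, hh, hfix, σ, hσ⟩ := exists_weyl_neg (κ := {i // g (a i) ≠ b i})
    (b := fun i => b i) (fun i => hb i)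
    (fun i j hij => hob i j (by rwa [ne_eq, Subtype.ext_iff] at hij))
    (hli.comp _ Subtype.val_injective)
  -- Members with different signs are orthogonal, since changing one sign preserves their product.
  have hfix' : ∀ j, g (a j) = b j → h (b j) = b j := by
    intro j hj
    refine hfix _ fun i => ?_
    have h1 := form_weyl hg (a j) (a i)
    rw [hform, hj, (hpm i).resolve_left i.2, map_neg] at h1
    show form (b j) (b i) = 0
    omega
  refine ⟨h * g, mul_mem hh hg, ?_⟩
  have hmaps : ∀ i, (h * g) (a i) ∈ Set.range b := by
    intro i
    rw [LinearEquiv.mul_apply]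
    by_cases hi : g (a i) = b i
    · rw [hi, hfix' i hi]; exact ⟨i, rfl⟩
    · rw [(hpm i).resolve_left hi, map_neg, hσ ⟨i, hi⟩, neg_neg]
      exact ⟨_, rfl⟩
  refine Set.Subset.antisymm ?_ ?_
  · rintro _ ⟨_, ⟨i, rfl⟩, rfl⟩
    exact hmaps i
  · rintro _ ⟨j, rfl⟩
    by_cases hj : g (a j) = b j
    · exact ⟨a j, ⟨j, rfl⟩, by rw [LinearEquiv.mul_apply, hj, hfix' j hj]⟩
    · refine ⟨a (σ.symm ⟨j, hj⟩), ⟨_, rfl⟩, ?_⟩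
      have h1 := (σ.symm ⟨j, hj⟩).2
      show (h * g) _ = _
      rw [LinearEquiv.mul_apply, (hpm _).resolve_left h1, map_neg, hσ, neg_neg,
        Equiv.apply_symm_apply]

end Bases

/-! ### Linear relations modulo two -/

section Words

variable {κ : Type*}

/-- A family of roots which is the basis of a subsystem: it is linearly independent and obtuse. -/
structure IsObtuseBasis (a : κ → Fin 8 → ℤ) : Prop where
  quad_eq_one : ∀ i, quad (a i) = 1
  form_nonpos : ∀ i j, i ≠ j → form (a i) (a j) ≤ 0
  linearIndependent : LinearIndependent ℤ a

/-- The set `S` of indices is a word of the family `a` of lattice vectors if the members of `a`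
indexed by `S` sum to zero modulo `2`. So words are the linear relations modulo `2`. -/
def IsWord (a : κ → Fin 8 → ℤ) (S : Finset κ) : Prop :=
  ∑ i ∈ S, red (a i) = 0

namespace IsObtuseBasis

variable {a b : κ → Fin 8 → ℤ} (ha : IsObtuseBasis a)
include ha

theorem form_self_eq (i : κ) : form (a i) (a i) = 2 := by
  rw [form_self, ha.quad_eq_one]; rfl

theorem form_eq_zero_or {i j : κ} (hij : i ≠ j) :
    form (a i) (a j) = 0 ∨ form (a i) (a j) = -1 := by
  have h1 := ha.form_nonpos i j hij
  have h2 := quad_pos (a := a i + a j) (fun h => by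
    classical
    have := linearIndependent_iff'.1 ha.linearIndependent ({i, j} : Finset κ) (fun _ => 1) (by
      rw [sum_pair hij, one_smul, one_smul, h]) i (by simp)
    exact absurd this one_ne_zero)
  rw [quad_add, ha.quad_eq_one, ha.quad_eq_one] at h2
  omega

theorem comp {κ' : Type*} {f : κ' → κ} (hf : Function.Injective f) : IsObtuseBasis (a ∘ f) where
  quad_eq_one _ := ha.quad_eq_one _
  form_nonpos _ _ hij := ha.form_nonpos _ _ (hf.ne hij)
  linearIndependent := ha.linearIndependent.comp f hf

/-- Positive combinations of a basis are nonzero, hence of norm at least that of a root. This is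
used to exclude the affine diagrams as subdiagrams. -/
theorem one_le_quad_sum (l : List (ℕ × κ)) (hl : ∃ p ∈ l, p.1 ≠ 0) :
    1 ≤ quad (l.map fun p => (p.1 : ℤ) • a p.2).sum := by
  classical
  refine quad_pos fun h => ?_
  have key : ∀ l : List (ℕ × κ), (l.map fun p => (p.1 : ℤ) • a p.2).sum =
      Finsupp.linearCombination ℤ a (l.map fun p => Finsupp.single p.2 (p.1 : ℤ)).sum := by
    intro l
    induction l with
    | nil => simp
    | cons p l ih =>
      rw [List.map_cons, List.sum_cons, List.map_cons, List.sum_cons, map_add, ih,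
        Finsupp.linearCombination_single]
  rw [key] at h
  have h0 := linearIndependent_iff.1 ha.linearIndependent _ h
  obtain ⟨q, hq, hq0⟩ := hl
  have h1 := DFunLike.congr_fun h0 q.2
  have h2 : ∀ l : List (ℕ × κ), 0 ≤ (l.map fun p => Finsupp.single p.2 (p.1 : ℤ)).sum q.2 := by
    intro l
    induction l with
    | nil => simp
    | cons p l ih =>
      rw [List.map_cons, List.sum_cons, Finsupp.add_apply, Finsupp.single_apply]
      split_ifs <;> omega
  have h3 : ∀ l : List (ℕ × κ), q ∈ l →
      0 < (l.map fun p => Finsupp.single p.2 (p.1 : ℤ)).sum q.2 := by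
    intro l
    induction l with
    | nil => simp
    | cons p l ih =>
      intro hq
      rw [List.map_cons, List.sum_cons, Finsupp.add_apply, Finsupp.single_apply]
      have := h2 l
      rcases List.mem_cons.1 hq with rfl | hq
      · rw [if_pos rfl]; omega
      · have := ih hq
        split_ifs <;> omega
  have := h3 l hq
  rw [h1] at this
  exact absurd this (lt_irrefl _)

/-- The diagram of a basis is a forest: there is no nonempty set of edges in which every vertex
has degree different from `1`. -/
theorem not_of_forall_exists_ne [Fintype κ] {H : κ → κ → Prop} (hsymm : ∀ i j, H i j → H j i)
    (hedge : ∀ i j, H i j → form (a i) (a j) = -1)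
    (hdeg : ∀ i j, H i j → ∃ k, k ≠ j ∧ H i k) (i j : κ) : ¬ H i j := by
  classical
  intro hij
  let n : κ → ℤ := fun i => if ∃ j, H i j then 1 else 0
  have hn : n = 0 := by
    refine eq_zero_of_form_sum_nonpos ha.linearIndependent (sum_nonpos fun i _ => ?_)
    by_cases hi : ∃ j, H i j
    · obtain ⟨j, hj⟩ := hi
      obtain ⟨k, hkj, hk⟩ := hdeg i j hj
      have hne : ∀ j, H i j → i ≠ j := by
        rintro j hj rfl
        have := hedge _ _ hj
        rw [ha.form_self_eq] at this
        exact absurd this (by decide)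
      have hnn : ∀ j, 0 ≤ n j := fun j => by simp only [n]; split_ifs <;> decide
      have hn1 : ∀ i j, H i j → n i = 1 := fun i j h => if_pos ⟨j, h⟩
      have hle : ∀ l, l ≠ i → n i * n l * form (a i) (a l) ≤ 0 := fun l hl =>
        mul_nonpos_of_nonneg_of_nonpos (mul_nonneg (hnn _) (hnn _)) (ha.form_nonpos _ _ hl.symm)
      have h1 : ∑ l, n i * n l * form (a i) (a l) ≤
          ∑ l ∈ {i, j, k}, n i * n l * form (a i) (a l) := by
        rw [← sum_sdiff (subset_univ ({i, j, k} : Finset κ))]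
        refine add_le_of_nonpos_left (sum_nonpos fun l hl => hle l ?_)
        rintro rfl
        simp at hl
      refine h1.trans (le_of_eq ?_)
      rw [sum_insert (by simp [hne j hj, hne k hk]), sum_pair hkj.symm, hn1 i j hj,
        hn1 j i (hsymm _ _ hj), hn1 k i (hsymm _ _ hk), hedge _ _ hj, hedge _ _ hk,
        ha.form_self_eq]
      rfl
    · have : n i = 0 := if_neg hi
      simp [this]
  have h1 : n i = 1 := if_pos ⟨j, hij⟩
  rw [hn] at h1
  exact absurd h1 zero_ne_one

/-- If every vertex has an even number of neighbors (counting a member of the set as a neighbor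
of itself twice) in each of two sets, then no edge joins the two sets. -/
theorem form_eq_zero_of_even [Fintype κ] {S T : Finset κ}
    (hS : ∀ i, Even (∑ j ∈ S, form (a i) (a j))) (hT : ∀ i, Even (∑ j ∈ T, form (a i) (a j)))
    {i j : κ} (hi : i ∈ S) (hj : j ∈ T) (hij : i ≠ j) : form (a i) (a j) = 0 := by
  classical
  have aux : ∀ {S : Finset κ} {i j : κ}, (∀ i, Even (∑ j ∈ S, form (a i) (a j))) → j ∈ S →
      form (a i) (a j) = -1 → ∃ k, k ≠ j ∧ k ∈ S ∧ form (a i) (a k) = -1 := by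
    intro S i j hS hj hij
    by_contra! hcon
    have h1 := hS i
    rw [← add_sum_erase S _ hj, hij] at h1
    have h2 : Even (∑ k ∈ S.erase j, form (a i) (a k)) := by
      refine even_sum _ fun k hk => ?_
      rw [mem_erase] at hk
      by_cases hik : i = k
      · rw [hik, ha.form_self_eq]; decide
      · rw [(ha.form_eq_zero_or hik).resolve_right (hcon k hk.1 hk.2)]; decide
    rw [Int.even_add] at h1
    exact absurd (h1.2 h2) (by decide)
  refine (ha.form_eq_zero_or hij).resolve_right fun h => ?_
  refine ha.not_of_forall_exists_ne (H := fun i j =>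
    form (a i) (a j) = -1 ∧ (i ∈ S ∧ j ∈ T ∨ i ∈ T ∧ j ∈ S)) ?_ (fun i j h => h.1) ?_ i j
    ⟨h, Or.inl ⟨hi, hj⟩⟩
  · rintro i j ⟨h, h'⟩
    exact ⟨form_comm (a i) (a j) ▸ h, h'.symm.imp And.symm And.symm⟩
  · rintro i j ⟨h, ⟨hi, hj⟩ | ⟨hi, hj⟩⟩
    · obtain ⟨k, hk, hkT, hik⟩ := aux hT hj h
      exact ⟨k, hk, hik, Or.inl ⟨hi, hkT⟩⟩
    · obtain ⟨k, hk, hkS, hik⟩ := aux hS hj h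
      exact ⟨k, hk, hik, Or.inr ⟨hi, hkS⟩⟩

end IsObtuseBasis

theorem IsWord.even {a : κ → Fin 8 → ℤ} {S : Finset κ} (hS : IsWord a S) (v : Fin 8 → ℤ) :
    Even (∑ j ∈ S, form v (a j)) := by
  have h : form (red v) (∑ j ∈ S, red (a j)) = 0 := by rw [hS, map_zero]
  rw [map_sum, sum_congr rfl fun j _ => form_red v (a j), ← Int.cast_sum,
    ZMod.intCast_zmod_eq_zero_iff_dvd] at h
  exact even_iff_two_dvd.2 h

theorem isWord_empty (a : κ → Fin 8 → ℤ) : IsWord a ∅ := sum_empty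

theorem IsWord.symmDiff [DecidableEq κ] {a : κ → Fin 8 → ℤ} {S T : Finset κ} (hS : IsWord a S)
    (hT : IsWord a T) : IsWord a (symmDiff S T) := by
  have h1 : ∑ i ∈ S ∩ T, red (a i) + ∑ i ∈ S \ T, red (a i) = 0 := by
    rw [sum_inter_add_sum_sdiff]; exact hS
  have h2 : ∑ i ∈ T ∩ S, red (a i) + ∑ i ∈ T \ S, red (a i) = 0 := by
    rw [sum_inter_add_sum_sdiff]; exact hT
  rw [IsWord, symmDiff_def, sup_eq_union, sum_union disjoint_sdiff_sdiff]
  have h3 := congrArg₂ (· + ·) h1 h2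
  rw [inter_comm T S] at h3
  rw [add_add_add_comm, add_self_eq_zero, zero_add, add_zero] at h3
  exact h3

namespace IsObtuseBasis

variable [Fintype κ] {a : κ → Fin 8 → ℤ} (ha : IsObtuseBasis a)
include ha

theorem form_eq_zero_of_isWord {S T : Finset κ} (hS : IsWord a S) (hT : IsWord a T)
    {i j : κ} (hi : i ∈ S) (hj : j ∈ T) (hij : i ≠ j) : form (a i) (a j) = 0 :=
  ha.form_eq_zero_of_even (fun _ => hS.even _) (fun _ => hT.even _) hi hj hij

theorem form_sum_of_isWord [DecidableEq κ] {S T : Finset κ} (hS : IsWord a S) (hT : IsWord a T) :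
    form (∑ i ∈ S, a i) (∑ i ∈ T, a i) = 2 * (S ∩ T).card := by
  simp only [map_sum, LinearMap.sum_apply]
  have h : ∀ i ∈ S, ∑ j ∈ T, form (a j) (a i) = if i ∈ T then 2 else 0 := by
    intro i hi
    split_ifs with hiT
    · rw [sum_eq_single i (fun j hj hji => ha.form_eq_zero_of_isWord hT hS hj hi hji)
        (fun h => absurd hiT h), ha.form_self_eq]
    · exact sum_eq_zero fun j hj => ha.form_eq_zero_of_isWord hT hS hj hi (by
        rintro rfl; exact hiT hj)
  rw [sum_comm, sum_congr rfl (fun i hi => (sum_congr rfl fun j _ => form_comm _ _).trans (h i hi)),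
    ← sum_filter, sum_const, filter_mem_eq_inter, nsmul_eq_mul, mul_comm]

/-- Half of the sum of a word is a lattice vector, so words form a doubly even code. -/
theorem four_dvd_card {S : Finset κ} (hS : IsWord a S) : 4 ∣ S.card := by
  classical
  have h1 := ha.form_sum_of_isWord hS hS
  rw [inter_self] at h1
  obtain ⟨d, hd⟩ := red_eq_zero_iff.1 ((map_sum red a S).trans hS)
  rw [form_self, hd, quad_smul] at h1
  omega

theorem even_card_inter [DecidableEq κ] {S T : Finset κ} (hS : IsWord a S) (hT : IsWord a T) :
    Even (S ∩ T).card := by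
  have h1 := ha.form_sum_of_isWord hS hT
  obtain ⟨d, hd⟩ := red_eq_zero_iff.1 ((map_sum red a S).trans hS)
  obtain ⟨e, he⟩ := red_eq_zero_iff.1 ((map_sum red a T).trans hT)
  rw [hd, he, map_smul, map_smul, LinearMap.smul_apply, smul_eq_mul, smul_eq_mul] at h1
  rw [even_iff_two_dvd]
  omega

end IsObtuseBasis

/-- Five mutually orthogonal roots are linearly dependent modulo `2`: totally isotropic subspaces
have dimension at most `4`. -/
theorem exists_isWord_of_card_eq_five {a : κ → Fin 8 → ℤ}
    {F : Finset κ} (hF : F.card = 5) (horth : ∀ i ∈ F, ∀ j ∈ F, i ≠ j → form (a i) (a j) = 0) :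
    ∃ w ⊆ F, w.Nonempty ∧ IsWord a w := by
  classical
  by_contra! hcon
  have hli : LinearIndependent (ZMod 2) (fun i : F => red (a i)) := by
    rw [Fintype.linearIndependent_iff]
    intro c hc i
    by_contra hi
    have hc1 : ∀ j, c j = 1 ∨ c j = 0 := fun j => by
      generalize c j = x; revert x; decide
    refine hcon ((univ.filter fun i => c i = 1).map (Function.Embedding.subtype _)) ?_
      ⟨i, by simpa using (hc1 i).resolve_right hi⟩ ?_
    · intro i hi
      obtain ⟨j, -, rfl⟩ := mem_map.1 hi
      exact j.2
    · rw [IsWord, sum_map, sum_filter]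
      refine Eq.trans (sum_congr rfl fun i _ => ?_) hc
      rcases hc1 i with h | h <;> simp [h]
  set U := Submodule.span (ZMod 2) (Set.range fun i : F => red (a i)) with hU
  have hdim : Module.finrank (ZMod 2) U = 5 := by
    rw [finrank_span_eq_card hli, Fintype.card_coe, hF]
  have hiso : U ≤ LinearMap.BilinForm.orthogonal form U := by
    intro x hx y hy
    show form y x = 0
    induction hx using Submodule.span_induction with
    | mem x hx =>
      obtain ⟨i, rfl⟩ := hx
      induction hy using Submodule.span_induction with
      | mem y hy =>
        obtain ⟨j, rfl⟩ := hy
        by_cases hij : j = i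
        · rw [hij]; exact form_self_mod_two _
        · simp only
          rw [form_red, horth j j.2 i i.2 (by rwa [ne_eq, ← Subtype.ext_iff])]; rfl
      | zero => simp
      | add _ _ _ _ h1 h2 => rw [map_add, LinearMap.add_apply, h1, h2, add_zero]
      | smul _ _ _ h => rw [map_smul, LinearMap.smul_apply, h, smul_zero]
    | zero => simp
    | add _ _ _ _ h1 h2 => rw [map_add, h1, h2, add_zero]
    | smul _ _ _ h => rw [map_smul, h, smul_zero]
  have h1 := LinearMap.BilinForm.finrank_orthogonal
    (B := (form : LinearMap.BilinForm (ZMod 2) (Fin 8 → ZMod 2))) 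
    ⟨fun _ h => eq_zero_of_form_eq_zero h,
      fun _ h => eq_zero_of_form_eq_zero fun y => (form_comm _ _).trans (h y)⟩ U
  have h2 := Submodule.finrank_mono hiso
  rw [h1, hdim, Module.finrank_fin_fun] at h2
  omega

end Words

/-! ### Matching the linear relations of isomorphic bases -/

section Matching

variable {κ : Type*}

theorem isWord_comp_iff {a : κ → Fin 8 → ℤ} (σ : Equiv.Perm κ) (S : Finset κ) :
    IsWord (a ∘ σ) S ↔ IsWord a (S.map σ.toEmbedding) := by
  rw [IsWord, IsWord, sum_map]; rfl

variable [Fintype κ]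

/-- Two distinct words of size `4` do not lie in a common set of size `5`. -/
theorem IsObtuseBasis.eq_of_subset [DecidableEq κ] {a : κ → Fin 8 → ℤ} (ha : IsObtuseBasis a)
    {F S T : Finset κ} (hF : F.card = 5) (hS : IsWord a S) (hT : IsWord a T) (hS4 : S.card = 4)
    (hT4 : T.card = 4) (hSF : S ⊆ F) (hTF : T ⊆ F) : S = T := by
  have h1 := ha.even_card_inter hS hT
  have h2 := card_union_add_card_inter S T
  have h3 := card_le_card (union_subset hSF hTF)
  have h4 := card_le_card (inter_subset_left (s₁ := S) (s₂ := T))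
  have h5 : (S ∩ T).card = 4 := by
    obtain ⟨k, hk⟩ := h1
    omega
  have h6 := eq_of_subset_of_card_le (inter_subset_left (s₁ := S) (s₂ := T)) (by omega)
  have h7 := eq_of_subset_of_card_le (inter_subset_right (s₁ := S) (s₂ := T)) (by omega)
  exact h6.symm.trans h7

theorem IsObtuseBasis.exists_isWord_of_orthogonal {a : κ → Fin 8 → ℤ} (ha : IsObtuseBasis a)
    {F : Finset κ} (hF : F.card = 5)
    (horth : ∀ i ∈ F, ∀ j ∈ F, i ≠ j → form (a i) (a j) = 0) :
    ∃ w ⊆ F, w.card = 4 ∧ IsWord a w := by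
  obtain ⟨w, hw, hne, hww⟩ := exists_isWord_of_card_eq_five hF horth
  have h1 := ha.four_dvd_card hww
  have h2 := card_le_card hw
  have h3 := hne.card_pos
  exact ⟨w, hw, by omega, hww⟩

/-- Let `a` and `b` be bases with the same Cartan matrix, and let a set of five mutually orthogonal
members contain different words of `a` and `b`. These words differ by exchanging two indices. The
exchange is a symmetry of the Cartan matrix: every member has evenly many neighbors in both words,
hence is adjacent to both or to none of the two. After it the bases have more common words. -/
theorem exists_perm_of_ne [DecidableEq κ] {a b : κ → Fin 8 → ℤ} (ha : IsObtuseBasis a)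
    (hb : IsObtuseBasis b) (hab : ∀ i j, form (a i) (a j) = form (b i) (b j))
    {F w w' : Finset κ} (hF : F.card = 5) (hw : IsWord a w) (hw' : IsWord b w')
    (hw4 : w.card = 4) (hw4' : w'.card = 4) (hwF : w ⊆ F) (hwF' : w' ⊆ F) (hne : w ≠ w') :
    ∃ σ : Equiv.Perm κ, (∀ i j, form (a (σ i)) (a (σ j)) = form (a i) (a j)) ∧
      (∀ S, IsWord a S → IsWord b S → IsWord (a ∘ σ) S) ∧ IsWord (a ∘ σ) w' ∧ ¬ IsWord a w' := by
  have hnotin : ¬ IsWord a w' := fun h =>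
    hne (ha.eq_of_subset hF hw h hw4 hw4' hwF hwF')
  have hinter : (w ∩ w').card = 3 := by
    have h2 := card_union_add_card_inter w w'
    have h3 := card_le_card (union_subset hwF hwF')
    have h4 := card_le_card (inter_subset_left (s₁ := w) (s₂ := w'))
    have h5 : (w ∩ w').card ≠ 4 := fun h => hne <|
      (eq_of_subset_of_card_le (inter_subset_left (s₁ := w) (s₂ := w')) (by omega)).symm.trans
      (eq_of_subset_of_card_le (inter_subset_right (s₁ := w) (s₂ := w')) (by omega))
    omega
  obtain ⟨o, ho⟩ := card_eq_one.1 (show (w \ w').card = 1 by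
    have := card_sdiff_add_card_inter w w'; omega)
  obtain ⟨o', ho'⟩ := card_eq_one.1 (show (w' \ w).card = 1 by
    have := card_sdiff_add_card_inter w' w; rw [inter_comm] at this; omega)
  have how : o ∈ w ∧ o ∉ w' := mem_sdiff.1 (ho ▸ mem_singleton_self o)
  have how' : o' ∈ w' ∧ o' ∉ w := mem_sdiff.1 (ho' ▸ mem_singleton_self o')
  have hoo : o ≠ o' := fun h => how.2 (h ▸ how'.1)
  have hsum : ∀ f : κ → ℤ, ∑ i ∈ w, f i = ∑ i ∈ w ∩ w', f i + f o := fun f => by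
    rw [← sum_inter_add_sum_sdiff w w', ho, sum_singleton]
  have hsum' : ∀ f : κ → ℤ, ∑ i ∈ w', f i = ∑ i ∈ w ∩ w', f i + f o' := fun f => by
    rw [← sum_inter_add_sum_sdiff w' w, ho', sum_singleton, inter_comm]
  have htwin : ∀ x, x ≠ o → x ≠ o' → form (a x) (a o) = form (a x) (a o') := by
    intro x hx hx'
    have h1 := hw.even (a x)
    have h2 := hw'.even (b x)
    rw [sum_congr rfl fun j _ => (hab x j).symm] at h2
    rw [hsum fun i => form (a x) (a i)] at h1
    rw [hsum' fun i => form (a x) (a i)] at h2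
    obtain ⟨k, hk⟩ := h1
    obtain ⟨l, hl⟩ := h2
    rcases ha.form_eq_zero_or hx with h3 | h3 <;>
      rcases ha.form_eq_zero_or hx' with h4 | h4 <;> rw [h3] at hk ⊢ <;> rw [h4] at hl ⊢ <;> omega
  set σ := Equiv.swap o o' with hσ
  refine ⟨σ, ?_, ?_, ?_, hnotin⟩
  · have h1 : ∀ i j, i ≠ o → i ≠ o' → form (a i) (a (σ j)) = form (a i) (a j) := by
      intro i j hi hi'
      by_cases hj : j = o
      · rw [hj, hσ, Equiv.swap_apply_left, htwin i hi hi']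
      by_cases hj' : j = o'
      · rw [hj', hσ, Equiv.swap_apply_right, htwin i hi hi']
      rw [hσ, Equiv.swap_apply_of_ne_of_ne hj hj']
    have h2 : ∀ i j, j ≠ o → j ≠ o' → form (a (σ i)) (a (σ j)) = form (a i) (a j) := by
      intro i j hj hj'
      rw [hσ, Equiv.swap_apply_of_ne_of_ne hj hj', form_comm, ← hσ, h1 j i hj hj', form_comm]
    intro i j
    by_cases hj : j ≠ o ∧ j ≠ o'
    · exact h2 i j hj.1 hj.2
    by_cases hi : i ≠ o ∧ i ≠ o'
    · rw [form_comm, h2 j i hi.1 hi.2, form_comm]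
    have hi' : i = o ∨ i = o' := by tauto
    have hj' : j = o ∨ j = o' := by tauto
    rcases hi' with rfl | rfl <;> rcases hj' with rfl | rfl <;>
      simp [hσ, ha.form_self_eq, form_comm]
  · intro S hSa hSb
    rw [isWord_comp_iff]
    have h1 := ha.even_card_inter hSa hw
    have h2 := hb.even_card_inter hSb hw'
    rw [card_eq_sum_ones, inter_comm, ← filter_mem_eq_inter, sum_filter] at h1 h2
    have h3 : o ∈ S ↔ o' ∈ S := by
      have h4 : ∑ i ∈ w, (if i ∈ S then 1 else 0) =
          ∑ i ∈ w ∩ w', (if i ∈ S then 1 else 0) + if o ∈ S then 1 else 0 := by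
        rw [← sum_inter_add_sum_sdiff w w', ho, sum_singleton]
      have h5 : ∑ i ∈ w', (if i ∈ S then 1 else 0) =
          ∑ i ∈ w ∩ w', (if i ∈ S then 1 else 0) + if o' ∈ S then 1 else 0 := by
        rw [← sum_inter_add_sum_sdiff w' w, ho', sum_singleton, inter_comm]
      rw [h4] at h1
      rw [h5] at h2
      obtain ⟨k, hk⟩ := h1
      obtain ⟨l, hl⟩ := h2
      by_cases h6 : o ∈ S <;> by_cases h7 : o' ∈ S <;>
        simp only [h6, h7, if_true, if_false] at hk hl ⊢ <;> omega
    have h4 : S.map σ.toEmbedding = S := by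
      refine eq_of_subset_of_card_le (fun x hx => ?_) (card_map _).ge
      obtain ⟨y, hy, rfl⟩ := mem_map.1 hx
      rw [Equiv.coe_toEmbedding]
      by_cases hyo : y = o
      · rw [hyo, hσ, Equiv.swap_apply_left, ← h3, ← hyo]; exact hy
      by_cases hyo' : y = o'
      · rw [hyo', hσ, Equiv.swap_apply_right, h3, ← hyo']; exact hy
      rw [hσ, Equiv.swap_apply_of_ne_of_ne hyo hyo']; exact hy
    rw [h4]; exact hSa
  · rw [isWord_comp_iff]
    have h4 : w'.map σ.toEmbedding = w := by
      refine eq_of_subset_of_card_le (fun x hx => ?_) (by rw [card_map]; omega)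
      obtain ⟨y, hy, rfl⟩ := mem_map.1 hx
      rw [Equiv.coe_toEmbedding]
      have hyo : y ≠ o := fun h => how.2 (h ▸ hy)
      by_cases hyo' : y = o'
      · rw [hyo', hσ, Equiv.swap_apply_right]; exact how.1
      rw [hσ, Equiv.swap_apply_of_ne_of_ne hyo hyo']
      by_contra hyw
      exact hyo' (mem_singleton.1 (ho' ▸ mem_sdiff.2 ⟨hy, hyw⟩))
    rw [h4]; exact hw

/-- Five mutually orthogonal members which contain different words of the two bases exist as soon
as some word of one of them is not a word of the other, unless all words of both lie in this one
word and it has four elements. -/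
theorem exists_five_of_isWord [DecidableEq κ] {a b : κ → Fin 8 → ℤ} (ha : IsObtuseBasis a)
    (hb : IsObtuseBasis b) (hab : ∀ i j, form (a i) (a j) = form (b i) (b j))
    {S : Finset κ} (hSa : IsWord a S) (hSb : ¬ IsWord b S)
    (hmin : ∀ T, T.card < S.card → (IsWord a T ↔ IsWord b T)) :
    (∃ F w w' : Finset κ, F.card = 5 ∧ IsWord a w ∧ IsWord b w' ∧ w.card = 4 ∧ w'.card = 4 ∧
      w ⊆ F ∧ w' ⊆ F ∧ w ≠ w') ∨
    S.card = 4 ∧ (∀ T, IsWord a T → T ⊆ S) ∧ ∀ T, IsWord b T → T ⊆ S := by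
  have hpos : S.card ≠ 0 := fun h => hSb (by rw [card_eq_zero.1 h]; exact isWord_empty b)
  have h4 := ha.four_dvd_card hSa
  have hevenb : ∀ {T}, IsWord b T → ∀ i, Even (∑ j ∈ T, form (a i) (a j)) := fun hT i => by
    rw [sum_congr rfl fun j _ => hab i j]; exact hT.even _
  by_cases hS5 : 5 ≤ S.card
  · left
    obtain ⟨F, hFS, hF⟩ := exists_subset_card_eq hS5
    have horth : ∀ i ∈ F, ∀ j ∈ F, i ≠ j → form (a i) (a j) = 0 := fun i hi j hj =>
      ha.form_eq_zero_of_isWord hSa hSa (hFS hi) (hFS hj)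
    obtain ⟨w, hwF, hw4, hw⟩ := ha.exists_isWord_of_orthogonal hF horth
    obtain ⟨w', hwF', hw4', hw'⟩ := hb.exists_isWord_of_orthogonal hF
      (fun i hi j hj hij => (hab i j).symm.trans (horth i hi j hj hij))
    refine ⟨F, w, w', hF, hw, hw', hw4, hw4', hwF, hwF', ?_⟩
    -- If the words coincide, then removing them from `S` contradicts the minimality of `S`.
    rintro rfl
    have hsub := hwF.trans hFS
    have hsd : symmDiff S w = S \ w := by
      rw [symmDiff_def, sdiff_eq_bot_iff.2 hsub, sup_bot_eq]
    have h1 := hSa.symmDiff hw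
    have hlt : (symmDiff S w).card < S.card := by
      rw [hsd, card_sdiff_of_subset hsub]; omega
    have h2 := ((hmin _ hlt).1 h1).symmDiff hw'
    rw [symmDiff_symmDiff_cancel_right] at h2
    exact hSb h2
  by_cases hall : (∀ T, IsWord a T → T ⊆ S) ∧ ∀ T, IsWord b T → T ⊆ S
  · exact Or.inr ⟨by omega, hall⟩
  left
  obtain ⟨T, hT, hTS⟩ : ∃ T, (IsWord a T ∨ IsWord b T) ∧ ¬ T ⊆ S := by
    by_contra! h
    exact hall ⟨fun T hT => h T (Or.inl hT), fun T hT => h T (Or.inr hT)⟩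
  obtain ⟨o, hoT, hoS⟩ := not_subset.1 hTS
  have heven : ∀ i, Even (∑ j ∈ T, form (a i) (a j)) :=
    hT.elim (fun h i => h.even _) hevenb
  have hF : (insert o S).card = 5 := by rw [card_insert_of_notMem hoS]; omega
  have horth : ∀ i ∈ insert o S, ∀ j ∈ insert o S, i ≠ j → form (a i) (a j) = 0 := by
    intro i hi j hj hij
    rcases mem_insert.1 hi with hi' | hi' <;> rcases mem_insert.1 hj with hj' | hj'
    · exact absurd (hi'.trans hj'.symm) hij
    · exact ha.form_eq_zero_of_even heven (fun _ => hSa.even _) (hi' ▸ hoT) hj' hij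
    · exact ha.form_eq_zero_of_even (fun _ => hSa.even _) heven hi' (hj' ▸ hoT) hij
    · exact ha.form_eq_zero_of_isWord hSa hSa hi' hj' hij
  obtain ⟨w', hwF', hw4', hw'⟩ := hb.exists_isWord_of_orthogonal hF
    (fun i hi j hj hij => (hab i j).symm.trans (horth i hi j hj hij))
  refine ⟨_, S, w', hF, hSa, hw', by omega, hw4', subset_insert _ _, hwF', ?_⟩
  rintro rfl
  exact hSb hw'

/-- Two bases with the same Cartan matrix have, up to a symmetry of the Cartan matrix, the same
relations modulo `2`, unless one of them has a word with four elements and the other has only the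
empty word. -/
theorem exists_perm_or_exceptional {a b : κ → Fin 8 → ℤ} (ha : IsObtuseBasis a)
    (hb : IsObtuseBasis b) (hab : ∀ i j, form (a i) (a j) = form (b i) (b j)) :
    (∃ σ : Equiv.Perm κ, (∀ i j, form (a (σ i)) (a (σ j)) = form (a i) (a j)) ∧
      ∀ S, IsWord (a ∘ σ) S ↔ IsWord b S) ∨
    ∃ O : Finset κ, O.card = 4 ∧ (IsWord a O ∧ (∀ S, IsWord b S → S = ∅) ∨
      IsWord b O ∧ (∀ S, IsWord a S → S = ∅)) := by
  classical
  induction hn : Fintype.card (Finset κ) - (univ.filter fun S => IsWord a S ∧ IsWord b S).card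
    using Nat.strong_induction_on generalizing a with
  | _ n ih =>
    by_cases hall : ∀ S, IsWord a S ↔ IsWord b S
    · exact Or.inl ⟨1, fun _ _ => rfl, hall⟩
    obtain ⟨S, hS, hmin⟩ : ∃ S : Finset κ, ¬ (IsWord a S ↔ IsWord b S) ∧
        ∀ T : Finset κ, T.card < S.card → (IsWord a T ↔ IsWord b T) := by
      push Not at hall
      have hne : {k : ℕ | ∃ S : Finset κ, ¬ (IsWord a S ↔ IsWord b S) ∧ S.card = k}.Nonempty := by
        obtain ⟨S, hS⟩ := hall
        exact ⟨_, S, by tauto, rfl⟩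
      obtain ⟨S, hS, hk⟩ := Nat.sInf_mem hne
      refine ⟨S, hS, fun T hT => ?_⟩
      by_contra hT'
      have := Nat.sInf_le (s := {k : ℕ | ∃ S : Finset κ, ¬ (IsWord a S ↔ IsWord b S) ∧
        S.card = k}) ⟨T, hT', rfl⟩
      omega
    have hfive : (∃ F w w' : Finset κ, F.card = 5 ∧ IsWord a w ∧ IsWord b w' ∧ w.card = 4 ∧
        w'.card = 4 ∧ w ⊆ F ∧ w' ⊆ F ∧ w ≠ w') ∨
        S.card = 4 ∧ (∀ T, IsWord a T → T ⊆ S) ∧ ∀ T, IsWord b T → T ⊆ S := by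
      by_cases hSa : IsWord a S
      · exact exists_five_of_isWord ha hb hab hSa (by tauto) hmin
      · rcases exists_five_of_isWord hb ha (fun i j => (hab i j).symm) (S := S) (by tauto) hSa
          (fun T hT => (hmin T hT).symm) with ⟨F, w, w', h1, h2, h3, h4, h5, h6, h7, h8⟩ | h
        · exact Or.inl ⟨F, w', w, h1, h3, h2, h5, h4, h7, h6, h8.symm⟩
        · exact Or.inr ⟨h.1, h.2.2, h.2.1⟩
    rcases hfive with ⟨F, w, w', hF, hw, hw', hw4, hw4', hwF, hwF', hne⟩ | ⟨hS4, hSa, hSb⟩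
    · obtain ⟨σ, hσ, hkeep, hnew, hold⟩ :=
        exists_perm_of_ne ha hb hab hF hw hw' hw4 hw4' hwF hwF' hne
      have hlt : (univ.filter fun S => IsWord a S ∧ IsWord b S).card <
          (univ.filter fun S => IsWord (a ∘ σ) S ∧ IsWord b S).card := by
        refine card_lt_card ⟨fun S hS => ?_, fun h => ?_⟩
        · rw [mem_filter] at hS ⊢
          exact ⟨hS.1, hkeep S hS.2.1 hS.2.2, hS.2.2⟩
        · exact hold (mem_filter.1 (h (mem_filter.2 ⟨mem_univ _, hnew, hw'⟩))).2.1
      have hle := card_le_univ (univ.filter fun S => IsWord (a ∘ σ) S ∧ IsWord b S)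
      rcases ih _ (by omega) (ha.comp σ.injective) (fun i j => (hσ i j).trans (hab i j)) rfl with
        ⟨τ, hτ, hτ'⟩ | ⟨O, hO, h | h⟩
      · exact Or.inl ⟨τ.trans σ, fun i j => (hτ i j).trans (hσ i j), hτ'⟩
      · refine Or.inr ⟨O.map σ.toEmbedding, by rw [card_map, hO], Or.inl ⟨?_, h.2⟩⟩
        exact (isWord_comp_iff σ O).1 h.1
      · refine Or.inr ⟨O, hO, Or.inr ⟨h.1, fun T hT => ?_⟩⟩
        have := h.2 (T.map σ.symm.toEmbedding) ((isWord_comp_iff σ _).2 (by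
          rw [map_map]
          convert hT
          ext x
          simp))
        exact map_eq_empty.1 this
    · right
      have key : ∀ {c : κ → Fin 8 → ℤ}, IsObtuseBasis c → ¬ IsWord c S →
          (∀ T, IsWord c T → T ⊆ S) → ∀ T, IsWord c T → T = ∅ := by
        intro c hc hS hcS T hT
        have h1 := hc.four_dvd_card hT
        have h2 := card_le_card (hcS T hT)
        have h3 : T.card ≠ 4 := fun h =>
          hS (eq_of_subset_of_card_le (hcS T hT) (by omega) ▸ hT)
        exact card_eq_zero.1 (by omega)
      refine ⟨S, hS4, ?_⟩
      by_cases h : IsWord a S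
      · exact Or.inl ⟨h, key hb (by tauto) hSb⟩
      · exact Or.inr ⟨by tauto, key ha h hSa⟩

end Matching

/-! ### Subdiagrams of a chain with seven vertices -/

section Subchain

/-- The members of a family with Cartan matrix `c` are placed at vertices of the chain `A₇`,
including the four vertices `0`, `2`, `4`, `6`, so that `c` is the corresponding submatrix of the
Cartan matrix of `A₇`. These are the Cartan matrices of the special types. -/
structure IsSubchain {κ : Type*} (c : κ → κ → ℤ) (pos : κ → Fin 7) : Prop where
  injective : Function.Injective pos
  eq_cartan : ∀ i j, c i j = CartanMatrix.A 7 (pos i) (pos j)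
  mem_range : ∀ k : Fin 4, ∃ i, (pos i).val = 2 * k.val

/-- The types of the subdiagrams of `A₇` containing the vertices `0`, `2`, `4`, `6`, with the
positions of the first vertices of the components. -/
def chainTypes : List (List ℕ × List ℕ) :=
  [([7], [0]), ([5, 1], [0, 6]), ([5, 1], [2, 0]), ([3, 3], [0, 4]), ([3, 1, 1], [0, 4, 6]),
    ([3, 1, 1], [2, 0, 6]), ([3, 1, 1], [4, 0, 2]), ([1, 1, 1, 1], [0, 2, 4, 6])]

/-- The position in `A₇` of a vertex of a diagram of type `τ`, if the components start at `off`. -/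
def chainPos (τ off : List ℕ) (x : Σ t : Fin τ.length, Fin (τ.get t)) : Fin 7 :=
  Fin.ofNat 7 (off.getD x.1 0 + x.2)

theorem chainPos_injective : ∀ p ∈ chainTypes, ∀ x y,
    chainPos p.1 p.2 x = chainPos p.1 p.2 y → x = y := by
  decide +kernel

theorem chainPos_cartan_same : ∀ p ∈ chainTypes, ∀ (t : Fin p.1.length) (i j : Fin (p.1.get t)),
    CartanMatrix.A (p.1.get t) i j -
      CartanMatrix.A 7 (chainPos p.1 p.2 ⟨t, i⟩) (chainPos p.1 p.2 ⟨t, j⟩) = 0 := by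
  decide +kernel

theorem chainPos_cartan_ne : ∀ p ∈ chainTypes, ∀ x y : (Σ t : Fin p.1.length, Fin (p.1.get t)),
    x.1 ≠ y.1 → CartanMatrix.A 7 (chainPos p.1 p.2 x) (chainPos p.1 p.2 y) = 0 := by
  decide +kernel

theorem chainPos_cartan {p : List ℕ × List ℕ} (hp : p ∈ chainTypes)
    (x y : Σ t : Fin p.1.length, Fin (p.1.get t)) :
    Matrix.blockDiagonal' (fun t : Fin p.1.length => CartanMatrix.A (p.1.get t)) x y =
      CartanMatrix.A 7 (chainPos p.1 p.2 x) (chainPos p.1 p.2 y) := by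
  obtain ⟨t, i⟩ := x
  obtain ⟨t', j⟩ := y
  by_cases h : t = t'
  · subst h
    rw [Matrix.blockDiagonal'_apply_eq]
    exact sub_eq_zero.1 (chainPos_cartan_same p hp t i j)
  · rw [Matrix.blockDiagonal'_apply_ne _ _ _ h]
    exact (chainPos_cartan_ne p hp ⟨t, i⟩ ⟨t', j⟩ h).symm

theorem chainPos_mem_range : ∀ p ∈ chainTypes, ∀ k : Fin 4, ∃ x,
    (chainPos p.1 p.2 x).val = 2 * k.val := by
  decide +kernel

/-- The list `chainTypes` is complete. -/
theorem exists_chainTypes : ∀ Y : Finset (Fin 7), {0, 2, 4, 6} ⊆ Y → ∃ p ∈ chainTypes,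
    ∀ k, k ∈ Y ↔ ∃ x, chainPos p.1 p.2 x = k := by
  decide +kernel

theorem mem_specialTypes : ∀ p ∈ chainTypes, p.1 ∈ specialTypes := by decide

theorem exists_chainTypes_of_mem : ∀ τ ∈ specialTypes, ∃ p ∈ chainTypes, p.1 = τ := by decide

/-- A set of vertices of `A₇` of cardinality divisible by `4` in which all even vertices have evenly
many neighbors is empty or consists of the even vertices. -/
theorem word_of_A7 : ∀ K : Finset (Fin 7),
    (∀ k : Fin 7, k.val % 2 = 0 → (∑ l ∈ K, CartanMatrix.A 7 k l) % 2 = 0) → K.card % 4 = 0 →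
      K = ∅ ∨ K = {0, 2, 4, 6} := by
  decide +kernel

variable {κ : Type*} {c : κ → κ → ℤ} {pos : κ → Fin 7}

theorem isSubchain_chainPos {p : List ℕ × List ℕ} (hp : p ∈ chainTypes)
    {c : (Σ t : Fin p.1.length, Fin (p.1.get t)) → (Σ t : Fin p.1.length, Fin (p.1.get t)) → ℤ}
    (hc : ∀ x y, c x y =
      Matrix.blockDiagonal' (fun t : Fin p.1.length => CartanMatrix.A (p.1.get t)) x y) :
    IsSubchain c (chainPos p.1 p.2) where
  injective x y h := chainPos_injective p hp x y h
  eq_cartan x y := (hc x y).trans (chainPos_cartan hp x y)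
  mem_range := chainPos_mem_range p hp

namespace IsSubchain

variable (hc : IsSubchain c pos)
include hc

/-- Submatrices of the Cartan matrix of `A₇` containing the vertices `0`, `2`, `4`, `6` are those
of special type. -/
theorem exists_equiv : ∃ τ ∈ specialTypes, ∃ f : (Σ t : Fin τ.length, Fin (τ.get t)) ≃ κ,
    ∀ x y, c (f x) (f y) =
      Matrix.blockDiagonal' (fun t : Fin τ.length => CartanMatrix.A (τ.get t)) x y := by
  classical
  have hfin : Finite κ := Finite.of_injective pos hc.injective
  have := Fintype.ofFinite κ
  have heven : ({0, 2, 4, 6} : Finset (Fin 7)) ⊆ univ.image pos := by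
    intro k hk
    have : ∀ k ∈ ({0, 2, 4, 6} : Finset (Fin 7)), ∃ l : Fin 4, k.val = 2 * l.val := by decide
    obtain ⟨l, hl⟩ := this k hk
    obtain ⟨i, hi⟩ := hc.mem_range l
    exact mem_image.2 ⟨i, mem_univ _, Fin.ext (hi.trans hl.symm)⟩
  obtain ⟨p, hp, hrange⟩ := exists_chainTypes _ heven
  have h1 : ∀ x, ∃ i, pos i = chainPos p.1 p.2 x := fun x => by
    obtain ⟨i, -, hi⟩ := mem_image.1 ((hrange _).2 ⟨x, rfl⟩)
    exact ⟨i, hi⟩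
  choose f hf using h1
  have hbij : Function.Bijective f := by
    constructor
    · intro x y hxy
      exact chainPos_injective p hp x y (by rw [← hf, ← hf, hxy])
    · intro i
      obtain ⟨x, hx⟩ := (hrange (pos i)).1 (mem_image_of_mem _ (mem_univ i))
      exact ⟨x, hc.injective (by rw [hf, hx])⟩
  refine ⟨p.1, mem_specialTypes p hp, Equiv.ofBijective f hbij, fun x y => ?_⟩
  rw [chainPos_cartan hp, Equiv.ofBijective_apply, Equiv.ofBijective_apply, hc.eq_cartan, hf, hf]

theorem map_even [Fintype κ] : (univ.filter fun i => (pos i).val % 2 = 0).map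
    ⟨pos, hc.injective⟩ = {0, 2, 4, 6} := by
  ext k
  simp only [mem_map, mem_filter, mem_univ, true_and, Function.Embedding.coeFn_mk]
  constructor
  · rintro ⟨i, hi, rfl⟩
    revert hi
    generalize pos i = k
    revert k; decide
  · intro hk
    have : ∀ k ∈ ({0, 2, 4, 6} : Finset (Fin 7)), ∃ l : Fin 4, k.val = 2 * l.val := by decide
    obtain ⟨l, hl⟩ := this k hk
    obtain ⟨i, hi⟩ := hc.mem_range l
    exact ⟨i, by omega, Fin.ext (hi.trans hl.symm)⟩

theorem card_even [Fintype κ] : (univ.filter fun i => (pos i).val % 2 = 0).card = 4 := by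
  rw [← card_map ⟨pos, hc.injective⟩, hc.map_even]
  rfl

end IsSubchain

/-- In a basis of special type, the only possible nontrivial relation modulo `2` is that the
members at even positions, which form the perfect moset, sum to zero. -/
theorem IsSubchain.isWord_eq [Fintype κ] {a : κ → Fin 8 → ℤ}
    (hc : IsSubchain (fun i j => form (a i) (a j)) pos) (ha : IsObtuseBasis a) {S : Finset κ}
    (hS : IsWord a S) : S = ∅ ∨ S = univ.filter fun i => (pos i).val % 2 = 0 := by
  have h := word_of_A7 (S.map ⟨pos, hc.injective⟩) (fun k hk => by
    obtain ⟨i, hi⟩ := hc.mem_range ⟨k.val / 2, by omega⟩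
    have hik : pos i = k := Fin.ext (by rw [hi]; simp only; omega)
    rw [sum_map]
    have := hS.even (a i)
    rw [sum_congr rfl fun j _ => hc.eq_cartan i j, hik] at this
    exact Int.even_iff.1 this) (by
    rw [card_map]
    exact Nat.mod_eq_zero_of_dvd (ha.four_dvd_card hS))
  rcases h with h | h
  · exact Or.inl (map_eq_empty.1 h)
  · right
    ext i
    rw [← mem_map' ⟨pos, hc.injective⟩, h]
    simp only [Function.Embedding.coeFn_mk, mem_filter, mem_univ, true_and]
    generalize pos i = k
    revert k; decide

/-- The graph with vertices `0`, `1`, `2`, `3` and with the edges `01`, `02`, `03`, `12`, `13`, `23`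
for which the corresponding argument is `true`. -/
def fourGraph (a b c d f g : Bool) : Fin 4 → Fin 4 → Bool :=
  ![![false, a, b, c], ![a, false, d, f], ![b, d, false, g], ![c, f, g, false]]

/-- A graph on four vertices without cycles and without a vertex of degree three is contained in
the path through the four vertices in a suitable order. -/
theorem exists_path_order : ∀ a b c d f g : Bool,
    (∀ i j k, (fourGraph a b c d f g i j && fourGraph a b c d f g j k &&
      fourGraph a b c d f g k i) = false) →
    (∀ i j k l, i ≠ k → j ≠ l → (fourGraph a b c d f g i j && fourGraph a b c d f g j k &&
      fourGraph a b c d f g k l && fourGraph a b c d f g l i) = false) →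
    (∀ i j k l, j ≠ k → j ≠ l → k ≠ l → (fourGraph a b c d f g i j && fourGraph a b c d f g i k &&
      fourGraph a b c d f g i l) = false) →
    ∃ σ : Equiv.Perm (Fin 4), fourGraph a b c d f g (σ 0) (σ 2) = false ∧
      fourGraph a b c d f g (σ 0) (σ 3) = false ∧ fourGraph a b c d f g (σ 1) (σ 3) = false := by
  decide +kernel

/-- The pairs of neighbors of a vertex with a positive even number of neighbors among four. -/
theorem exists_pair_of_even : ∀ g : Fin 4 → Bool, (g 0 ^^ g 1 ^^ g 2 ^^ g 3) = false →
    (∃ k, g k = true) → (∃ k, g k = false) →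
    ∃ i j, i ≠ j ∧ ∀ k, g k = true ↔ k = i ∨ k = j := by
  decide +kernel

end Subchain

section

variable {κ : Type*}

theorem cartanMatrix_A_apply (n : ℕ) (k l : Fin n) : CartanMatrix.A n k l =
    if k.val = l.val then 2 else if k.val + 1 = l.val ∨ l.val + 1 = k.val then -1 else 0 := by
  simp only [CartanMatrix.A, Matrix.of_apply, Fin.ext_iff]

/-- Let four mutually orthogonal members of a basis be such that every other member has evenly many
neighbors, but not zero, among them. Then the basis is of special type: every other member has two
neighbors among the four and can be regarded as an edge between them, and the graph with these
edges has no cycles and no vertex of degree three, since the basis contains no affine diagram. -/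
theorem exists_isSubchain {b : κ → Fin 8 → ℤ} (hb : IsObtuseBasis b) {O : Finset κ}
    (hO : O.card = 4) (horth : ∀ i ∈ O, ∀ j ∈ O, i ≠ j → form (b i) (b j) = 0)
    (heven : ∀ x, Even (∑ j ∈ O, form (b x) (b j)))
    (hne : ∀ x ∉ O, ∃ j ∈ O, form (b x) (b j) ≠ 0) :
    ∃ pos, IsSubchain (fun i j => form (b i) (b j)) pos := by
  classical
  obtain ⟨o⟩ : Nonempty (Fin 4 ≃ O) := ⟨(O.equivFinOfCardEq hO).symm⟩
  have ho : ∀ i j : Fin 4, form (b (o i)) (b (o j)) = if i = j then 2 else 0 := by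
    intro i j
    split_ifs with h
    · rw [h, hb.form_self_eq]
    · exact horth _ (o i).2 _ (o j).2 fun h' => h (o.injective (Subtype.ext h'))
  have hxo : ∀ x ∉ O, ∀ i, x ≠ o i := fun x hx i h => hx (h ▸ (o i).2)
  have hval : ∀ x ∉ O, ∀ k, form (b x) (b (o k)) = 0 ∨ form (b x) (b (o k)) = -1 := fun x hx k =>
    hb.form_eq_zero_or (hxo x hx k)
  have hsum : ∀ x, Even (∑ k, form (b x) (b (o k))) := fun x => by
    have := heven x
    rwa [← sum_coe_sort, ← o.sum_comp] at this
  have hpair : ∀ x ∉ O, ∃ i j : Fin 4, i ≠ j ∧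
      ∀ k, form (b x) (b (o k)) = if k = i ∨ k = j then -1 else 0 := by
    intro x hx
    let g : Fin 4 → Bool := fun k => decide (form (b x) (b (o k)) = -1)
    have hg : ∀ k, form (b x) (b (o k)) = if g k then -1 else 0 := fun k => by
      rcases hval x hx k with h | h <;> simp [g, h]
    have h1 := hsum x
    rw [Fin.sum_univ_four] at h1
    obtain ⟨i, j, hij, h⟩ := exists_pair_of_even g
      (by
        rw [hg 0, hg 1, hg 2, hg 3] at h1
        revert h1
        generalize g 0 = p; generalize g 1 = q; generalize g 2 = r; generalize g 3 = s
        revert p q r s; decide)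
      (by
        obtain ⟨j, hj, h⟩ := hne x hx
        refine ⟨o.symm ⟨j, hj⟩, ?_⟩
        have := (hval x hx (o.symm ⟨j, hj⟩)).resolve_left (by simpa using h)
        simpa [g] using this)
      (by
        by_contra! hall
        have h2 : ∀ k, form (b x) (b (o k)) = -1 := fun k => by
          rw [hg, if_pos (by simpa using hall k)]
        -- The diagram would contain the affine diagram `D₄`.
        have := hb.one_le_quad_sum [(2, x), (1, (o 0 : κ)), (1, (o 1 : κ)), (1, (o 2 : κ)),
          (1, (o 3 : κ))] ⟨_, List.mem_cons_self, two_ne_zero⟩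
        simp only [List.map_cons, List.map_nil, List.sum_cons, List.sum_nil, add_zero,
          Nat.cast_ofNat, Nat.cast_one, one_smul, quad_add, quad_smul, map_add, map_smul,
          LinearMap.smul_apply, smul_eq_mul, hb.quad_eq_one, h2, ho] at this
        revert this; decide)
    exact ⟨i, j, hij, fun k => by rw [hg]; simp only [h]⟩
  -- `N x i j` says that the neighbors of `x` among the four are the `i`-th and the `j`-th one.
  let N : κ → Fin 4 → Fin 4 → Prop := fun x i j =>
    x ∉ O ∧ i ≠ j ∧ ∀ k, form (b x) (b (o k)) = if k = i ∨ k = j then -1 else 0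
  -- Distinct vertices outside of the four are orthogonal.
  have hX : ∀ x ∉ O, ∀ y ∉ O, x ≠ y → form (b x) (b y) = 0 := by
    intro x hx y hy hxy
    refine (hb.form_eq_zero_or hxy).resolve_right fun h => ?_
    obtain ⟨i, j, hij, hxn⟩ := hpair x hx
    obtain ⟨i', j', hij', hyn⟩ := hpair y hy
    -- The diagram would contain the affine diagram `D₅`, or a cycle if they had a common neighbor.
    have := hb.one_le_quad_sum [(2, x), (2, y), (1, (o i : κ)), (1, (o j : κ)),
      (1, (o i' : κ)), (1, (o j' : κ))] ⟨_, List.mem_cons_self, two_ne_zero⟩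
    simp only [List.map_cons, List.map_nil, List.sum_cons, List.sum_nil, add_zero,
      Nat.cast_ofNat, Nat.cast_one, one_smul, quad_add, quad_smul, map_add, map_smul,
      LinearMap.smul_apply, smul_eq_mul, hb.quad_eq_one, h, ho, hxn, hyn,
      hij, hij', true_or, or_true, if_true, if_false] at this
    split_ifs at this <;> omega
  -- Two of them with the same neighbors form a cycle.
  have huniq : ∀ x y i j, N x i j → N y i j → x = y := by
    rintro x y i j ⟨hx, hij, hxn⟩ ⟨hy, -, hyn⟩
    by_contra hxy
    have := hb.one_le_quad_sum [(1, x), (1, y), (1, (o i : κ)), (1, (o j : κ))]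
      ⟨_, List.mem_cons_self, one_ne_zero⟩
    simp only [List.map_cons, List.map_nil, List.sum_cons, List.sum_nil, add_zero,
      Nat.cast_one, one_smul, quad_add, map_add,
      hb.quad_eq_one, ho, hxn, hyn, hX x hx y hy hxy,
      hij, true_or, or_true, if_true, if_false] at this
    omega
  -- The graph with an edge between the two neighbors of each vertex outside of the four.
  let E : Fin 4 → Fin 4 → Prop := fun i j => ∃ x, N x i j
  have hEsymm : ∀ i j, E i j ↔ E j i := by
    have : ∀ i j, E i j → E j i := by
      rintro i j ⟨x, hx, hij, h⟩
      exact ⟨x, hx, hij.symm, fun k => by rw [h]; exact if_congr or_comm rfl rfl⟩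
    exact fun i j => ⟨this i j, this j i⟩
  have hEself : ∀ i, ¬ E i i := fun i ⟨x, h⟩ => h.2.1 rfl
  -- Neighbors of different edges are distinct.
  have hxy : ∀ {x y i j i' j'}, N x i j → N y i' j' → (i' ≠ i ∧ i' ≠ j ∨ j' ≠ i ∧ j' ≠ j) →
      form (b x) (b y) = 0 := by
    rintro x y i j i' j' ⟨hx, hij, hxn⟩ ⟨hy, hij', hyn⟩ h
    refine hX x hx y hy ?_
    rintro rfl
    rcases h with ⟨h1, h2⟩ | ⟨h1, h2⟩
    · have := hxn i'
      rw [hyn, if_pos (Or.inl rfl), if_neg (not_or.2 ⟨h1, h2⟩)] at this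
      omega
    · have := hxn j'
      rw [hyn, if_pos (Or.inr rfl), if_neg (not_or.2 ⟨h1, h2⟩)] at this
      omega
  -- Cycles of edges would be cycles of the diagram, and a vertex with three edges would be the center
  -- of the affine diagram `E₆`.
  have htriangle : ∀ i j k, ¬ (E i j ∧ E j k ∧ E k i) := by
    rintro i j k ⟨⟨x, hx⟩, ⟨y, hy⟩, ⟨z, hz⟩⟩
    have h1 := hx.2.1
    have h2 := hy.2.1
    have h3 := hz.2.1
    have := hb.one_le_quad_sum [(1, x), (1, y), (1, z), (1, (o i : κ)), (1, (o j : κ)),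
      (1, (o k : κ))] ⟨_, List.mem_cons_self, one_ne_zero⟩
    simp only [List.map_cons, List.map_nil, List.sum_cons, List.sum_nil, add_zero,
      Nat.cast_one, one_smul, quad_add, map_add,
      hb.quad_eq_one, ho, hx.2.2, hy.2.2, hz.2.2,
      hxy hx hy (Or.inr ⟨h3, h2.symm⟩), hxy hx hz (Or.inl ⟨h3, h2.symm⟩),
      hxy hy hz (Or.inr ⟨h1, h3.symm⟩),
      h1, h2, h3, h1.symm, h2.symm, h3.symm, true_or, or_true, or_self, if_true, if_false] at this
    omega
  have hsquare : ∀ i j k l, i ≠ k → j ≠ l → ¬ (E i j ∧ E j k ∧ E k l ∧ E l i) := by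
    rintro i j k l hik hjl ⟨⟨x, hx⟩, ⟨y, hy⟩, ⟨z, hz⟩, ⟨w, hw⟩⟩
    have h1 := hx.2.1
    have h2 := hy.2.1
    have h3 := hz.2.1
    have h4 := hw.2.1
    have := hb.one_le_quad_sum [(1, x), (1, y), (1, z), (1, w), (1, (o i : κ)), (1, (o j : κ)),
      (1, (o k : κ)), (1, (o l : κ))] ⟨_, List.mem_cons_self, one_ne_zero⟩
    simp only [List.map_cons, List.map_nil, List.sum_cons, List.sum_nil, add_zero,
      Nat.cast_one, one_smul, quad_add, map_add,
      hb.quad_eq_one, ho, hx.2.2, hy.2.2, hz.2.2, hw.2.2,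
      hxy hx hy (Or.inr ⟨hik.symm, h2.symm⟩), hxy hx hz (Or.inl ⟨hik.symm, h2.symm⟩),
      hxy hx hw (Or.inl ⟨h4, hjl.symm⟩), hxy hy hz (Or.inr ⟨hjl.symm, h3.symm⟩),
      hxy hy hw (Or.inr ⟨h1, hik⟩), hxy hz hw (Or.inr ⟨hik, h4.symm⟩),
      h1, h2, h3, h4, hik, hjl, h1.symm, h2.symm, h3.symm, h4.symm, hik.symm, hjl.symm,
      true_or, or_true, or_self, if_true, if_false] at this
    omega
  have hstar : ∀ i j k l, j ≠ k → j ≠ l → k ≠ l → ¬ (E i j ∧ E i k ∧ E i l) := by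
    rintro i j k l hjk hjl hkl ⟨⟨x, hx⟩, ⟨y, hy⟩, ⟨z, hz⟩⟩
    have h1 := hx.2.1
    have h2 := hy.2.1
    have h3 := hz.2.1
    have := hb.one_le_quad_sum [(3, (o i : κ)), (2, x), (2, y), (2, z), (1, (o j : κ)),
      (1, (o k : κ)), (1, (o l : κ))] ⟨_, List.mem_cons_self, three_ne_zero⟩
    simp only [List.map_cons, List.map_nil, List.sum_cons, List.sum_nil, add_zero,
      Nat.cast_ofNat, Nat.cast_one, one_smul, quad_add, quad_smul, map_add, map_smul,
      LinearMap.smul_apply, smul_eq_mul, hb.quad_eq_one, ho,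
      form_comm (b (o i)), hx.2.2, hy.2.2, hz.2.2,
      hxy hx hy (Or.inr ⟨h2.symm, hjk.symm⟩), hxy hx hz (Or.inr ⟨h3.symm, hjl.symm⟩),
      hxy hy hz (Or.inr ⟨h3.symm, hkl.symm⟩),
      h1, h2, h3, hjk, hjl, hkl, h1.symm, h2.symm, h3.symm, hjk.symm, hjl.symm, hkl.symm,
      true_or, or_true, or_self, if_true, if_false] at this
    omega
  obtain ⟨σ, hσ⟩ : ∃ σ : Equiv.Perm (Fin 4), ¬ E (σ 0) (σ 2) ∧ ¬ E (σ 0) (σ 3) ∧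
      ¬ E (σ 1) (σ 3) := by
    let G := fourGraph (E 0 1) (E 0 2) (E 0 3) (E 1 2) (E 1 3) (E 2 3)
    have hG : ∀ i j, G i j = true ↔ E i j := by
      intro i j
      fin_cases i <;> fin_cases j <;>
        simp [G, fourGraph, hEself, hEsymm 1 0, hEsymm 2 0, hEsymm 3 0, hEsymm 2 1, hEsymm 3 1,
          hEsymm 3 2]
    obtain ⟨σ, h⟩ := exists_path_order (E 0 1) (E 0 2) (E 0 3) (E 1 2) (E 1 3) (E 2 3)
      (fun i j k => by
        rw [Bool.eq_false_iff, Ne, Bool.and_eq_true, Bool.and_eq_true, and_assoc]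
        exact fun h => htriangle i j k ⟨(hG _ _).1 h.1, (hG _ _).1 h.2.1, (hG _ _).1 h.2.2⟩)
      (fun i j k l h1 h2 => by
        rw [Bool.eq_false_iff, Ne, Bool.and_eq_true, Bool.and_eq_true, Bool.and_eq_true, and_assoc,
          and_assoc]
        exact fun h => hsquare i j k l h1 h2
          ⟨(hG _ _).1 h.1, (hG _ _).1 h.2.1, (hG _ _).1 h.2.2.1, (hG _ _).1 h.2.2.2⟩)
      (fun i j k l h1 h2 h3 => by
        rw [Bool.eq_false_iff, Ne, Bool.and_eq_true, Bool.and_eq_true, and_assoc]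
        exact fun h => hstar i j k l h1 h2 h3
          ⟨(hG _ _).1 h.1, (hG _ _).1 h.2.1, (hG _ _).1 h.2.2⟩)
    refine ⟨σ, ?_⟩
    rw [← hG, ← hG, ← hG, Bool.not_eq_true, Bool.not_eq_true, Bool.not_eq_true]
    exact h
  have hpath : ∀ x ∉ O, ∃ m : Fin 3, N x (σ m.castSucc) (σ m.succ) := by
    intro x hx
    obtain ⟨i, j, hij, h⟩ := hpair x hx
    obtain ⟨i, rfl⟩ := σ.surjective i
    obtain ⟨j, rfl⟩ := σ.surjective j
    have h1 : N x (σ i) (σ j) := ⟨hx, hij, h⟩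
    have h2 : N x (σ j) (σ i) :=
      ⟨hx, hij.symm, fun k => by rw [h]; exact if_congr or_comm rfl rfl⟩
    have h3 : E (σ i) (σ j) := ⟨x, h1⟩
    have h4 : E (σ j) (σ i) := ⟨x, h2⟩
    fin_cases i <;> fin_cases j
    · exact absurd rfl hij
    · exact ⟨0, h1⟩
    · exact absurd h3 hσ.1
    · exact absurd h3 hσ.2.1
    · exact ⟨0, h2⟩
    · exact absurd rfl hij
    · exact ⟨1, h1⟩
    · exact absurd h3 hσ.2.2
    · exact absurd h4 hσ.1
    · exact ⟨1, h2⟩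
    · exact absurd rfl hij
    · exact ⟨2, h1⟩
    · exact absurd h4 hσ.2.1
    · exact absurd h4 hσ.2.2
    · exact ⟨2, h2⟩
    · exact absurd rfl hij
  choose! m hm using hpath
  let pos : κ → Fin 7 := fun x =>
    if h : x ∈ O then ⟨2 * (σ.symm (o.symm ⟨x, h⟩)).val, by omega⟩
      else ⟨2 * (m x).val + 1, by omega⟩
  have hposO : ∀ k, pos (o (σ k)) = ⟨2 * k.val, by omega⟩ := fun k => by
    simp only [pos, dif_pos (o (σ k)).2, Subtype.coe_eta, Equiv.symm_apply_apply]
  have hposX : ∀ x ∉ O, pos x = ⟨2 * (m x).val + 1, by omega⟩ := fun x hx => dif_neg hx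
  have hcases : ∀ x, x ∉ O ∨ ∃ k, x = o (σ k) := fun x => by
    by_cases hx : x ∈ O
    · exact Or.inr ⟨σ.symm (o.symm ⟨x, hx⟩), by simp⟩
    · exact Or.inl hx
  have hXO : ∀ x ∉ O, ∀ k, form (b x) (b (o (σ k))) = CartanMatrix.A 7 (pos x) (pos (o (σ k))) := by
    intro x hx k
    rw [hposX x hx, hposO, (hm x hx).2.2, cartanMatrix_A_apply]
    simp only [σ.injective.eq_iff, Fin.ext_iff, Fin.val_castSucc, Fin.val_succ]
    split_ifs <;> omega
  refine ⟨pos, fun x y hxy => ?_, fun x y => ?_, fun k => ⟨o (σ k), by rw [hposO]⟩⟩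
  · rcases hcases x with hx | ⟨k, rfl⟩ <;> rcases hcases y with hy | ⟨l, rfl⟩
    · rw [hposX x hx, hposX y hy, Fin.mk.injEq] at hxy
      have hmm : m x = m y := Fin.ext (by omega)
      exact huniq x y _ _ (hm x hx) (hmm ▸ hm y hy)
    · rw [hposX x hx, hposO, Fin.mk.injEq] at hxy
      omega
    · rw [hposO, hposX y hy, Fin.mk.injEq] at hxy
      omega
    · rw [hposO, hposO, Fin.mk.injEq] at hxy
      rw [Fin.ext (a := k) (b := l) (by omega)]
  · rcases hcases x with hx | ⟨k, rfl⟩ <;> rcases hcases y with hy | ⟨l, rfl⟩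
    · rcases eq_or_ne x y with rfl | hxy
      · rw [hb.form_self_eq]
        rw [cartanMatrix_A_apply, if_pos rfl]
      · have hne : m x ≠ m y := fun h => hxy (huniq x y _ _ (hm x hx) (h ▸ hm y hy))
        rw [hX x hx y hy hxy, hposX x hx, hposX y hy, cartanMatrix_A_apply]
        rw [Ne, Fin.ext_iff] at hne
        simp only
        split_ifs <;> omega
    · exact hXO x hx l
    · rw [form_comm, hXO y hy k, cartanMatrix_A_apply, cartanMatrix_A_apply]
      split_ifs <;> first | rfl | omega
    · rw [ho, hposO, hposO, cartanMatrix_A_apply]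
      simp only [σ.injective.eq_iff, Fin.ext_iff]
      split_ifs <;> omega

end

/-! ### Conjugacy of bases -/

section Conjugacy

variable {κ : Type*}

/-- A basis is determined up to conjugacy by its Cartan matrix, unless it is of special type. -/
theorem exists_isSubchain_of_not_conjugate [Fintype κ] {a b : κ → Fin 8 → ℤ}
    (ha : IsObtuseBasis a) (hb : IsObtuseBasis b)
    (hab : ∀ i j, form (a i) (a j) = form (b i) (b j))
    (hconj : ¬ ∃ g ∈ weyl, g '' Set.range a = Set.range b) :
    ∃ pos, IsSubchain (fun i j => form (b i) (b j)) pos := by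
  classical
  have aux : ∀ {a b : κ → Fin 8 → ℤ}, IsObtuseBasis a →
      (∀ i j, form (a i) (a j) = form (b i) (b j)) → ∀ O : Finset κ, O.card = 4 → IsWord a O →
      (∀ S, IsWord b S → S = ∅) → (∀ i ∈ O, ∀ j ∈ O, i ≠ j → form (b i) (b j) = 0) ∧
      (∀ x, Even (∑ j ∈ O, form (b x) (b j))) ∧ ∀ x ∉ O, ∃ j ∈ O, form (b x) (b j) ≠ 0 := by
    intro a b ha hab O hO haO hb
    have horth : ∀ i ∈ O, ∀ j ∈ O, i ≠ j → form (b i) (b j) = 0 := fun i hi j hj hij => by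
      rw [← hab]
      exact ha.form_eq_zero_of_isWord haO haO hi hj hij
    refine ⟨horth, fun x => ?_, fun x hx => ?_⟩
    · rw [← sum_congr rfl fun j _ => hab x j]
      exact haO.even (a x)
    · -- Otherwise `O` and `x` would contain a word of `b`.
      by_contra! hcon
      obtain ⟨w, -, hw, hw'⟩ := exists_isWord_of_card_eq_five (a := b) (F := insert x O)
        (by rw [card_insert_of_notMem hx, hO]) (by
          intro i hi j hj hij
          rcases mem_insert.1 hi with rfl | hi' <;> rcases mem_insert.1 hj with rfl | hj'
          · exact absurd rfl hij
          · exact hcon j hj'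
          · rw [form_comm]; exact hcon i hi'
          · exact horth i hi' j hj' hij)
      exact hw.ne_empty (hb w hw')
  rcases exists_perm_or_exceptional ha hb hab with ⟨σ, hσ, hw⟩ | ⟨O, hO, ⟨h1, h2⟩ | ⟨h1, h2⟩⟩
  · refine absurd ?_ hconj
    obtain ⟨g, hg, h⟩ := exists_weyl_image_eq (a := a ∘ σ) (fun i => ha.quad_eq_one _)
      hb.quad_eq_one (fun i j => (hσ i j).trans (hab i j)) hb.form_nonpos hb.linearIndependent hw
    exact ⟨g, hg, by rwa [σ.surjective.range_comp] at h⟩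
  · obtain ⟨h3, h4, h5⟩ := aux ha hab O hO h1 h2
    exact exists_isSubchain hb hO h3 h4 h5
  · obtain ⟨h3, h4, h5⟩ := aux hb (fun i j => (hab i j).symm) O hO h1 h2
    simp only [hab] at h3 h4 h5
    exact exists_isSubchain hb hO h3 h4 h5

/-- Bases with the same Cartan matrix of special type are conjugate if their perfect mosets have the
same parity. -/
theorem IsSubchain.exists_weyl_image_eq [Fintype κ] {a b : κ → Fin 8 → ℤ} {pos : κ → Fin 7}
    (hc : IsSubchain (fun i j => form (b i) (b j)) pos)
    (ha : IsObtuseBasis a) (hb : IsObtuseBasis b)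
    (hab : ∀ i j, form (a i) (a j) = form (b i) (b j))
    (hw : IsWord a (univ.filter fun i => (pos i).val % 2 = 0) ↔
      IsWord b (univ.filter fun i => (pos i).val % 2 = 0)) :
    ∃ g ∈ weyl, g '' Set.range a = Set.range b := by
  refine PiSystem.exists_weyl_image_eq ha.quad_eq_one hb.quad_eq_one hab hb.form_nonpos
    hb.linearIndependent fun S => ⟨fun h => ?_, fun h => ?_⟩
  · rcases IsSubchain.isWord_eq (a := a) (by simpa only [hab] using hc) ha h with rfl | rfl
    · exact isWord_empty b
    · exact hw.1 h
  · rcases hc.isWord_eq hb h with rfl | rfl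
    · exact isWord_empty a
    · exact hw.2 h

theorem isObtuseBasis_of_orthogonal {a : κ → Fin 8 → ℤ} (ha : ∀ i, quad (a i) = 1)
    (horth : ∀ i j, i ≠ j → form (a i) (a j) = 0) : IsObtuseBasis a where
  quad_eq_one := ha
  form_nonpos i j h := (horth i j h).le
  linearIndependent := by
    classical
    refine linearIndependent_iff'.2 fun s g hg i hi => ?_
    have h : form (∑ j ∈ s, g j • a j) (a i) = 0 := by rw [hg, map_zero, LinearMap.zero_apply]
    rw [map_sum, LinearMap.sum_apply, sum_eq_single_of_mem i hi fun j _ hj => by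
      rw [map_smul, LinearMap.smul_apply, horth j i hj, smul_zero], map_smul, LinearMap.smul_apply,
      form_self, ha, smul_eq_mul] at h
    omega

end Conjugacy

/-! ### The standard moset and the standard chains -/

section Standard

theorem quad_mosetCoeff : ∀ s, quad (mosetCoeff s) = 1 := by decide +kernel

theorem form_mosetCoeff : ∀ s t, s ≠ t → form (mosetCoeff s) (mosetCoeff t) = 0 := by
  decide +kernel

theorem mosetCoeff_injective : Function.Injective mosetCoeff := by
  unfold Function.Injective
  decide +kernel

/-- The parity of a set of four members of the standard moset tells whether it is a word. -/
theorem isWord_mosetCoeff : ∀ S : Finset (Fin 8), S.card = 4 →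
    (IsWord mosetCoeff S ↔ mosetParity S = 0) := by
  unfold IsWord mosetParity
  decide +kernel

theorem mosetParity_eq_one {S : Finset (Fin 8)} (h : mosetParity S ≠ 0) : mosetParity S = 1 := by
  unfold mosetParity at h ⊢
  split_ifs at h ⊢ <;> simp_all

/-- Two bases of type `A₇`: the first one is obtained from the extended basis of `E₇` (which contains
the opposite of the highest root) and the second one from the basis of `E₈`, by omitting `α₂`. -/
def chainCoeff : Fin 2 → Fin 7 → Fin 8 → ℤ :=
  ![![![-2, -2, -3, -4, -3, -2, -1, 0], ![1, 0, 0, 0, 0, 0, 0, 0], ![0, 0, 1, 0, 0, 0, 0, 0],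
      ![0, 0, 0, 1, 0, 0, 0, 0], ![0, 0, 0, 0, 1, 0, 0, 0], ![0, 0, 0, 0, 0, 1, 0, 0],
      ![0, 0, 0, 0, 0, 0, 1, 0]],
    ![![1, 0, 0, 0, 0, 0, 0, 0], ![0, 0, 1, 0, 0, 0, 0, 0], ![0, 0, 0, 1, 0, 0, 0, 0],
      ![0, 0, 0, 0, 1, 0, 0, 0], ![0, 0, 0, 0, 0, 1, 0, 0], ![0, 0, 0, 0, 0, 0, 1, 0],
      ![0, 0, 0, 0, 0, 0, 0, 1]]]

theorem form_chainCoeff : ∀ ε k l,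
    form (chainCoeff ε k) (chainCoeff ε l) - CartanMatrix.A 7 k l = 0 := by
  decide +kernel

theorem isObtuseBasis_chainCoeff (ε : Fin 2) : IsObtuseBasis (chainCoeff ε) where
  quad_eq_one := by revert ε; decide +kernel
  form_nonpos := by revert ε; decide +kernel
  linearIndependent := by
    rw [Fintype.linearIndependent_iff]
    intro g hg
    have h : ∀ k, g 0 * chainCoeff ε 0 k + g 1 * chainCoeff ε 1 k + g 2 * chainCoeff ε 2 k +
        g 3 * chainCoeff ε 3 k + g 4 * chainCoeff ε 4 k + g 5 * chainCoeff ε 5 k +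
        g 6 * chainCoeff ε 6 k = 0 := fun k => by
      have := congrFun hg k
      simpa only [Fin.sum_univ_seven, Pi.add_apply, Pi.smul_apply, smul_eq_mul,
        Pi.zero_apply] using this
    have h0 := h 0; have h1 := h 1; have h2 := h 2; have h3 := h 3
    have h4 := h 4; have h5 := h 5; have h6 := h 6; have h7 := h 7
    clear h hg
    fin_cases ε <;> simp [chainCoeff] at h0 h1 h2 h3 h4 h5 h6 h7 <;> intro i <;> fin_cases i <;>
      simp <;> omega

theorem isWord_chainCoeff : ∀ ε, IsWord (chainCoeff ε) {0, 2, 4, 6} ↔ ε = 0 := by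
  unfold IsWord
  decide +kernel

end Standard

/-! ### Coordinates of the roots -/

section Coordinates

variable {ι M N : Type*} [AddCommGroup M] [Module ℝ M] [AddCommGroup N] [Module ℝ N]

/-- The roots of `P` have coordinates `z`: the injective map `L` from vectors of coordinates to vectors
takes `z i` to the root with index `i`, the brackets are given by the form of the `E₈` lattice, and
the coordinates of the roots are all lattice vectors of norm one. -/
structure IsCoordinates (P : RootPairing ι ℝ M N) [P.IsCrystallographic]
    (L : (Fin 8 → ℤ) →ₗ[ℤ] M) (z : ι → Fin 8 → ℤ) : Prop where
  injective : Function.Injective L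
  root_eq : ∀ i, P.root i = L (z i)
  pairingIn_eq : ∀ i j, P.pairingIn ℤ i j = form (z i) (z j)
  quad_eq_one : ∀ i, quad (z i) = 1
  exists_eq : ∀ a, quad a = 1 → ∃ i, z i = a

theorem form_apply_single (x : Fin 8 → ℤ) (k : Fin 8) :
    form x (Pi.single k 1) = ∑ l, x l * CartanMatrix.E₈ l k := by
  conv_lhs => rw [pi_eq_sum_univ' x]
  simp only [map_sum, map_smul, LinearMap.sum_apply, LinearMap.smul_apply, smul_eq_mul]
  refine sum_congr rfl fun l _ => ?_
  rw [← form_single]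

/-- The coordinates with respect to a basis of simple roots of type `E₈`. By reflecting simple roots, the
coordinates of all roots have norm one, and they are all vectors of norm one since, modulo `2`, all
nonsingular vectors are obtained from simple roots by reflections. -/
theorem exists_isCoordinates [Finite ι] (P : RootPairing ι ℝ M N) [P.IsCrystallographic]
    [P.IsReduced] (b : P.Base) (e : Fin 8 ≃ b.support)
    (hE : ∀ i j, b.cartanMatrix (e i) (e j) = CartanMatrix.E₈ i j) :
    ∃ z, IsCoordinates P (Fintype.linearCombination ℤ fun k => P.root (e k)) z := by
  set L := Fintype.linearCombination ℤ fun k => P.root (e k) with hL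
  let p : ι → (Fin 8 → ℤ) → Prop := fun i c =>
    P.root i = L c ∧ quad c = 1 ∧ ∀ x, P.coroot' i (L x) = (form x c : ℤ)
  have hinj : Function.Injective L := by
    have h : LinearIndependent ℝ fun k => P.root (e k) :=
      b.linearIndepOn_root.comp (fun k => (⟨e k, (e k).2⟩ : (b.support : Set ι)))
        fun k l h => e.injective (Subtype.ext (Subtype.mk.inj h))
    refine (injective_iff_map_eq_zero L).2 fun x hx => funext fun k => ?_
    exact Fintype.linearIndependent_iff.1 (h.restrict_scalars' ℤ) x hx k
  have hrefl : ∀ i j c d, p i c → p j d → p (P.reflectionPerm j i) (c - form c d • d) := by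
    rintro i j c d ⟨h1, h2, h3⟩ ⟨h4, h5, h6⟩
    refine ⟨?_, ?_, fun x => ?_⟩
    · rw [P.root_reflectionPerm, P.reflection_apply, h1, h6, h4, map_sub, map_smul,
        Int.cast_smul_eq_zsmul]
    · rw [quad_sub, quad_smul, map_smul, h2, h5, smul_eq_mul]
      ring
    · rw [P.coroot'_reflectionPerm, LinearMap.comp_apply, LinearEquiv.coe_coe, P.reflection_apply,
        map_sub, h3, map_smul, h6, h4, h3, map_sub, map_smul, smul_eq_mul, smul_eq_mul, form_comm c,
        Int.cast_sub, Int.cast_mul]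
      ring
  have hall : ∀ i, ∃ c, p i c := by
    have hsimple : ∀ i ∈ b.support, ∃ c, p i c := by
      intro i hi
      obtain ⟨k, hk⟩ := e.surjective ⟨i, hi⟩
      obtain rfl : (e k : ι) = i := by rw [hk]
      refine ⟨Pi.single k 1, ?_, ?_, fun x => ?_⟩
      · rw [hL, Fintype.linearCombination_apply_single, one_smul]
      · have h := form_self (Pi.single k (1 : ℤ) : Fin 8 → ℤ)
        have h2 : ∀ k, CartanMatrix.E₈ k k = 2 := by decide
        rw [form_single, h2] at h
        omega
      · rw [form_apply_single, hL, Fintype.linearCombination_apply, map_sum, Int.cast_sum]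
        refine sum_congr rfl fun l _ => ?_
        rw [map_zsmul, ← hE, zsmul_eq_mul, Int.cast_mul]
        exact congrArg _ (P.algebraMap_pairingIn ℤ (e l) (e k)).symm
    intro i
    refine b.induction_reflect i ?_ hsimple ?_
    · rintro i ⟨c, hc⟩
      exact ⟨_, hrefl i i c c hc hc⟩
    · rintro i j ⟨c, hc⟩ hj
      obtain ⟨d, hd⟩ := hsimple j hj
      exact ⟨_, hrefl i j c d hc hd⟩
  choose z hz using hall
  have hzrefl : ∀ i j, z (P.reflectionPerm j i) = z i - form (z i) (z j) • z j := fun i j =>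
    hinj (by rw [← (hz _).1, (hrefl i j _ _ (hz i) (hz j)).1])
  have hred : ∀ x : Fin 8 → ZMod 2, quad x = 1 → ∃ i, red (z i) = x := by
    intro x hx
    refine nonsingular_induction (p := fun x => ∃ i, red (z i) = x) (fun k => ?_) ?_ hx
    · refine ⟨e k, ?_⟩
      have : z (e k) = Pi.single k 1 := hinj (by
        rw [← (hz _).1, hL, Fintype.linearCombination_apply_single, one_smul])
      rw [this]
      ext l
      rw [red_apply]
      by_cases hlk : l = k
      · subst hlk; simp
      · simp [hlk]
    · rintro x y - - hxy ⟨i, rfl⟩ ⟨j, rfl⟩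
      refine ⟨P.reflectionPerm j i, ?_⟩
      rw [form_red] at hxy
      rw [hzrefl, map_sub, map_zsmul, ← Int.cast_smul_eq_zsmul (ZMod 2), hxy, one_smul,
        sub_eq_iff_eq_add, add_assoc, add_self_eq_zero, add_zero]
  refine ⟨z, hinj, fun i => (hz i).1, fun i j => ?_, fun i => (hz i).2.1, fun a ha => ?_⟩
  · have := (hz j).2.2 (z i)
    rw [← (hz i).1] at this
    have h2 := P.algebraMap_pairingIn ℤ i j
    exact Int.cast_injective (α := ℝ) (h2.trans this)
  · obtain ⟨i, hi⟩ := hred (red a) (by rw [quad_red, ha, Int.cast_one])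
    rcases eq_or_eq_neg_of_red_eq (hz i).2.1 ha hi with h | h
    · exact ⟨i, h⟩
    · refine ⟨P.reflectionPerm i i, ?_⟩
      rw [hzrefl, form_self, (hz i).2.1, h]
      module

end Coordinates

/-! ### Sets of roots in coordinates -/

section Transfer

variable {ι M N : Type*} [AddCommGroup M] [Module ℝ M] [AddCommGroup N] [Module ℝ N]

theorem exists_linearCombination_of_mem_closure {κ : Type*} {v : κ → M} {x : M} {s : Set κ}
    (hx : x ∈ AddSubmonoid.closure (v '' s)) :
    ∃ f : s →₀ ℝ, (∀ k, 0 ≤ f k) ∧ Finsupp.linearCombination ℝ (fun k : s => v k) f = x := by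
  induction hx using AddSubmonoid.closure_induction with
  | mem x hx =>
    obtain ⟨k, hk, rfl⟩ := hx
    classical
    exact ⟨Finsupp.single ⟨k, hk⟩ 1, fun l => by
      rw [Finsupp.single_apply]; split_ifs <;> norm_num, by simp⟩
  | zero => exact ⟨0, fun _ => le_rfl, map_zero _⟩
  | add x y _ _ hx hy =>
    obtain ⟨f, hf, rfl⟩ := hx
    obtain ⟨g, hg, rfl⟩ := hy
    exact ⟨f + g, fun k => add_nonneg (hf k) (hg k), map_add _ _ _⟩

/-- The difference of two members of a basis has coefficients of both signs. -/
theorem sub_notMem_closure {κ : Type*} {v : κ → M} {s : Set κ} (hv : LinearIndepOn ℝ v s)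
    {i j : κ} (hi : i ∈ s) (hj : j ∈ s) (hij : i ≠ j) :
    v i - v j ∉ AddSubmonoid.closure (v '' s) := by
  classical
  intro h
  obtain ⟨f, hf, hfx⟩ := exists_linearCombination_of_mem_closure h
  have h1 : f = Finsupp.single ⟨i, hi⟩ 1 - Finsupp.single ⟨j, hj⟩ 1 := by
    refine hv (hfx.trans ?_)
    simp
  have h2 := hf ⟨j, hj⟩
  rw [h1, Finsupp.sub_apply, Finsupp.single_eq_same, Finsupp.single_eq_of_ne (by
    simpa [eq_comm] using hij)] at h2
  norm_num at h2

namespace IsCoordinates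

variable {P : RootPairing ι ℝ M N} [P.IsCrystallographic] {L : (Fin 8 → ℤ) →ₗ[ℤ] M}
  {z : ι → Fin 8 → ℤ} (hz : IsCoordinates P L z)
include hz

theorem coord_injective : Function.Injective z := fun i j h =>
  P.root.injective (by rw [hz.root_eq, hz.root_eq, h])

theorem pairing_eq (i j : ι) : P.pairing i j = (form (z i) (z j) : ℤ) := by
  rw [← hz.pairingIn_eq]
  exact (P.algebraMap_pairingIn ℤ i j).symm

theorem pairing_eq_zero_iff (i j : ι) : P.pairing i j = 0 ↔ form (z i) (z j) = 0 := by
  rw [hz.pairing_eq, Int.cast_eq_zero]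

theorem coord_reflectionPerm (i j : ι) :
    z (P.reflectionPerm j i) = z i - form (z i) (z j) • z j := by
  refine hz.injective ?_
  rw [← hz.root_eq, P.root_reflectionPerm, P.reflection_apply_root, hz.pairing_eq, hz.root_eq,
    hz.root_eq, map_sub, map_smul, Int.cast_smul_eq_zsmul]

theorem exists_weyl_eq (w : P.weylGroup) :
    ∃ g ∈ weyl, ∀ i, z (P.weylGroupToPerm w i) = g (z i) := by
  have hw : P.weylGroupToPerm w ∈ Subgroup.closure (Set.range P.reflectionPerm) := by
    rw [← P.range_weylGroupToPerm]
    exact ⟨w, rfl⟩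
  generalize P.weylGroupToPerm w = π at hw
  induction hw using Subgroup.closure_induction with
  | mem π hπ =>
    obtain ⟨j, rfl⟩ := hπ
    obtain ⟨s, hs, h⟩ := exists_weyl_reflection (hz.quad_eq_one j)
    exact ⟨s, hs, fun i => by rw [hz.coord_reflectionPerm, h]⟩
  | one => exact ⟨1, one_mem _, fun _ => rfl⟩
  | mul π ρ _ _ hπ hρ =>
    obtain ⟨g, hg, h⟩ := hπ
    obtain ⟨g', hg', h'⟩ := hρ
    exact ⟨g * g', mul_mem hg hg', fun i => by
      rw [Equiv.Perm.mul_apply, h, h', LinearEquiv.mul_apply]⟩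
  | inv π _ hπ =>
    obtain ⟨g, hg, h⟩ := hπ
    refine ⟨g⁻¹, inv_mem hg, fun i => ?_⟩
    have := h (π⁻¹ i)
    rw [← Equiv.Perm.mul_apply, mul_inv_cancel, Equiv.Perm.one_apply] at this
    rw [this, ← LinearEquiv.mul_apply, inv_mul_cancel]
    rfl

theorem exists_weylGroup_eq {g : (Fin 8 → ℤ) ≃ₗ[ℤ] (Fin 8 → ℤ)} (hg : g ∈ weyl) :
    ∃ w, ∀ i, z (P.weylGroupToPerm w i) = g (z i) := by
  induction hg using Subgroup.closure_induction with
  | mem s hs =>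
    obtain ⟨r, hr, h⟩ := hs
    obtain ⟨j, rfl⟩ := hz.exists_eq r hr
    have : P.reflectionPerm j ∈ P.weylGroupToPerm.range := by
      rw [P.range_weylGroupToPerm]
      exact Subgroup.subset_closure ⟨j, rfl⟩
    obtain ⟨w, hw⟩ := this
    exact ⟨w, fun i => by rw [hw, hz.coord_reflectionPerm, h]⟩
  | one => exact ⟨1, fun i => by rw [map_one]; rfl⟩
  | mul g g' _ _ h h' =>
    obtain ⟨w, hw⟩ := h
    obtain ⟨w', hw'⟩ := h'
    exact ⟨w * w', fun i => by
      rw [map_mul, Equiv.Perm.mul_apply, hw, hw', LinearEquiv.mul_apply]⟩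
  | inv g _ h =>
    obtain ⟨w, hw⟩ := h
    refine ⟨w⁻¹, fun i => ?_⟩
    have := hw (P.weylGroupToPerm w⁻¹ i)
    rw [← Equiv.Perm.mul_apply, ← map_mul, mul_inv_cancel, map_one, Equiv.Perm.one_apply] at this
    rw [this, ← LinearEquiv.mul_apply, inv_mul_cancel]
    rfl

theorem isConjugate_iff {Λ Λ' : Set ι} :
    IsConjugate P Λ Λ' ↔ ∃ g ∈ weyl, g '' (z '' Λ) = z '' Λ' := by
  have key : ∀ (w : P.weylGroup) (g : (Fin 8 → ℤ) ≃ₗ[ℤ] (Fin 8 → ℤ)),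
      (∀ i, z (P.weylGroupToPerm w i) = g (z i)) →
      (P.weylGroupToPerm w '' Λ = Λ' ↔ g '' (z '' Λ) = z '' Λ') := by
    intro w g h
    rw [← hz.coord_injective.image_injective.eq_iff, Set.image_image, Set.image_image,
      Set.image_congr fun i _ => h i]
  constructor
  · rintro ⟨w, hw⟩
    obtain ⟨g, hg, h⟩ := hz.exists_weyl_eq w
    exact ⟨g, hg, (key w g h).1 hw⟩
  · rintro ⟨g, hg, h'⟩
    obtain ⟨w, h⟩ := hz.exists_weylGroup_eq hg
    exact ⟨w, (key w g h).2 h'⟩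

theorem linearIndepOn_root_iff [Finite ι] (Λ : Set ι) :
    LinearIndepOn ℝ P.root Λ ↔ LinearIndependent ℤ fun i : Λ => z i := by
  classical
  constructor
  · intro h
    have h1 : LinearIndependent ℤ (L ∘ fun i : Λ => z i) := by
      have : (L ∘ fun i : Λ => z i) = fun i : Λ => P.root i := funext fun i => (hz.root_eq i).symm
      rw [this]
      exact LinearIndependent.restrict_scalars' ℤ h
    exact LinearIndependent.of_comp L h1
  · -- A real relation between the roots is a relation between the columns of their Cartan matrix.
    intro h
    have := Fintype.ofFinite Λ
    have hdet := det_form_ne_zero h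
    refine Fintype.linearIndependent_iff.2 fun c hc => congrFun (?_ : c = 0)
    set A : Matrix Λ Λ ℤ := Matrix.of fun i j : Λ => form (z i) (z j) with hA
    have hdet' : (A.map (Int.castRingHom ℝ)).det ≠ 0 := by
      rw [← RingHom.mapMatrix_apply, ← RingHom.map_det]
      simpa using hdet
    refine Matrix.eq_zero_of_vecMul_eq_zero hdet' (funext fun j => ?_)
    have h1 : P.coroot' j (∑ i, c i • P.root i) = 0 := by rw [hc, map_zero]
    rw [map_sum] at h1
    simp only [Matrix.vecMul, dotProduct, Matrix.map_apply, Pi.zero_apply]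
    rw [← h1]
    refine sum_congr rfl fun i _ => ?_
    rw [map_smul, smul_eq_mul]
    exact congrArg _ (hz.pairing_eq i j).symm

/-- In coordinates, `Π`-systems are the linearly independent obtuse sets of roots. -/
theorem isPiSystem_iff [Finite ι] (Λ : Set ι) :
    IsPiSystem P Λ ↔ IsObtuseBasis fun i : Λ => z i := by
  constructor
  · -- If two members had positive product, then their difference would be in the subsystem.
    rintro ⟨Ψ, hΨ, hsub, hli, hbasis⟩
    refine ⟨fun i => hz.quad_eq_one i, fun i j hij => ?_, (hz.linearIndepOn_root_iff Λ).1 hli⟩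
    have hij' : (i : ι) ≠ j := fun h => hij (Subtype.ext h)
    have h2 := form_le_two (hz.quad_eq_one i) (hz.quad_eq_one j)
    have h3 : form (z i) (z j) ≠ 2 := fun h => hij' (hz.coord_injective
      (eq_of_form_eq_two (hz.quad_eq_one i) (hz.quad_eq_one j) h))
    by_contra! h4
    have h5 : form (z i) (z j) = 1 := by omega
    have h6 : P.root (P.reflectionPerm j i) = P.root i - P.root j := by
      rw [hz.root_eq, hz.coord_reflectionPerm, h5, one_smul, map_sub, hz.root_eq, hz.root_eq]
    rcases hbasis _ (hΨ.1 j (hsub j.2) i (hsub i.2)) with h | h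
    · rw [h6] at h
      exact sub_notMem_closure hli i.2 j.2 hij' h
    · rw [h6, neg_sub] at h
      exact sub_notMem_closure hli j.2 i.2 hij'.symm h
  · -- The set is a basis of the subsystem of all roots in its integral span.
    intro h
    have := Fintype.ofFinite Λ
    refine ⟨{i | z i ∈ Submodule.span ℤ (Set.range fun i : Λ => z i)}, ⟨?_, ?_⟩,
      fun i hi => Submodule.subset_span ⟨⟨i, hi⟩, rfl⟩, (hz.linearIndepOn_root_iff Λ).2
      h.linearIndependent, fun i hi => ?_⟩
    · intro i hi j hj
      rw [Set.mem_ofPred_eq, hz.coord_reflectionPerm]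
      exact Submodule.sub_mem _ hj (Submodule.smul_mem _ _ hi)
    · intro i hi j hj k hk
      have : z k = z i + z j := hz.injective (by
        rw [map_add, ← hz.root_eq, ← hz.root_eq, ← hz.root_eq, hk])
      rw [Set.mem_ofPred_eq, this]
      exact Submodule.add_mem _ hi hj
    · obtain ⟨n, hn⟩ := exists_nat_combination (fun i j hij => h.form_nonpos i j hij)
        (hz.quad_eq_one i) hi
      have hmem : L (∑ k : Λ, (n k : ℤ) • z k) ∈ AddSubmonoid.closure (P.root '' Λ) := by
        rw [map_sum]
        refine sum_mem fun k _ => ?_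
        rw [map_smul, ← hz.root_eq, natCast_zsmul]
        exact AddSubmonoid.nsmul_mem _ (AddSubmonoid.subset_closure (Set.mem_image_of_mem _ k.2)) _
      rcases hn with hn | hn
      · left
        rw [hz.root_eq, hn]
        exact hmem
      · right
        rw [hz.root_eq, hn, map_neg, neg_neg]
        exact hmem

end IsCoordinates

end Transfer

/-! ### Perfect mosets of unions of chains -/

section PerfectMoset

variable {ι M N : Type*} [AddCommGroup M] [Module ℝ M] [AddCommGroup N] [Module ℝ N]
  {P : RootPairing ι ℝ M N} {C Λ : Set ι}

theorem diagram_adj {i j : ι} :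
    (diagram P).Adj i j ↔ i ≠ j ∧ (P.pairing i j ≠ 0 ∨ P.pairing j i ≠ 0) :=
  SimpleGraph.fromRel_adj _ i j

theorem IsIrreducible.induction (hC : IsIrreducible P C) {q : ι → Prop} {x : ι} (hx : x ∈ C)
    (hq : q x) (hstep : ∀ i ∈ C, ∀ j ∈ C, (diagram P).Adj i j → q i → q j) {y : ι} (hy : y ∈ C) :
    q y := by
  have h := (SimpleGraph.reachable_iff_reflTransGen _ _).1 (hC.preconnected ⟨x, hx⟩ ⟨y, hy⟩)
  have key : ∀ v : C, Relation.ReflTransGen ((diagram P).induce C).Adj ⟨x, hx⟩ v → q v := by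
    intro v hv
    induction hv with
    | refl => exact hq
    | tail _ hadj ih => exact hstep _ (Subtype.prop _) _ (Subtype.prop _) hadj ih
  exact key ⟨y, hy⟩ h

theorem isIrreducible_singleton (i : ι) : IsIrreducible P {i} := by
  refine (SimpleGraph.connected_iff_exists_forall_reachable _).2 ⟨⟨i, rfl⟩, ?_⟩
  rintro ⟨j, rfl⟩
  exact SimpleGraph.Reachable.refl _

theorem exists_isComponent [Finite ι] {i : ι} (hi : i ∈ Λ) : ∃ C, IsComponent P C Λ ∧ i ∈ C := by
  obtain ⟨C, hC, hmax⟩ := Finite.exists_le_maximal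
    (p := fun Y : Set ι => Y ⊆ Λ ∧ IsIrreducible P Y)
    ⟨Set.singleton_subset_iff.2 hi, isIrreducible_singleton i⟩
  exact ⟨C, hmax, hC rfl⟩

theorem IsComponent.mem_of_adj (hC : IsComponent P C Λ) {i j : ι} (hi : i ∈ C) (hj : j ∈ Λ)
    (hij : (diagram P).Adj i j) : j ∈ C := by
  have h : C ∪ {j} ⊆ Λ ∧ IsIrreducible P (C ∪ {j}) :=
    ⟨Set.union_subset hC.prop.1 (Set.singleton_subset_iff.2 hj),
      SimpleGraph.connected_induce_union hC.prop.2.preconnected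
        (isIrreducible_singleton j).preconnected hi rfl hij⟩
  exact hC.le_of_ge h Set.subset_union_left (Or.inr rfl)

/-- If the members of a set of roots have different positions on a line, such that the neighbors
are those at adjacent positions, and those at odd positions have two neighbors, then its only
perfect moset consists of the members at even positions. -/
theorem isPerfectMoset_iff [Finite ι] {p : ι → ℕ} (hinj : Set.InjOn p Λ)
    (hadj : ∀ i ∈ Λ, ∀ j ∈ Λ, i ≠ j →
      (P.pairing i j ≠ 0 ↔ p i + 1 = p j ∨ p j + 1 = p i))
    (hodd : ∀ i ∈ Λ, p i % 2 = 1 → (∃ j ∈ Λ, p j = p i + 1) ∧ ∃ j ∈ Λ, p j + 1 = p i)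
    {O : Set ι} : IsPerfectMoset P O Λ ↔ O = {i | i ∈ Λ ∧ p i % 2 = 0} := by
  have hadj' : ∀ i ∈ Λ, ∀ j ∈ Λ, ((diagram P).Adj i j ↔ p i + 1 = p j ∨ p j + 1 = p i) := by
    intro i hi j hj
    rw [diagram_adj]
    constructor
    · rintro ⟨hij, h | h⟩
      · exact (hadj i hi j hj hij).1 h
      · exact ((hadj j hj i hi hij.symm).1 h).symm
    · intro h
      have hij : i ≠ j := by rintro rfl; omega
      exact ⟨hij, Or.inl ((hadj i hi j hj hij).2 h)⟩
  -- The members at odd positions are mapped to their successors, within each component.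
  have hsucc : ∀ i, ∃ j, i ∈ Λ → p i % 2 = 1 → j ∈ Λ ∧ p j = p i + 1 := by
    intro i
    by_cases h : i ∈ Λ ∧ p i % 2 = 1
    · obtain ⟨j, hj⟩ := (hodd i h.1 h.2).1
      exact ⟨j, fun _ _ => hj⟩
    · exact ⟨i, fun h1 h2 => absurd ⟨h1, h2⟩ h⟩
  choose s hs using hsucc
  have hsC : ∀ C, IsComponent P C Λ → ∀ i ∈ C, p i % 2 = 1 → s i ∈ C := by
    intro C hC i hi hi'
    have h := hs i (hC.prop.1 hi) hi'
    exact hC.mem_of_adj hi h.1 ((hadj' i (hC.prop.1 hi) _ h.1).2 (Or.inl h.2.symm))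
  have hsinj : Set.InjOn s {i | i ∈ Λ ∧ p i % 2 = 1} := by
    intro i hi j hj hij
    have h1 := hs i hi.1 hi.2
    have h2 := hs j hj.1 hj.2
    rw [hij] at h1
    exact hinj hi.1 hj.1 (by omega)
  constructor
  · rintro ⟨hOΛ, hO⟩
    -- If a member at an even position is missing, the moset consists of the members at odd
    -- positions in its component, and these are too few.
    have heven : ∀ i ∈ Λ, p i % 2 = 0 → i ∈ O := by
      intro i hi hpi
      by_contra hiO
      obtain ⟨C, hC, hiC⟩ := exists_isComponent (P := P) hi
      obtain ⟨⟨-, horth, -⟩, horth', hcard⟩ := hO C hC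
      have halt : ∀ x ∈ C, (x ∈ O ↔ p x % 2 = 1) := by
        intro x hx
        refine hC.prop.2.induction hiC (q := fun x => x ∈ O ↔ p x % 2 = 1)
          (iff_of_false hiO (by omega)) ?_ hx
        intro x hx y hy hxy ih
        have hp := (hadj' x (hC.prop.1 hx) y (hC.prop.1 hy)).1 hxy
        have hne := (hadj x (hC.prop.1 hx) y (hC.prop.1 hy) hxy.ne).2 hp
        have h1 : ¬ (x ∈ O ∧ y ∈ O) := fun h =>
          hne (horth x ⟨h.1, hx⟩ y ⟨h.2, hy⟩ hxy.ne)
        have h2 : ¬ (x ∉ O ∧ y ∉ O) := fun h =>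
          hne (horth' x ⟨hx, h.1⟩ y ⟨hy, h.2⟩ hxy.ne)
        by_cases hxO : x ∈ O <;> by_cases hyO : y ∈ O <;> simp only [hxO, hyO, true_iff,
          false_iff, not_true_eq_false, not_false_eq_true, and_true, true_and] at ih h1 h2 ⊢ <;>
          omega
      -- The member with the smallest position is at an even position and is not a successor.
      obtain ⟨m, hm, hmin⟩ := (Set.toFinite C).exists_minimalFor p C ⟨i, hiC⟩
      have hmin' : ∀ j ∈ C, p m ≤ p j := fun j hj => by
        by_contra! h
        exact absurd (hmin hj h.le) (by omega)
      have hpm : p m % 2 = 0 := by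
        by_contra hpm
        obtain ⟨j, hj, hjm⟩ := (hodd m (hC.prop.1 hm) (by omega)).2
        have := hmin' j (hC.mem_of_adj hm hj ((hadj' m (hC.prop.1 hm) j hj).2 (Or.inr hjm)))
        omega
      have hle : (O ∩ C).ncard ≤ ((C \ O) \ {m}).ncard := by
        have hsub : O ∩ C ⊆ {i | i ∈ Λ ∧ p i % 2 = 1} := fun x hx =>
          ⟨hC.prop.1 hx.2, (halt x hx.2).1 hx.1⟩
        refine Set.ncard_le_ncard_of_injOn s ?_ (hsinj.mono hsub)
        rintro x ⟨hxO, hxC⟩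
        have hx1 := (halt x hxC).1 hxO
        have hsx := hsC C hC x hxC hx1
        have hps := (hs x (hC.prop.1 hxC) hx1).2
        refine ⟨⟨hsx, fun h => ?_⟩, fun h => ?_⟩
        · have := (halt _ hsx).1 h
          omega
        · have := hmin' x hxC
          rw [Set.mem_singleton_iff.1 h] at hps
          omega
      have hmC : m ∈ C \ O := ⟨hm, fun h => by have := (halt m hm).1 h; omega⟩
      have hlt := Set.ncard_sdiff_singleton_lt_of_mem hmC
      omega
    refine Set.Subset.antisymm (fun i hi => ⟨hOΛ hi, ?_⟩) fun i hi => heven i hi.1 hi.2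
    by_contra hpi
    obtain ⟨C, hC, hiC⟩ := exists_isComponent (P := P) (hOΛ hi)
    have h := hs i (hOΛ hi) (by omega)
    have hne : i ≠ s i := fun hsi => by rw [← hsi] at h; omega
    exact (hadj i (hOΛ hi) _ h.1 hne).2 (Or.inl h.2.symm)
      ((hO C hC).1.2.1 i ⟨hi, hiC⟩ _
        ⟨heven _ h.1 (by omega), hsC C hC i hiC (by omega)⟩ hne)
  · rintro rfl
    refine ⟨fun i hi => hi.1, fun C hC => ⟨⟨Set.inter_subset_right, ?_, ?_⟩, ?_, ?_⟩⟩
    · rintro i ⟨⟨hi, hpi⟩, -⟩ j ⟨⟨hj, hpj⟩, -⟩ hij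
      by_contra h
      have := (hadj i hi j hj hij).1 h
      omega
    · rintro i ⟨hiC, hi⟩
      have hpi : p i % 2 = 1 := by
        by_contra h
        exact hi ⟨⟨hC.prop.1 hiC, by omega⟩, hiC⟩
      have h := hs i (hC.prop.1 hiC) hpi
      exact ⟨s i, ⟨⟨h.1, by omega⟩, hsC C hC i hiC hpi⟩,
        (hadj i (hC.prop.1 hiC) _ h.1 fun hsi => by rw [← hsi] at h; omega).2 (Or.inl h.2.symm)⟩
    · rintro i ⟨hiC, hi⟩ j ⟨hjC, hj⟩ hij
      have hpi : p i % 2 ≠ 0 := fun h => hi ⟨hC.prop.1 hiC, h⟩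
      have hpj : p j % 2 ≠ 0 := fun h => hj ⟨hC.prop.1 hjC, h⟩
      by_contra h
      have := (hadj i (hC.prop.1 hiC) j (hC.prop.1 hjC) hij).1 h
      omega
    · have hpi : ∀ i ∈ C \ {i | i ∈ Λ ∧ p i % 2 = 0}, p i % 2 = 1 := fun i hi => by
        by_contra h
        exact hi.2 ⟨hC.prop.1 hi.1, by omega⟩
      have hsub : C \ {i | i ∈ Λ ∧ p i % 2 = 0} ⊆ {i | i ∈ Λ ∧ p i % 2 = 1} := fun i hi =>
        ⟨hC.prop.1 hi.1, hpi i hi⟩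
      refine Set.ncard_le_ncard_of_injOn s (fun i hi => ?_) (hsinj.mono hsub)
      have h := hs i (hC.prop.1 hi.1) (hpi i hi)
      have := hpi i hi
      exact ⟨⟨h.1, by omega⟩, hsC C hC i hi.1 this⟩

end PerfectMoset

/-! ### Charge and parity -/

section Parity

variable {ι M N : Type*} [AddCommGroup M] [Module ℝ M] [AddCommGroup N] [Module ℝ N]
  {P : RootPairing ι ℝ M N}

theorem HasParity.eq {b : P.Base} {e : Fin 8 ≃ b.support} {Λ : Set ι} {ε ε' : ZMod 2}
    (h : HasParity P e Λ ε) (h' : HasParity P e Λ ε') : ε = ε' := by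
  obtain ⟨O, hO⟩ := h.1
  obtain ⟨w, S, hS⟩ := (h.2 O hO).1
  rw [← (h.2 O hO).2 w S hS, (h'.2 O hO).2 w S hS]

variable [P.IsCrystallographic]

namespace IsCoordinates

section

variable {L : (Fin 8 → ℤ) →ₗ[ℤ] M} {z : ι → Fin 8 → ℤ} (hz : IsCoordinates P L z)
  {κ : Type*} {o : κ → ι} {pos : κ → Fin 7}
include hz

theorem isPerfectMoset_iff [Finite ι] (ho : Function.Injective o)
    (hc : IsSubchain (fun x y => form (z (o x)) (z (o y))) pos) {O : Set ι} :
    IsPerfectMoset P O (Set.range o) ↔ O = o '' {x | (pos x).val % 2 = 0} := by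
  classical
  set p : ι → ℕ := Function.extend o (fun x => (pos x).val) 0 with hp
  have hpo : ∀ x, p (o x) = (pos x).val := fun x => ho.extend_apply _ _ _
  have hpar : ∀ k < 7, k % 2 = 0 → ∃ x, (pos x).val = k := by
    intro k hk hk2
    obtain ⟨x, hx⟩ := hc.mem_range ⟨k / 2, by omega⟩
    exact ⟨x, by rw [hx]; simp only; omega⟩
  rw [PiSystem.isPerfectMoset_iff (p := p)]
  · refine Eq.congr_right (Set.ext fun i => ?_)
    constructor
    · rintro ⟨⟨x, rfl⟩, hx⟩
      exact ⟨x, by rwa [hpo] at hx, rfl⟩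
    · rintro ⟨x, hx, rfl⟩
      exact ⟨⟨x, rfl⟩, by rwa [hpo]⟩
  · rintro _ ⟨x, rfl⟩ _ ⟨y, rfl⟩ hxy
    rw [hpo, hpo] at hxy
    rw [hc.injective (Fin.ext hxy)]
  · rintro _ ⟨x, rfl⟩ _ ⟨y, rfl⟩ hxy
    have hne : (pos x).val ≠ (pos y).val := fun h => hxy (by rw [hc.injective (Fin.ext h)])
    rw [hpo, hpo, Ne, hz.pairing_eq_zero_iff, hc.eq_cartan, cartanMatrix_A_apply, if_neg hne]
    split_ifs with h
    · simpa using h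
    · simpa using h
  · rintro _ ⟨x, rfl⟩ hx
    simp only [hpo, Set.exists_range_iff] at hx ⊢
    have := (pos x).isLt
    obtain ⟨y, hy⟩ := hpar ((pos x).val + 1) (by omega) (by omega)
    obtain ⟨y', hy'⟩ := hpar ((pos x).val - 1) (by omega) (by omega)
    exact ⟨⟨y, hy⟩, ⟨y', by omega⟩⟩

theorem hasCharge [Finite ι] (ho : Function.Injective o)
    (hc : IsSubchain (fun x y => form (z (o x)) (z (o y))) pos) :
    HasCharge P (Set.range o) 4 := by
  refine ⟨⟨_, (hz.isPerfectMoset_iff ho hc).2 rfl⟩, fun O hO => ?_⟩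
  have hfin : Finite κ := Finite.of_injective pos hc.injective
  have := Fintype.ofFinite κ
  rw [(hz.isPerfectMoset_iff ho hc).1 hO, Set.ncard_image_of_injective _ ho, ← hc.card_even,
    ← Set.ncard_coe_finset]
  congr 1
  ext x
  simp

end

variable {b : P.Base} {e : Fin 8 ≃ b.support} {z : ι → Fin 8 → ℤ}
  (hz : IsCoordinates P (Fintype.linearCombination ℤ fun k => P.root (e k)) z)
include hz

theorem mapsOntoMoset_iff {w : P.weylGroup} {g : (Fin 8 → ℤ) ≃ₗ[ℤ] (Fin 8 → ℤ)}
    (hwg : ∀ i, z (P.weylGroupToPerm w i) = g (z i)) {O : Set ι} {S : Finset (Fin 8)} :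
    MapsOntoMoset P e w O S ↔ g '' (z '' O) = mosetCoeff '' S := by
  have h1 : mosetRoot P e = (Fintype.linearCombination ℤ fun k => P.root (e k)) ∘ mosetCoeff := rfl
  have h2 : (P.root : ι → M) = (Fintype.linearCombination ℤ fun k => P.root (e k)) ∘ z :=
    funext hz.root_eq
  rw [MapsOntoMoset, h2, h1, Set.image_comp, Set.image_comp, hz.injective.image_injective.eq_iff,
    Set.image_image, Set.image_image, Set.image_congr fun i _ => hwg i]

open Classical in
/-- Four orthogonal roots are conjugate to members of the standard moset, and their parity tells
whether they sum to zero modulo `2`. -/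
theorem hasOrthogonalParity {κ : Type*} [Fintype κ] (hκ : Fintype.card κ = 4) {o : κ → ι}
    (horth : ∀ x y, x ≠ y → form (z (o x)) (z (o y)) = 0) :
    HasOrthogonalParity P e (Set.range o) (if IsWord (z ∘ o) univ then 0 else 1) := by
  have hb : IsObtuseBasis (z ∘ o) :=
    isObtuseBasis_of_orthogonal (fun x => hz.quad_eq_one _) horth
  constructor
  · obtain ⟨S, hS, hword⟩ : ∃ S : Finset (Fin 8), S.card = 4 ∧
        (IsWord mosetCoeff S ↔ IsWord (z ∘ o) univ) := by
      by_cases h : IsWord (z ∘ o) univ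
      · exact ⟨{0, 2, 3, 7}, rfl, iff_of_true ((isWord_mosetCoeff _ rfl).2 (by decide)) h⟩
      · exact ⟨{0, 1, 2, 7}, rfl, iff_of_false (fun h =>
          absurd ((isWord_mosetCoeff _ rfl).1 h) (by decide)) h⟩
    -- As words have four or no elements, the parities determine all words.
    obtain ⟨f⟩ : Nonempty (κ ≃ S) := Fintype.card_eq.1 (by rw [hκ, Fintype.card_coe, hS])
    set m : κ → Fin 8 → ℤ := fun x => mosetCoeff (f x) with hm
    have hmorth : ∀ x y, x ≠ y → form (m x) (m y) = 0 := fun x y hxy =>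
      form_mosetCoeff _ _ fun h => hxy (f.injective (Subtype.ext h))
    have hmb : IsObtuseBasis m :=
      isObtuseBasis_of_orthogonal (fun x => quad_mosetCoeff _) hmorth
    have hmw : IsWord m univ ↔ IsWord mosetCoeff S := by
      unfold IsWord
      rw [← sum_coe_sort S, ← f.sum_comp]
    have hcases : ∀ {a : κ → Fin 8 → ℤ}, IsObtuseBasis a → ∀ T, IsWord a T → T = ∅ ∨ T = univ := by
      intro a ha T hT
      have h1 := ha.four_dvd_card hT
      have h2 := card_le_univ T
      rw [hκ] at h2
      rcases T.eq_empty_or_nonempty with h | h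
      · exact Or.inl h
      · have := Nat.le_of_dvd h.card_pos h1
        exact Or.inr ((card_eq_iff_eq_univ T).1 (by omega))
    obtain ⟨g, hg, h⟩ := exists_weyl_image_eq (a := z ∘ o) (b := m) hb.quad_eq_one hmb.quad_eq_one
      (fun x y => by
        rcases eq_or_ne x y with rfl | hxy
        · rw [hb.form_self_eq, hmb.form_self_eq]
        · exact (horth x y hxy).trans (hmorth x y hxy).symm)
      hmb.form_nonpos hmb.linearIndependent (fun T => ⟨fun hT => by
        rcases hcases hb T hT with rfl | rfl
        · exact isWord_empty _
        · exact hmw.2 (hword.2 hT), fun hT => by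
        rcases hcases hmb T hT with rfl | rfl
        · exact isWord_empty _
        · exact hword.1 (hmw.1 hT)⟩)
    obtain ⟨w, hw⟩ := hz.exists_weylGroup_eq hg
    refine ⟨w, S, (hz.mapsOntoMoset_iff hw).2 ?_⟩
    rw [← Set.range_comp, h]
    ext c
    constructor
    · rintro ⟨x, rfl⟩
      exact ⟨f x, (f x).2, rfl⟩
    · rintro ⟨s, hs, rfl⟩
      exact ⟨f.symm ⟨s, hs⟩, by simp [hm]⟩
  · intro w S hS
    obtain ⟨g, hg, hwg⟩ := hz.exists_weyl_eq w
    have h := (hz.mapsOntoMoset_iff hwg).1 hS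
    have hfin : univ.image (fun x => g (z (o x))) = S.image mosetCoeff := by
      rw [← coe_inj, coe_image, coe_image, coe_univ, Set.image_univ, ← h, ← Set.range_comp,
        ← Set.range_comp]
      rfl
    have hinj : Function.Injective fun x => g (z (o x)) :=
      g.injective.comp hb.linearIndependent.injective
    have hcard : S.card = 4 := by
      rw [← card_image_of_injective S mosetCoeff_injective, ← hfin, card_image_of_injective _ hinj,
        card_univ, hκ]
    have hsum : IsWord mosetCoeff S ↔ IsWord (z ∘ o) univ := by
      unfold IsWord
      rw [← sum_image (f := red) mosetCoeff_injective.injOn, ← hfin, sum_image hinj.injOn,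
        sum_red_map_eq_zero_iff]
      rfl
    rw [isWord_mosetCoeff S hcard] at hsum
    split_ifs with hw
    · exact hsum.2 hw
    · exact mosetParity_eq_one fun h => hw (hsum.1 h)

open Classical in
/-- A `Π`-system of special type has parity `0` if its members at even positions form a word, and parity
`1` otherwise. -/
theorem hasParity [Finite ι] {κ : Type*} [Fintype κ] {o : κ → ι} {pos : κ → Fin 7}
    (ho : Function.Injective o) (hc : IsSubchain (fun x y => form (z (o x)) (z (o y))) pos) :
    HasParity P e (Set.range o)
      (if IsWord (z ∘ o) (univ.filter fun x => (pos x).val % 2 = 0) then 0 else 1) := by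
  refine ⟨⟨_, (hz.isPerfectMoset_iff ho hc).2 rfl⟩, fun O hO => ?_⟩
  set E := univ.filter fun x => (pos x).val % 2 = 0 with hE
  have h := hz.hasOrthogonalParity (κ := E) (by rw [Fintype.card_coe, hE, hc.card_even])
    (o := fun x : E => o x) (fun x y hxy => by
      have hx := (mem_filter.1 x.2).2
      have hy := (mem_filter.1 y.2).2
      have hne : (pos x).val ≠ (pos y).val := fun h =>
        hxy (Subtype.ext (hc.injective (Fin.ext h)))
      rw [hc.eq_cartan, cartanMatrix_A_apply, if_neg hne, if_neg (by omega)])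
  have h1 : Set.range (fun x : E => o x) = O := by
    rw [(hz.isPerfectMoset_iff ho hc).1 hO]
    ext i
    simp [hE]
  have h2 : IsWord (z ∘ fun x : E => o x) univ ↔ IsWord (z ∘ o) E := by
    unfold IsWord
    rw [← sum_coe_sort E]
    rfl
  rw [h1] at h
  simpa only [h2] using h

end IsCoordinates

end Parity

/-! ### Special `Π`-systems -/

section Special

variable {ι M N : Type*} [AddCommGroup M] [Module ℝ M] [AddCommGroup N] [Module ℝ N]
  {P : RootPairing ι ℝ M N} [P.IsCrystallographic]

namespace IsCoordinates

section

variable {L : (Fin 8 → ℤ) →ₗ[ℤ] M} {z : ι → Fin 8 → ℤ} (hz : IsCoordinates P L z)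
include hz

theorem isPiSystem_range_iff [Finite ι] {κ : Type*} {o : κ → ι} (ho : Function.Injective o) :
    IsPiSystem P (Set.range o) ↔ IsObtuseBasis (z ∘ o) := by
  rw [hz.isPiSystem_iff]
  let f := Equiv.ofInjective o ho
  constructor
  · intro h
    exact h.comp f.injective
  · intro h
    have h1 := h.comp f.symm.injective
    have h2 : (z ∘ o) ∘ f.symm = fun i : Set.range o => z i :=
      funext fun i => congrArg z (Equiv.apply_ofInjective_symm ho i)
    rwa [h2] at h1

/-- The `Π`-systems of a given type are the ranges of the families of roots which are bases in
coordinates and have the Cartan matrix of that type. -/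
theorem hasTypeA_iff [Finite ι] {Λ : Set ι} {τ : List ℕ} :
    IsPiSystem P Λ ∧ HasTypeA P Λ τ ↔
      ∃ o : (Σ t : Fin τ.length, Fin (τ.get t)) → ι, Set.range o = Λ ∧ IsObtuseBasis (z ∘ o) ∧
        ∀ x y, form (z (o x)) (z (o y)) =
          Matrix.blockDiagonal' (fun t : Fin τ.length => CartanMatrix.A (τ.get t)) x y := by
  constructor
  · rintro ⟨hΛ, f, hf⟩
    have hinj : Function.Injective fun x => (f x : ι) := Subtype.val_injective.comp f.injective
    have hrange : Set.range (fun x => (f x : ι)) = Λ := 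
      (f.surjective.range_comp Subtype.val).trans Subtype.range_val
    rw [← hrange, hz.isPiSystem_range_iff hinj] at hΛ
    exact ⟨fun x => f x, hrange, hΛ, fun x y => (hz.pairingIn_eq _ _).symm.trans (hf x y)⟩
  · rintro ⟨o, rfl, hb, hform⟩
    have ho : Function.Injective o := Function.Injective.of_comp hb.linearIndependent.injective
    exact ⟨(hz.isPiSystem_range_iff ho).2 hb, Equiv.ofInjective o ho, fun x y =>
      (hz.pairingIn_eq _ _).trans (hform x y)⟩

/-- Special `Π`-systems have a special type. -/
theorem exists_hasTypeA_of_isSpecial [Finite ι] {Λ : Set ι} (h : IsSpecial P Λ) :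
    ∃ τ ∈ specialTypes, HasTypeA P Λ τ := by
  obtain ⟨hΛ, Λ', hΛ', ⟨f, hf⟩, hconj⟩ := h
  have := Fintype.ofFinite Λ
  have hform : ∀ x y : Λ, form (z x) (z y) = form (z (f x)) (z (f y)) := fun x y => by
    have := hf x y
    rw [hz.pairing_eq, hz.pairing_eq] at this
    exact (Int.cast_injective this).symm
  have ha := (hz.isPiSystem_iff Λ).1 hΛ
  have hb : IsObtuseBasis fun x : Λ => z (f x) := ((hz.isPiSystem_iff Λ').1 hΛ').comp f.injective
  obtain ⟨pos, hc⟩ := exists_isSubchain_of_not_conjugate ha hb hform (by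
    rintro ⟨g, hg, h⟩
    refine hconj (hz.isConjugate_iff.2 ⟨g, hg, ?_⟩)
    have h1 : Set.range (fun x : Λ => z x) = z '' Λ := by
      rw [← Function.comp_def, Set.range_comp, Subtype.range_val]
    have h2 : Set.range (fun x : Λ => z (f x)) = z '' Λ' := by
      have : (fun x : Λ => z (f x)) = (z ∘ Subtype.val) ∘ f := rfl
      rw [this, f.surjective.range_comp, Set.range_comp, Subtype.range_val]
    rwa [h1, h2] at h)
  obtain ⟨τ, hτ, k, hk⟩ := hc.exists_equiv
  exact ⟨τ, hτ, k, fun x y => by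
    rw [hz.pairingIn_eq, hform]
    exact hk x y⟩

theorem hasCharge_of_hasTypeA [Finite ι] {Λ : Set ι} {τ : List ℕ} (hτ : τ ∈ specialTypes)
    (hΛ : IsPiSystem P Λ) (h : HasTypeA P Λ τ) : HasCharge P Λ 4 := by
  obtain ⟨p, hp, rfl⟩ := exists_chainTypes_of_mem τ hτ
  obtain ⟨o, rfl, hb, hform⟩ := hz.hasTypeA_iff.1 ⟨hΛ, h⟩
  have ho : Function.Injective o := Function.Injective.of_comp hb.linearIndependent.injective
  have hc := isSubchain_chainPos hp hform
  exact hz.hasCharge ho hc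

theorem isPiSystem_and_hasTypeA_of_isConjugate [Finite ι] {Λ Λ' : Set ι} {τ : List ℕ}
    (hΛ : IsPiSystem P Λ ∧ HasTypeA P Λ τ) (hconj : IsConjugate P Λ Λ') :
    IsPiSystem P Λ' ∧ HasTypeA P Λ' τ := by
  obtain ⟨o, rfl, hb, hform⟩ := hz.hasTypeA_iff.1 hΛ
  obtain ⟨w, rfl⟩ := hconj
  obtain ⟨g, hg, hw⟩ := hz.exists_weyl_eq w
  have hform' : ∀ x y, form (z (P.weylGroupToPerm w (o x))) (z (P.weylGroupToPerm w (o y))) =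
      form (z (o x)) (z (o y)) := fun x y => by rw [hw, hw, form_weyl hg]
  refine hz.hasTypeA_iff.2 ⟨P.weylGroupToPerm w ∘ o, Set.range_comp _ _,
    ⟨fun x => hz.quad_eq_one _, fun x y hxy => ?_, ?_⟩, fun x y => ?_⟩
  · exact (hform' x y).trans_le (hb.form_nonpos x y hxy)
  · have : z ∘ P.weylGroupToPerm w ∘ o = g ∘ z ∘ o := funext fun x => hw (o x)
    rw [this]
    exact hb.linearIndependent.map' g.toLinearMap (LinearMap.ker_eq_bot.2 g.injective)
  · exact (hform' x y).trans (hform x y)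

end

variable {b : P.Base} {e : Fin 8 ≃ b.support} {z : ι → Fin 8 → ℤ}
  (hz : IsCoordinates P (Fintype.linearCombination ℤ fun k => P.root (e k)) z)
include hz

theorem exists_hasParity [Finite ι] {Λ : Set ι} {τ : List ℕ} (hτ : τ ∈ specialTypes)
    (hΛ : IsPiSystem P Λ ∧ HasTypeA P Λ τ) : HasParity P e Λ 0 ∨ HasParity P e Λ 1 := by
  classical
  obtain ⟨p, hp, rfl⟩ := exists_chainTypes_of_mem τ hτ
  obtain ⟨o, rfl, hb, hform⟩ := hz.hasTypeA_iff.1 hΛ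
  have ho : Function.Injective o := Function.Injective.of_comp hb.linearIndependent.injective
  have hc := isSubchain_chainPos hp hform
  have h := hz.hasParity ho hc
  split_ifs at h
  · exact Or.inl h
  · exact Or.inr h

/-- `Π`-systems of the same special type and of the same parity are conjugate. -/
theorem isConjugate_of_hasParity [Finite ι] {Λ Λ' : Set ι} {τ : List ℕ} (hτ : τ ∈ specialTypes)
    (hΛ : IsPiSystem P Λ ∧ HasTypeA P Λ τ) (hΛ' : IsPiSystem P Λ' ∧ HasTypeA P Λ' τ) {ε : ZMod 2}
    (h : HasParity P e Λ ε) (h' : HasParity P e Λ' ε) : IsConjugate P Λ Λ' := by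
  classical
  obtain ⟨p, hp, rfl⟩ := exists_chainTypes_of_mem τ hτ
  obtain ⟨o, rfl, hb, hform⟩ := hz.hasTypeA_iff.1 hΛ
  obtain ⟨o', rfl, hb', hform'⟩ := hz.hasTypeA_iff.1 hΛ'
  have ho : Function.Injective o := Function.Injective.of_comp hb.linearIndependent.injective
  have ho' : Function.Injective o' := Function.Injective.of_comp hb'.linearIndependent.injective
  have hc := isSubchain_chainPos hp hform
  have hc' := isSubchain_chainPos hp hform'
  have h1 := (hz.hasParity ho hc).eq h
  have h2 := (hz.hasParity ho' hc').eq h'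
  have hw : IsWord (z ∘ o) (univ.filter fun x => (chainPos p.1 p.2 x).val % 2 = 0) ↔
      IsWord (z ∘ o') (univ.filter fun x => (chainPos p.1 p.2 x).val % 2 = 0) := by
    rw [← h2] at h1
    split_ifs at h1 with h3 h4 h4
    · exact iff_of_true h3 h4
    · exact absurd h1 zero_ne_one
    · exact absurd h1 one_ne_zero
    · exact iff_of_false h3 h4
  obtain ⟨g, hg, hgr⟩ := IsSubchain.exists_weyl_image_eq (a := z ∘ o) (b := z ∘ o') hc' hb hb'
    (fun x y => (hform x y).trans (hform' x y).symm) hw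
  exact hz.isConjugate_iff.2 ⟨g, hg, by rwa [← Set.range_comp z o, ← Set.range_comp z o']⟩

/-- Parity is invariant under conjugacy. -/
theorem hasParity_of_isConjugate [Finite ι] {Λ Λ' : Set ι} {τ : List ℕ} (hτ : τ ∈ specialTypes)
    (hΛ : IsPiSystem P Λ ∧ HasTypeA P Λ τ) (hconj : IsConjugate P Λ Λ') {ε : ZMod 2}
    (h : HasParity P e Λ ε) : HasParity P e Λ' ε := by
  classical
  obtain ⟨p, hp, rfl⟩ := exists_chainTypes_of_mem τ hτ
  obtain ⟨o, rfl, hb, hform⟩ := hz.hasTypeA_iff.1 hΛ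
  have ho : Function.Injective o := Function.Injective.of_comp hb.linearIndependent.injective
  obtain ⟨w, rfl⟩ := hconj
  obtain ⟨g, hg, hw⟩ := hz.exists_weyl_eq w
  have hc := isSubchain_chainPos hp hform
  have hc' : IsSubchain (fun x y => form (z (P.weylGroupToPerm w (o x)))
      (z (P.weylGroupToPerm w (o y)))) (chainPos p.1 p.2) := by
    simpa only [hw, form_weyl hg] using hc
  have h1 := hz.hasParity ((P.weylGroupToPerm w).injective.comp ho) hc'
  have h2 : ∀ S, IsWord (z ∘ P.weylGroupToPerm w ∘ o) S ↔ IsWord (z ∘ o) S := fun S => by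
    have : z ∘ P.weylGroupToPerm w ∘ o = g ∘ z ∘ o := funext fun x => hw (o x)
    rw [this]
    exact sum_red_map_eq_zero_iff g (z ∘ o) S
  rw [← (hz.hasParity ho hc).eq h, ← Set.range_comp]
  simpa only [h2] using h1

/-- Each special type occurs with both parities, within the standard bases of type `A₇`. -/
theorem exists_isPiSystem_hasParity [Finite ι] {τ : List ℕ} (hτ : τ ∈ specialTypes) (ε : Fin 2) :
    ∃ Λ, (IsPiSystem P Λ ∧ HasTypeA P Λ τ) ∧ HasParity P e Λ (if ε = 0 then 0 else 1) := by
  classical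
  obtain ⟨p, hp, rfl⟩ := exists_chainTypes_of_mem τ hτ
  have hb : IsObtuseBasis (chainCoeff ε ∘ chainPos p.1 p.2) :=
    (isObtuseBasis_chainCoeff ε).comp (chainPos_injective p hp)
  have hex : ∀ x, ∃ i, z i = chainCoeff ε (chainPos p.1 p.2 x) := fun x =>
    hz.exists_eq _ (hb.quad_eq_one x)
  choose o hoz using hex
  have hzo : z ∘ o = chainCoeff ε ∘ chainPos p.1 p.2 := funext hoz
  have hform : ∀ x y, form (z (o x)) (z (o y)) =
      Matrix.blockDiagonal' (fun t : Fin p.1.length => CartanMatrix.A (p.1.get t)) x y := by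
    intro x y
    rw [hoz, hoz, chainPos_cartan hp]
    exact sub_eq_zero.1 (form_chainCoeff ε _ _)
  have ho : Function.Injective o := Function.Injective.of_comp (f := z) (by
    rw [hzo]; exact hb.linearIndependent.injective)
  have hc := isSubchain_chainPos hp hform
  refine ⟨Set.range o, hz.hasTypeA_iff.2 ⟨o, rfl, by rwa [hzo], hform⟩, ?_⟩
  have h := hz.hasParity ho hc
  have hw : IsWord (z ∘ o) (univ.filter fun x => (chainPos p.1 p.2 x).val % 2 = 0) ↔ ε = 0 := by
    rw [← isWord_chainCoeff, hzo, ← hc.map_even]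
    unfold IsWord
    rw [sum_map]
    rfl
  simpa only [hw] using h

end IsCoordinates

end Special

end PiSystem


theorem theorem4p6 {ι M N : Type*} [Finite ι] [AddCommGroup M] [Module ℝ M]
    [AddCommGroup N] [Module ℝ N] (P : RootPairing ι ℝ M N) [P.IsRootSystem]
    [P.IsCrystallographic] [P.IsReduced] (b : P.Base) (e : Fin 8 ≃ b.support)
    (hE : ∀ i j, b.cartanMatrix (e i) (e j) = CartanMatrix.E₈ i j) :
    (∀ Λ : Set ι, PiSystem.IsSpecial P Λ ↔
      PiSystem.IsPiSystem P Λ ∧ ∃ τ ∈ PiSystem.specialTypes, PiSystem.HasTypeA P Λ τ) ∧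
    (∀ Λ : Set ι, PiSystem.IsSpecial P Λ → PiSystem.HasCharge P Λ 4) ∧
    ∀ τ ∈ PiSystem.specialTypes, ∃ Λ₀ Λ₁ : Set ι,
      PiSystem.weylOrbit P Λ₀ ≠ PiSystem.weylOrbit P Λ₁ ∧
      {Λ : Set ι | PiSystem.IsPiSystem P Λ ∧ PiSystem.HasTypeA P Λ τ} =
        PiSystem.weylOrbit P Λ₀ ∪ PiSystem.weylOrbit P Λ₁ ∧
      (∀ Λ ∈ PiSystem.weylOrbit P Λ₀, PiSystem.HasParity P e Λ 0) ∧
      ∀ Λ ∈ PiSystem.weylOrbit P Λ₁, PiSystem.HasParity P e Λ 1 := by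
  obtain ⟨z, hz⟩ := PiSystem.exists_isCoordinates P b e hE
  refine ⟨fun Λ => ⟨fun h => ⟨h.1, hz.exists_hasTypeA_of_isSpecial h⟩, ?_⟩, fun Λ h => ?_,
    fun τ hτ => ?_⟩
  · rintro ⟨hΛ, τ, hτ, h⟩
    -- The standard `Π`-system of the same type and of the other parity is not conjugate to `Λ`.
    obtain ⟨Λ', hΛ', hconj⟩ : ∃ Λ', (PiSystem.IsPiSystem P Λ' ∧ PiSystem.HasTypeA P Λ' τ) ∧
        ¬ PiSystem.IsConjugate P Λ Λ' := by
      rcases hz.exists_hasParity hτ ⟨hΛ, h⟩ with h0 | h1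
      · obtain ⟨Λ', hΛ', h'⟩ := hz.exists_isPiSystem_hasParity hτ 1
        exact ⟨Λ', hΛ', fun hconj => absurd
          ((hz.hasParity_of_isConjugate hτ ⟨hΛ, h⟩ hconj h0).eq h') (by decide)⟩
      · obtain ⟨Λ', hΛ', h'⟩ := hz.exists_isPiSystem_hasParity hτ 0
        exact ⟨Λ', hΛ', fun hconj => absurd
          ((hz.hasParity_of_isConjugate hτ ⟨hΛ, h⟩ hconj h1).eq h') (by decide)⟩
    refine ⟨hΛ, Λ', hΛ'.1, ?_, hconj⟩
    obtain ⟨f, hf⟩ := h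
    obtain ⟨f', hf'⟩ := hΛ'.2
    refine ⟨f.symm.trans f', fun x y => ?_⟩
    rw [← P.algebraMap_pairingIn ℤ, ← P.algebraMap_pairingIn ℤ]
    have := hf (f.symm x) (f.symm y)
    rw [f.apply_symm_apply, f.apply_symm_apply] at this
    rw [this]
    exact congrArg _ (hf' _ _)
  · obtain ⟨τ, hτ, hτ'⟩ := hz.exists_hasTypeA_of_isSpecial h
    exact hz.hasCharge_of_hasTypeA hτ h.1 hτ'
  · obtain ⟨Λ₀, hΛ₀, h₀⟩ := hz.exists_isPiSystem_hasParity hτ 0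
    obtain ⟨Λ₁, hΛ₁, h₁⟩ := hz.exists_isPiSystem_hasParity hτ 1
    rw [if_pos rfl] at h₀
    rw [if_neg one_ne_zero] at h₁
    have hrefl : Λ₁ ∈ PiSystem.weylOrbit P Λ₁ := hz.isConjugate_iff.2 ⟨1, one_mem _, by
      rw [LinearEquiv.coe_one, Set.image_id]⟩
    refine ⟨Λ₀, Λ₁, fun h => ?_, Set.ext fun Λ => ⟨fun hΛ => ?_, ?_⟩,
      fun Λ hΛ => hz.hasParity_of_isConjugate hτ hΛ₀ hΛ h₀,
      fun Λ hΛ => hz.hasParity_of_isConjugate hτ hΛ₁ hΛ h₁⟩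
    · rw [← h] at hrefl
      exact absurd ((hz.hasParity_of_isConjugate hτ hΛ₀ hrefl h₀).eq h₁) (by decide)
    · rcases hz.exists_hasParity hτ hΛ with h | h
      · exact Or.inl (hz.isConjugate_of_hasParity hτ hΛ₀ hΛ h₀ h)
      · exact Or.inr (hz.isConjugate_of_hasParity hτ hΛ₁ hΛ h₁ h)
    · rintro (h | h)
      · exact hz.isPiSystem_and_hasTypeA_of_isConjugate hΛ₀ h
      · exact hz.isPiSystem_and_hasTypeA_of_isConjugate hΛ₁ h
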